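/- A 2-orbifold with cone points is a Hausdorff paracompact space $\mathcal{O}$ together with an index function $\mathcal{O}\to\mathbb{Z}_{\ge 1}$ such that every point $x$ has an open neighbourhood homeomorphic to $\mathbb{C}/\mu_q$, where $q$ is the index of $x$ and $\mu_q$ is the group of $q$-th roots of unity acting by rotations, with $x$ corresponding to $0$ and all other points of the neighbourhood of index $1$; the points of index $q>1$ are called singular, those of index $1$ ordinary. Such a $\mathcal O$ is denoted $S^2(q_1,q_2,q_3)$ if its underlying space is homeomorphic to $S^2$ and it has exactly three singular points $x_1,x_2,x_3$, of indices $q_1,q_2,q_3$. A map $f:\mathcal{O}_1\to\mathcal{O}_2$ is an orbifold covering if every $p\in\mathcal{O}_2$ has an open neighbourhood $U\cong\mathbb{C}/\mu_b$ as above such that $f^{-1}(U)$ is a disjoint union of open sets $V_\lambda\cong\mathbb{C}/\mu_{a_\lambda}$ as above, with $\mu_{a_\lambda}\le\mu_b$ and $f|_{V_\lambda}$ the natural quotient map $\mathbb{C}/\mu_{a_\lambda}\to\mathbb{C}/\mu_b$. Its degree is the number of preimages of any ordinary point $y \in\mathcal{O}_2$. If $f^{-1}(x)=\{a_1,\dots,a_i\}$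 and $f$ is locally equivalent to $z\mapsto z^{d_j}$ at $a_j$ (with $a_j$ and $x$ corresponding to $0$), the covering data of $f$ at $x$ is the multiset $D(x)=[d_1,\dots,d_i]$. Let $D(\mathcal{O})$ be the set of degrees of orbifold self-coverings $\mathcal{O}\to\mathcal{O}$. For each of the three orbifolds below, every orbifold self-covering has a well-defined finite degree, and the following hold. **Proposition.** (1) For $\mathcal{O}=S^2(2,3,6)$, $D(\mathcal{O})=\{m^2+mn+n^2 \mid m,n\in\mathbb{Z},\ (m,n)\neq(0,0)\}$. Moreover, if $d\in D(\mathcal{O})$ is coprime to $6$, then $d\equiv 1 \bmod 6$; and every orbifold self-covering of $\mathcal O$ of degree $d=6k+1$ has covering data $$D(x_1)=[\underbrace{2,\dots,2}_{3k},1],\quad D(x_2)=[\underbrace{3,\dots,3}_{2k},1],\quad D(x_3)=[\underbrace{6,\dots,6}_{k},1],$$ where $x_1,x_2,x_3$ are the singular points of indices $2,3,6$. (2) For $\mathcal{O}=S^2(3,3,3)$, $D(\mathcal{O})=\{m^2+mn+n^2 \mid m,n\in\mathbb{Z},\ (m,n)\neq(0,0)\}$. Moreover, if $d\in D(\mathcal{O})$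 is coprime to $3$, then $d\equiv 1 \bmod 3$; and every orbifold self-covering of $\mathcal O$ of degree $d=3k+1$ has covering data $$D(x_1)=D(x_2)=D(x_3)=[\underbrace{3,\dots,3}_{k},1],$$ where $x_1,x_2,x_3$ are the singular points. (3) For $\mathcal{O}=S^2(2,4,4)$, $D(\mathcal{O})=\{m^2+n^2 \mid m,n\in\mathbb{Z},\ (m,n)\neq(0,0)\}$. Moreover, if $d\in D(\mathcal{O})$ is coprime to $4$, then $d\equiv 1 \bmod 4$; and every orbifold self-covering of $\mathcal O$ of degree $d=4k+1$ has covering data $$D(x_1)=[\underbrace{2,\dots,2}_{2k},1],\quad D(x_2)=D(x_3)=[\underbrace{4,\dots,4}_{k},1],$$ where $x_1,x_2,x_3$ are the singular points of indices $2,4,4$. -/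

import Mathlib

/-- `φ : ℂ → X` is a folding chart with group `μ_n` for the index function `index`:
`φ` is continuous and open and its fibres are exactly the orbits of the rotation group
`μ_n = {ζ | ζ ^ n = 1}`, so that it induces a homeomorphism of the quotient `ℂ / μ_n` onto the
open set `range φ`; the image of the origin has index `n` and every other point of `range φ` is
an ordinary point (index `1`). -/
structure IsFoldingChart {X : Type*} [TopologicalSpace X] (index : X → ℕ) (n : ℕ)
    (φ : ℂ → X) : Prop where
  pos : 0 < n
  continuous : Continuous φ
  isOpenMap : IsOpenMap φ
  fibre : ∀ z w : ℂ, φ z = φ w ↔ ∃ ζ : ℂ, ζ ^ n = 1 ∧ w = ζ * z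
  index_zero : index (φ 0) = n
  index_ne_zero : ∀ z : ℂ, z ≠ 0 → index (φ z) = 1

/-- A (topological) 2-orbifold all of whose singular points are cone points, on the space `X`:
`X` is Hausdorff and paracompact and every point `x` has a neighbourhood homeomorphic to the
quotient `ℂ / μ_n` by rotations, `n = index x`, with `x` at the origin. The singular points are
the points with `index x > 1`. -/
structure ConeOrbifold (X : Type*) [TopologicalSpace X] where
  index : X → ℕ
  t2 : T2Space X
  paracompact : ParacompactSpace X
  exists_chart : ∀ x : X, ∃ (n : ℕ) (φ : ℂ → X), IsFoldingChart index n φ ∧ φ 0 = x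

namespace ConeOrbifold

variable {X Y : Type*} [TopologicalSpace X] [TopologicalSpace Y]

/-- `f` is an orbifold covering: every point `p` of the target has an open neighbourhood
`U = range ψ ≅ ℂ / μ_b` (with `p` at the origin) whose preimage is the disjoint union of open
sets `V = range φ ≅ ℂ / μ_a`, on each of which `f` is the natural map `ℂ / μ_a → ℂ / μ_b`
(that is `f ∘ φ = ψ`, which forces `μ_a ≤ μ_b`). -/
def IsCovering (O₁ : ConeOrbifold X) (O₂ : ConeOrbifold Y) (f : X → Y) : Prop :=
  ∀ p : Y, ∃ (b : ℕ) (ψ : ℂ → Y), IsFoldingChart O₂.index b ψ ∧ ψ 0 = p ∧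
    ∃ 𝒱 : Set (Set X), 𝒱.PairwiseDisjoint id ∧ f ⁻¹' Set.range ψ = ⋃₀ 𝒱 ∧
      ∀ V ∈ 𝒱, ∃ (a : ℕ) (φ : ℂ → X),
        IsFoldingChart O₁.index a φ ∧ Set.range φ = V ∧ ∀ z : ℂ, f (φ z) = ψ z

/-- `f` has (finite) degree `d`: every ordinary point of the target has exactly `d` preimages. -/
def HasDegree (O₂ : ConeOrbifold Y) (f : X → Y) (d : ℕ) : Prop :=
  ∀ y : Y, O₂.index y = 1 → (f ⁻¹' {y}).encard = d

/-- The set of degrees of orbifold self-coverings of `O`. -/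
def selfCoveringDegrees (O : ConeOrbifold X) : Set ℕ :=
  {d | ∃ f : X → X, O.IsCovering O f ∧ O.HasDegree f d}

/-- At the point `a`, the map `f` is locally equivalent to `z ↦ z ^ e` on `ℂ`, with `a` and
`f a` corresponding to `0`. -/
def HasLocalDegree (f : X → Y) (a : X) (e : ℕ) : Prop :=
  0 < e ∧ ∃ (φ : ℂ → X) (ψ : ℂ → Y), Topology.IsOpenEmbedding φ ∧ Topology.IsOpenEmbedding ψ ∧
    φ 0 = a ∧ ψ 0 = f a ∧ ∀ z : ℂ, f (φ z) = ψ (z ^ e)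

/-- The covering data of `f` at `x` is the multiset `D`: the fibre over `x` is finite and `D` is
the multiset of the local degrees of `f` at the points of this fibre. -/
def HasCoveringData (f : X → Y) (x : Y) (D : Multiset ℕ) : Prop :=
  ∃ (h : (f ⁻¹' {x}).Finite) (e : X → ℕ),
    (∀ a ∈ f ⁻¹' {x}, HasLocalDegree f a (e a)) ∧ D = h.toFinset.val.map e

/-- `O` is the orbifold `S²(q 0, q 1, q 2)` with singular points `x 0, x 1, x 2`: the underlying
space is homeomorphic to the 2-sphere, the three points are distinct, `x i` has index `q i`, and
there are no other singular points. -/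
structure IsSphereWith (O : ConeOrbifold X) (q : Fin 3 → ℕ) (x : Fin 3 → X) : Prop where
  homeo : Nonempty (X ≃ₜ Metric.sphere (0 : EuclideanSpace ℝ (Fin 3)) 1)
  injective : Function.Injective x
  index_eq : ∀ i, O.index (x i) = q i
  index_eq_one : ∀ y, y ∉ Set.range x → O.index y = 1

end ConeOrbifold

/-!
Each of the three orbifolds is the quotient of the plane by a group `Γ` of rotations and
translations, and every orbifold self-covering lifts to a homeomorphism of the plane at bounded
distance from a similarity.

Let `ρ` be a primitive root of unity of order `q = 3`, `4` or `6`, with trace `t = -1`, `0` or `1`,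
and let `Γ` be the group of all maps `z ↦ ζ z + l` with `ζ ^ q = 1` and `l` in `Λ = ℤ + ℤ ρ`. A
uniformization of an orbifold is an open surjection `π` from the plane whose fibres are the orbits
of `Γ` and for which the index of `π z` is the order of the stabilizer of `z`.

*Existence.* The underlying space is only known to be a sphere, so it suffices to find a continuous
`Γ`-invariant map from the plane to `ℝ³ ∖ 0` that separates orbits along rays and meets every ray
(`exists_isUniformization`); the sphere being homogeneous on triples of distinct points, the three
special orbits can then be moved to the given singular points. For `q = 3` the map is given by the
sum and the alternating product of the three characters
`exp (2πix)`, `exp (-2πiy)`, `exp (2πi(y-x))` of `x + y ρ`, which `ρ` permutes cyclically. Three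
numbers of norm one with product one are determined up to cyclic order by these two invariants,
which range over a surface that every ray meets exactly once
(`IsUnitTriple.eq_rotate_of_smul`, `exists_isUnitTriple_smul`). For `q = 6` and `q = 4` the group
has a subgroup of index two with a similar map, and the quotient of the sphere by a half-turn is a
sphere (`exists_isUniformization_of_halfTurn`).

*Degrees.* Multiplication by `a = m + n ρ ≠ 0` maps `Λ` into itself and so induces a covering
(`IsUniformization.exists_isCovering`). Conversely `f ∘ π` lifts through `π` for every
self-covering `f`: lifts exist locally because a covering is in suitable charts the identity of a
disc in the plane, two lifts over a convex open set differ by an element of `Γ`, and so lifts over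
small rectangles can be glued (`IsUniformization.exists_lift`). The lift is at bounded distance from
a real-linear bijection, hence a proper local homeomorphism of the plane, hence a homeomorphism. It
is equivariant with respect to an endomorphism of `Γ`, given on `Λ` by multiplication by a nonzero
`a = m + n ρ`, up to complex conjugation (`IsUniformization.exists_isEquivariantLift`). Counting the
classes of `Λ` modulo `a Λ` shows that the degree is the norm `m ^ 2 + t m n + n ^ 2` of `a`
(`IsUniformization.exists_hasDegree`, `IsUniformization.selfCoveringDegrees_eq`).

*Covering data.* If `f` has local degree `e` at `y`, then `e` times the index of `y` is the index of
`f y`, and the local degrees over a point add up to the degree. Over a point of index `Q` the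
local degree is therefore `Q` except possibly at singular points of the fibre, of which there are at
most three, and when the degree is `1` modulo the largest index, this leaves a single singular point
of local degree `1` (`ConeOrbifold.hasCoveringData_of_arith`).
-/

open Metric Topology

open scoped ComplexConjugate

/-! ### The lattice spanned by a crystallographic rotation -/

/-- `ρ` is a primitive `q`-th root of unity with `q ≥ 3` that is a root of `X² - t X + 1` for an
integer `t`. This forces `(q, t)` to be `(3, -1)`, `(4, 0)` or `(6, 1)`, so that `ρ` generates the
rotation group of a crystallographic group of rotations and translations of the plane. -/
structure IsCrystRotation (q : ℕ) (ρ : ℂ) (t : ℤ) : Prop where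
  prim : IsPrimitiveRoot ρ q
  three_le : 3 ≤ q
  sq : ρ ^ 2 = t * ρ - 1

/-- The lattice `ℤ + ℤ ρ`. -/
def rotLattice (ρ : ℂ) : AddSubgroup ℂ where
  carrier := {z | ∃ m n : ℤ, z = m + n * ρ}
  add_mem' := by
    rintro _ _ ⟨a, b, rfl⟩ ⟨c, d, rfl⟩
    exact ⟨a + c, b + d, by push_cast; ring⟩
  zero_mem' := ⟨0, 0, by simp⟩
  neg_mem' := by
    rintro _ ⟨a, b, rfl⟩
    exact ⟨-a, -b, by push_cast; ring⟩

/-- `z` and `w` lie in the same orbit of the group of all maps `z ↦ ζ z + l` with `ζ ^ q = 1` and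
`l` in the lattice `ℤ + ℤ ρ`. -/
def SameOrbit (q : ℕ) (ρ z w : ℂ) : Prop :=
  ∃ ζ : ℂ, ζ ^ q = 1 ∧ ∃ l ∈ rotLattice ρ, w = ζ * z + l

theorem one_mem_rotLattice (ρ : ℂ) : (1 : ℂ) ∈ rotLattice ρ := ⟨1, 0, by simp⟩

theorem self_mem_rotLattice (ρ : ℂ) : ρ ∈ rotLattice ρ := ⟨0, 1, by simp⟩

namespace IsCrystRotation

variable {q : ℕ} {ρ : ℂ} {t : ℤ}

theorem q_pos (h : IsCrystRotation q ρ t) : 0 < q := by have := h.three_le; omega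

theorem norm_eq_one (h : IsCrystRotation q ρ t) : ‖ρ‖ = 1 :=
  h.prim.norm'_eq_one h.q_pos.ne'

theorem norm_root (h : IsCrystRotation q ρ t) {ζ : ℂ} (hζ : ζ ^ q = 1) : ‖ζ‖ = 1 :=
  Complex.norm_eq_one_of_pow_eq_one hζ h.q_pos.ne'

theorem root_ne_zero (h : IsCrystRotation q ρ t) {ζ : ℂ} (hζ : ζ ^ q = 1) : ζ ≠ 0 := by
  rintro rfl
  simp [h.q_pos.ne'] at hζ

theorem exists_pow (h : IsCrystRotation q ρ t) {ζ : ℂ} (hζ : ζ ^ q = 1) :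
    ∃ j < q, ρ ^ j = ζ := by
  have : NeZero q := ⟨h.q_pos.ne'⟩
  exact h.prim.eq_pow_of_pow_eq_one hζ

theorem mul_mem (h : IsCrystRotation q ρ t) {z w : ℂ} (hz : z ∈ rotLattice ρ)
    (hw : w ∈ rotLattice ρ) : z * w ∈ rotLattice ρ := by
  obtain ⟨a, b, rfl⟩ := hz
  obtain ⟨c, d, rfl⟩ := hw
  refine ⟨a * c - b * d, a * d + b * c + t * b * d, ?_⟩
  push_cast
  linear_combination (b * d : ℂ) * h.sq

theorem root_mem (h : IsCrystRotation q ρ t) {ζ : ℂ} (hζ : ζ ^ q = 1) : ζ ∈ rotLattice ρ := by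
  obtain ⟨j, -, rfl⟩ := h.exists_pow hζ
  clear hζ
  induction j with
  | zero => simpa using one_mem_rotLattice ρ
  | succ j ih => rw [pow_succ]; exact h.mul_mem ih (self_mem_rotLattice ρ)

theorem ne_zero (h : IsCrystRotation q ρ t) : ρ ≠ 0 := h.root_ne_zero h.prim.pow_eq_one

theorem conj_eq (h : IsCrystRotation q ρ t) : (starRingEnd ℂ) ρ = t - ρ := by
  have h1 : ρ * (starRingEnd ℂ) ρ = 1 := by
    rw [Complex.mul_conj, Complex.normSq_eq_norm_sq, h.norm_eq_one]; simp
  apply mul_left_cancel₀ h.ne_zero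
  rw [h1]
  linear_combination h.sq

theorem conj_mem (h : IsCrystRotation q ρ t) {z : ℂ} (hz : z ∈ rotLattice ρ) :
    (starRingEnd ℂ) z ∈ rotLattice ρ := by
  obtain ⟨a, b, rfl⟩ := hz
  refine ⟨a + b * t, -b, ?_⟩
  simp only [map_add, map_mul, map_intCast, h.conj_eq]
  push_cast
  ring

theorem im_ne_zero (h : IsCrystRotation q ρ t) : ρ.im ≠ 0 := by
  intro him
  have hre : ρ = (ρ.re : ℂ) := by apply Complex.ext <;> simp [him]
  have hn := h.norm_eq_one
  rw [hre, Complex.norm_real, Real.norm_eq_abs] at hn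
  have hsq : ρ ^ 2 = 1 := by
    rw [hre, ← Complex.ofReal_pow, ← sq_abs, hn]; simp
  have := h.prim.dvd_of_pow_eq_one 2 hsq
  have := Nat.le_of_dvd (by norm_num) this
  have := h.three_le
  omega

theorem two_mul_re (h : IsCrystRotation q ρ t) : 2 * ρ.re = t := by
  have := congrArg Complex.re h.conj_eq
  simp at this
  linarith

theorem re_sq_add_im_sq (h : IsCrystRotation q ρ t) : ρ.re ^ 2 + ρ.im ^ 2 = 1 := by
  have : Complex.normSq ρ = 1 := by rw [Complex.normSq_eq_norm_sq, h.norm_eq_one]; norm_num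
  rw [Complex.normSq_apply] at this
  linarith

theorem trace_sq_lt (h : IsCrystRotation q ρ t) : t ^ 2 < 4 := by
  have h1 := h.re_sq_add_im_sq
  have h2 := h.two_mul_re
  have h3 : 0 < ρ.im ^ 2 := by have := h.im_ne_zero; positivity
  have : (t : ℝ) ^ 2 < 4 := by rw [← h2]; nlinarith
  exact_mod_cast this

theorem normSq_add_mul (h : IsCrystRotation q ρ t) (m n : ℤ) :
    Complex.normSq (m + n * ρ) = ((m ^ 2 + t * m * n + n ^ 2 : ℤ) : ℝ) := by
  rw [Complex.normSq_apply]
  simp only [Complex.add_re, Complex.intCast_re, Complex.mul_re, Complex.intCast_im, zero_mul,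
    sub_zero, Complex.add_im, Complex.mul_im, add_zero, zero_add]
  push_cast
  linear_combination (n ^ 2 : ℝ) * h.re_sq_add_im_sq + (m * n : ℝ) * h.two_mul_re

theorem quadForm_pos (h : IsCrystRotation q ρ t) {m n : ℤ} (hmn : (m, n) ≠ (0, 0)) :
    0 < m ^ 2 + t * m * n + n ^ 2 := by
  have ht := h.trace_sq_lt
  have h4 : 4 * (m ^ 2 + t * m * n + n ^ 2) = (2 * m + t * n) ^ 2 + (4 - t ^ 2) * n ^ 2 := by ring
  by_cases hn : n = 0
  · subst hn
    have : m ≠ 0 := by rintro rfl; exact hmn rfl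
    have : 0 < m ^ 2 := by positivity
    nlinarith
  · have : 0 < n ^ 2 := by positivity
    nlinarith [sq_nonneg (2 * m + t * n)]

theorem add_mul_eq_zero (h : IsCrystRotation q ρ t) {m n : ℤ} (h0 : (m : ℂ) + n * ρ = 0) :
    m = 0 ∧ n = 0 := by
  by_contra hc
  have := h.quadForm_pos (m := m) (n := n) (by simpa using hc)
  have h1 := h.normSq_add_mul m n
  rw [h0, map_zero] at h1
  have : (m ^ 2 + t * m * n + n ^ 2 : ℤ) = 0 := by exact_mod_cast h1.symm
  omega

/-- Nonzero lattice vectors have length at least `1`, because the square of the length is a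
positive integer. -/
theorem one_le_norm (h : IsCrystRotation q ρ t) {z : ℂ} (hz : z ∈ rotLattice ρ) (h0 : z ≠ 0) :
    1 ≤ ‖z‖ := by
  obtain ⟨m, n, rfl⟩ := hz
  have hp := h.quadForm_pos (m := m) (n := n) (by
    rintro h1
    simp only [Prod.mk.injEq] at h1
    simp [h1.1, h1.2] at h0)
  have h1 := h.normSq_add_mul m n
  rw [Complex.normSq_eq_norm_sq] at h1
  have h2 : (1 : ℝ) ≤ ((m ^ 2 + t * m * n + n ^ 2 : ℤ) : ℝ) := by exact_mod_cast hp
  nlinarith [norm_nonneg ((m : ℂ) + n * ρ)]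

theorem sameOrbit_refl (q : ℕ) (ρ z : ℂ) : SameOrbit q ρ z z :=
  ⟨1, one_pow _, 0, zero_mem _, by simp⟩

theorem sameOrbit_symm (h : IsCrystRotation q ρ t) {z w : ℂ} (hzw : SameOrbit q ρ z w) :
    SameOrbit q ρ w z := by
  obtain ⟨ζ, hζ, l, hl, rfl⟩ := hzw
  have h1 : ζ⁻¹ ^ q = 1 := by rw [inv_pow, hζ, inv_one]
  refine ⟨ζ⁻¹, h1, -(ζ⁻¹ * l), neg_mem (h.mul_mem (h.root_mem h1) hl), ?_⟩
  have := h.root_ne_zero hζ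
  field_simp
  ring

theorem sameOrbit_trans (h : IsCrystRotation q ρ t) {x y z : ℂ} (hxy : SameOrbit q ρ x y)
    (hyz : SameOrbit q ρ y z) : SameOrbit q ρ x z := by
  obtain ⟨ζ, hζ, l, hl, rfl⟩ := hxy
  obtain ⟨ξ, hξ, k, hk, rfl⟩ := hyz
  refine ⟨ξ * ζ, by rw [mul_pow, hζ, hξ, one_mul], ξ * l + k,
    add_mem (h.mul_mem (h.root_mem hξ) hl) hk, by ring⟩

theorem exists_pos_forall_dist (h : IsCrystRotation q ρ t) (c : ℂ) :
    ∃ δ > 0, ∀ l ∈ rotLattice ρ, ‖l - c‖ < δ → l = c := by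
  by_cases hex : ∃ k ∈ rotLattice ρ, ‖k - c‖ < 1 / 2 ∧ k ≠ c
  · obtain ⟨k, hk, hkc, hne⟩ := hex
    have hpos : 0 < ‖k - c‖ := norm_pos_iff.mpr (sub_ne_zero.mpr hne)
    refine ⟨‖k - c‖, hpos, fun l hl hlc => ?_⟩
    exfalso
    have hlk : l ≠ k := by rintro rfl; exact lt_irrefl _ hlc
    have h1 := h.one_le_norm (sub_mem hl hk) (sub_ne_zero.mpr hlk)
    have h2 : ‖l - k‖ ≤ ‖l - c‖ + ‖k - c‖ := by
      simpa [dist_eq_norm] using dist_triangle_right l k c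
    linarith
  · push Not at hex
    exact ⟨1 / 2, by norm_num, fun l hl hlc => hex l hl hlc⟩

/-- The group acts properly discontinuously. -/
theorem exists_separation (h : IsCrystRotation q ρ t) (u v : ℂ) :
    ∃ r > 0, ∀ ζ l z w : ℂ, ζ ^ q = 1 → l ∈ rotLattice ρ → z ∈ ball u r → w ∈ ball v r →
      w = ζ * z + l → v = ζ * u + l := by
  choose δ hδ hδ' using fun c => h.exists_pos_forall_dist c
  have hfin : (Finset.range q).Nonempty := by simpa using h.q_pos.ne'
  refine ⟨((Finset.range q).inf' hfin fun j => δ (v - ρ ^ j * u)) / 2, ?_, ?_⟩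
  · refine half_pos ?_
    rw [Finset.lt_inf'_iff]
    exact fun j _ => hδ _
  · intro ζ l z w hζ hl hz hw hwz
    obtain ⟨j, hj, rfl⟩ := h.exists_pow hζ
    have hle := Finset.inf'_le (fun j => δ (v - ρ ^ j * u)) (Finset.mem_range.mpr hj)
    set r := (Finset.range q).inf' hfin fun j => δ (v - ρ ^ j * u)
    rw [mem_ball, dist_eq_norm] at hz hw
    have h1 : l - (v - ρ ^ j * u) = (w - v) - ρ ^ j * (z - u) := by rw [hwz]; ring
    have h2 : ‖l - (v - ρ ^ j * u)‖ < δ (v - ρ ^ j * u) := by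
      rw [h1]
      refine (norm_sub_le _ _).trans_lt ?_
      rw [norm_mul, h.norm_root hζ, one_mul]
      linarith
    rw [hδ' _ l hl h2]
    ring

/-- A radius separating the orbit of `z₀`: a group element that moves a point of the
`r`-ball around one point of the orbit into the `r`-ball around another one maps centre to
centre. -/
theorem exists_orbit_separation (h : IsCrystRotation q ρ t) (z₀ : ℂ) :
    ∃ r > 0, ∀ u v : ℂ, SameOrbit q ρ z₀ u → SameOrbit q ρ z₀ v → ∀ ζ l z w : ℂ, ζ ^ q = 1 →
      l ∈ rotLattice ρ → z ∈ ball u r → w ∈ ball v r → w = ζ * z + l → v = ζ * u + l := by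
  obtain ⟨r, hr, hsep⟩ := h.exists_separation z₀ z₀
  refine ⟨r, hr, ?_⟩
  rintro _ _ ⟨α, hα, a, ha, rfl⟩ ⟨β, hβ, b, hb, rfl⟩ ζ l z w hζ hl hz hw rfl
  have hα0 := h.root_ne_zero hα
  have hβ0 := h.root_ne_zero hβ
  have hβi : β⁻¹ ^ q = 1 := by rw [inv_pow, hβ, inv_one]
  have key := hsep (β⁻¹ * ζ * α) (β⁻¹ * (ζ * a + l - b)) (α⁻¹ * (z - a))
    (β⁻¹ * (ζ * z + l - b)) (by rw [mul_pow, mul_pow, hα, hζ, hβi]; simp)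
    (h.mul_mem (h.root_mem hβi) (sub_mem (add_mem (h.mul_mem (h.root_mem hζ) ha) hl) hb))
    ?_ ?_ ?_
  · calc β * z₀ + b = β * (β⁻¹ * ζ * α * z₀ + β⁻¹ * (ζ * a + l - b)) + b := by rw [← key]
      _ = _ := by field_simp; ring
  · rw [mem_ball, dist_eq_norm] at hz ⊢
    have : α⁻¹ * (z - a) - z₀ = α⁻¹ * (z - (α * z₀ + a)) := by field_simp; ring
    rwa [this, norm_mul, norm_inv, h.norm_root hα, inv_one, one_mul]
  · rw [mem_ball, dist_eq_norm] at hw ⊢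
    have : β⁻¹ * (ζ * z + l - b) - z₀ = β⁻¹ * (ζ * z + l - (β * z₀ + b)) := by field_simp; ring
    rwa [this, norm_mul, norm_inv, h.norm_root hβ, inv_one, one_mul]
  · field_simp
    ring

/-- The index of the sublattice `a Λ` in `Λ` is the norm of `a`; here `Λ` is identified with
`ℤ²` by the basis `1, ρ`. -/
theorem exists_sublattice (h : IsCrystRotation q ρ t) (m n : ℤ) (hmn : (m, n) ≠ (0, 0)) :
    ∃ N : Submodule ℤ (Fin 2 → ℤ),
      (∀ v, v ∈ N ↔ ∃ l ∈ rotLattice ρ, (v 0 : ℂ) + v 1 * ρ = (m + n * ρ) * l) ∧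
      Nat.card ((Fin 2 → ℤ) ⧸ N) = (m ^ 2 + t * m * n + n ^ 2).natAbs := by
  let A : Matrix (Fin 2) (Fin 2) ℤ := !![m, -n; n, m + t * n]
  have hdet : A.det = m ^ 2 + t * m * n + n ^ 2 := by
    rw [Matrix.det_fin_two_of]; ring
  have hinj : Function.Injective (Matrix.toLin' A) := by
    rw [← LinearMap.ker_eq_bot]
    apply Matrix.ker_toLin'_eq_bot_iff.mpr
    intro v hv
    by_contra hne
    have := Matrix.exists_mulVec_eq_zero_iff.mp ⟨v, hne, hv⟩
    have hp := h.quadForm_pos hmn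
    omega
  refine ⟨LinearMap.range (Matrix.toLin' A), fun v => ?_, ?_⟩
  · constructor
    · rintro ⟨w, rfl⟩
      refine ⟨w 0 + w 1 * ρ, ⟨w 0, w 1, rfl⟩, ?_⟩
      simp [A, Matrix.mulVec, dotProduct, Fin.sum_univ_two]
      linear_combination (-(n * w 1) : ℂ) * h.sq
    · rintro ⟨_, ⟨x, y, rfl⟩, hl⟩
      refine ⟨![x, y], ?_⟩
      have h0 : ((v 0 - (m * x - n * y) : ℤ) : ℂ) + ((v 1 - (n * x + (m + t * n) * y) : ℤ) : ℂ) * ρ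
          = 0 := by
        push_cast
        linear_combination hl + (n * y : ℂ) * h.sq
      obtain ⟨h1, h2⟩ := h.add_mul_eq_zero h0
      ext i
      fin_cases i
      · simp [A, Matrix.mulVec, dotProduct, Fin.sum_univ_two]; linarith
      · simp [A, Matrix.mulVec, dotProduct, Fin.sum_univ_two]; linarith
  · rw [← Submodule.natAbs_det_equiv _ (LinearEquiv.ofInjective _ hinj), ← hdet,
      ← LinearMap.det_toLin']
    rfl

end IsCrystRotation

/-! ### Folding charts -/

/-- The map `z ↦ w + c z / √(1 + |z|²)`, for `c ≠ 0` a homeomorphism of the plane onto the open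
disc of radius `|c|` about `w`. -/
noncomputable def discMap (w c z : ℂ) : ℂ := w + c * OpenPartialHomeomorph.univUnitBall z

@[simp] theorem discMap_zero (w c : ℂ) : discMap w c 0 = w := by simp [discMap]

theorem discMap_mul (w c z : ℂ) {ζ : ℂ} (hζ : ‖ζ‖ = 1) :
    discMap w c (ζ * z) = w + ζ * (discMap w c z - w) := by
  simp [discMap, OpenPartialHomeomorph.univUnitBall_apply, hζ]
  ring

theorem isOpenEmbedding_discMap (w : ℂ) {c : ℂ} (hc : c ≠ 0) : IsOpenEmbedding (discMap w c) := by
  have h1 : IsOpenEmbedding (OpenPartialHomeomorph.univUnitBall : ℂ → ℂ) :=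
    OpenPartialHomeomorph.isOpenEmbedding _ rfl
  have h2 : IsOpenEmbedding (fun z : ℂ => w + c * z) :=
    ((Homeomorph.mulLeft₀ c hc).trans (Homeomorph.addLeft w)).isOpenEmbedding
  exact h2.comp h1

theorem range_discMap (w : ℂ) {c : ℂ} (hc : c ≠ 0) : Set.range (discMap w c) = ball w ‖c‖ := by
  have hc' : 0 < ‖c‖ := norm_pos_iff.mpr hc
  ext y
  constructor
  · rintro ⟨z, rfl⟩
    have : (OpenPartialHomeomorph.univUnitBall z : ℂ) ∈ ball (0 : ℂ) 1 :=
      OpenPartialHomeomorph.univUnitBall.map_source (x := z) (Set.mem_univ z)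
    rw [mem_ball_zero_iff] at this
    rw [mem_ball, dist_eq_norm, discMap, add_sub_cancel_left, norm_mul]
    nlinarith
  · intro hy
    rw [mem_ball, dist_eq_norm] at hy
    have hy' : (y - w) / c ∈
        (OpenPartialHomeomorph.univUnitBall : OpenPartialHomeomorph ℂ ℂ).target := by
      change _ ∈ ball (0 : ℂ) 1
      rw [mem_ball_zero_iff, norm_div, div_lt_one hc']
      exact hy
    refine ⟨OpenPartialHomeomorph.univUnitBall.symm ((y - w) / c), ?_⟩
    rw [discMap, OpenPartialHomeomorph.right_inv _ hy']
    field_simp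
    ring

theorem discMap_eq_iff (w : ℂ) {c z : ℂ} (hc : c ≠ 0) : discMap w c z = w ↔ z = 0 := by
  rw [← (isOpenEmbedding_discMap w hc).injective.eq_iff (a := z), discMap_zero]

theorem exists_pow_eq (n : ℕ) (hn : 0 < n) (z : ℂ) : ∃ w : ℂ, w ^ n = z :=
  ⟨z ^ (1 / n : ℂ), by rw [one_div]; exact Complex.cpow_nat_inv_pow z hn.ne'⟩

namespace IsFoldingChart

variable {X : Type*} [TopologicalSpace X] {index : X → ℕ} {n : ℕ} {φ φ₁ φ₂ : ℂ → X}

theorem eq_zero_iff (h : IsFoldingChart index n φ) {z : ℂ} : φ z = φ 0 ↔ z = 0 := by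
  constructor
  · intro hz
    obtain ⟨ζ, -, h0⟩ := (h.fibre 0 z).mp hz.symm
    simpa using h0
  · rintro rfl; rfl

theorem comp_discMap (h : IsFoldingChart index n φ) {c : ℂ} (hc : c ≠ 0) :
    IsFoldingChart index n (φ ∘ discMap 0 c) where
  pos := h.pos
  continuous := h.continuous.comp (isOpenEmbedding_discMap 0 hc).continuous
  isOpenMap := h.isOpenMap.comp (isOpenEmbedding_discMap 0 hc).isOpenMap
  fibre z w := by
    rw [Function.comp_apply, Function.comp_apply, h.fibre]
    refine exists_congr fun ζ => and_congr_right fun hζ => ?_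
    have hn : ‖ζ‖ = 1 := Complex.norm_eq_one_of_pow_eq_one hζ h.pos.ne'
    have := discMap_mul 0 c z hn
    rw [zero_add, sub_zero] at this
    rw [← this, (isOpenEmbedding_discMap 0 hc).injective.eq_iff]
  index_zero := by simpa using h.index_zero
  index_ne_zero z hz := h.index_ne_zero _ (by rwa [Ne, discMap_eq_iff 0 hc])

/-- The quotient of the plane by `μ_n` is the plane again, with quotient map `z ↦ z ^ n`: a folding
chart is an open embedding of the plane precomposed with `z ↦ z ^ n`. -/
theorem exists_isOpenEmbedding (h : IsFoldingChart index n φ) :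
    ∃ ψ : ℂ → X, IsOpenEmbedding ψ ∧ ∀ z, ψ (z ^ n) = φ z := by
  choose r hr using exists_pow_eq n h.pos
  have key : ∀ z, φ (r (z ^ n)) = φ z := by
    intro z
    by_cases hz : z = 0
    · subst hz
      have h0 : r (0 ^ n) ^ n = 0 := by rw [hr, zero_pow h.pos.ne']
      rw [pow_eq_zero_iff h.pos.ne'] at h0
      rw [h0]
    · rw [eq_comm, h.fibre]
      refine ⟨r (z ^ n) / z, ?_, by field_simp⟩
      rw [div_pow, hr, div_self (pow_ne_zero n hz)]
  have hq : IsQuotientMap fun z : ℂ => z ^ n :=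
    (isClosedMap_pow ℂ n).isQuotientMap (continuous_pow n) (exists_pow_eq n h.pos)
  refine ⟨fun z => φ (r z), IsOpenEmbedding.of_continuous_injective_isOpenMap ?_ ?_ ?_, key⟩
  · rw [hq.continuous_iff]
    convert h.continuous using 1
    exact funext key
  · intro z w hzw
    obtain ⟨ζ, hζ, hw⟩ := (h.fibre _ _).mp hzw
    rw [← hr z, ← hr w, hw, mul_pow, hζ, one_mul]
  · intro U hU
    have : (fun z => φ (r z)) '' U = φ '' ((fun z => z ^ n) ⁻¹' U) := by
      ext x
      constructor
      · rintro ⟨z, hz, rfl⟩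
        exact ⟨r z, by simpa [hr] using hz, rfl⟩
      · rintro ⟨z, hz, rfl⟩
        exact ⟨z ^ n, hz, key z⟩
    rw [this]
    exact h.isOpenMap _ (hU.preimage (continuous_pow n))

end IsFoldingChart

/-- If `t` is continuous on the plane and vanishes at most at the origin, then `z ↦ t (z ^ n)` has
a continuous `n`-th root. Writing `t (exp s) = exp (L s)`, the difference `L (s + 2πi) - L s` is a
constant multiple of `2πi`, so `exp (L (n s) / n)` depends on `exp s` only. -/
theorem exists_continuous_pow_eq_comp_pow {t : ℂ → ℂ} (ht : Continuous t) (h0 : t 0 = 0)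
    (hne : ∀ z, z ≠ 0 → t z ≠ 0) {n : ℕ} (hn : 0 < n) :
    ∃ k : ℂ → ℂ, Continuous k ∧ ∀ z, k z ^ n = t (z ^ n) := by
  have hne' : ∀ s, t (Complex.exp s) ≠ 0 := fun s => hne _ (Complex.exp_ne_zero s)
  obtain ⟨L, ⟨-, hL⟩, -⟩ := Complex.isCoveringMapOn_exp.existsUnique_continuousMap_lifts
    (⟨fun s => t (Complex.exp s), by fun_prop⟩ : C(ℂ, ℂ)) (a₀ := 0)
    (e₀ := Complex.log (t (Complex.exp 0))) (Complex.exp_log (hne' 0)) hne'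
  have hLc : Continuous L := L.continuous
  have hL' : ∀ s, Complex.exp (L s) = t (Complex.exp s) := fun s => congrFun hL s
  have hn' : (n : ℂ) ≠ 0 := by exact_mod_cast hn.ne'
  -- the period of `L`
  obtain ⟨m, hm⟩ : ∃ m : ℤ, ∀ s, L (s + 2 * Real.pi * Complex.I) =
      L s + m * (2 * Real.pi * Complex.I) := by
    have hex : ∀ s, ∃ m : ℤ, L (s + 2 * Real.pi * Complex.I) =
        L s + m * (2 * Real.pi * Complex.I) := by
      intro s
      rw [← Complex.exp_eq_exp_iff_exists_int, hL', hL', Complex.exp_periodic s]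
    choose m hm using hex
    have hmc : Continuous fun s => (m s : ℝ) := by
      have : (fun s => (m s : ℝ)) = fun s =>
          ((L (s + 2 * Real.pi * Complex.I) - L s) / (2 * Real.pi * Complex.I)).re := by
        funext s
        rw [hm s, add_sub_cancel_left, mul_div_cancel_right₀ _ Complex.two_pi_I_ne_zero]
        simp
      rw [this]
      fun_prop
    have hmc' : Continuous m := Int.isClosedEmbedding_coe_real.isEmbedding.continuous_iff.mpr hmc
    refine ⟨m 0, fun s => ?_⟩
    rw [hm s, PreconnectedSpace.constant inferInstance hmc' (x := s) (y := 0)]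
  have hmi : ∀ (j : ℕ) s, L (s + j * (2 * Real.pi * Complex.I)) =
      L s + j * (m * (2 * Real.pi * Complex.I)) := by
    intro j
    induction j with
    | zero => simp
    | succ j ih =>
      intro s
      have : s + ((j + 1 : ℕ) : ℂ) * (2 * Real.pi * Complex.I) =
          s + j * (2 * Real.pi * Complex.I) + 2 * Real.pi * Complex.I := by push_cast; ring
      rw [this, hm, ih]
      push_cast
      ring
  set G : ℂ → ℂ := fun s => Complex.exp (L (n * s) / n) with hG
  have hGc : Continuous G := by fun_prop
  have hGp : ∀ s, G (s + 2 * Real.pi * Complex.I) = G s := by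
    intro s
    simp only [hG]
    rw [mul_add, hmi, add_div, mul_div_cancel_left₀ _ hn', Complex.exp_add,
      Complex.exp_int_mul_two_pi_mul_I, mul_one]
  have hGpow : ∀ s, G s ^ n = t (Complex.exp s ^ n) := by
    intro s
    simp only [hG]
    rw [← Complex.exp_nat_mul, mul_div_cancel₀ _ hn', hL', Complex.exp_nat_mul]
  set k : ℂ → ℂ := fun z => if z = 0 then 0 else G (Complex.log z) with hk
  have hkpow : ∀ z, k z ^ n = t (z ^ n) := by
    intro z
    by_cases hz : z = 0
    · simp [hk, hz, hn.ne', h0]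
    · simp only [hk, hz, if_false]
      rw [hGpow, Complex.exp_log hz]
  refine ⟨k, ?_, hkpow⟩
  rw [continuous_iff_continuousAt]
  intro z
  by_cases hz : z = 0
  · subst hz
    have hk0 : k 0 = 0 := by simp [hk]
    rw [ContinuousAt, hk0, tendsto_zero_iff_norm_tendsto_zero]
    have h1 : Filter.Tendsto (fun z => ‖t (z ^ n)‖) (𝓝 0) (𝓝 0) := by
      have : Continuous fun z => ‖t (z ^ n)‖ := by fun_prop
      simpa [hn.ne', h0] using this.tendsto 0
    have h2 : ∀ z, ‖k z‖ = ‖t (z ^ n)‖ ^ (1 / n : ℝ) := by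
      intro z
      rw [← hkpow, norm_pow, one_div, Real.pow_rpow_inv_natCast (norm_nonneg _) hn.ne']
    simp_rw [h2]
    have h3 := h1.rpow_const (p := (1 / n : ℝ)) (Or.inr (by positivity))
    rwa [Real.zero_rpow (by positivity)] at h3
  · have hkG : ∀ s, k (Complex.exp s) = G s := by
      intro s
      simp only [hk, Complex.exp_ne_zero, if_false]
      obtain ⟨j, hj⟩ := Complex.exp_eq_exp_iff_exists_int.mp
        (Complex.exp_log (Complex.exp_ne_zero s))
      have hper : Function.Periodic G (2 * Real.pi * Complex.I) := hGp
      rw [hj]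
      exact hper.int_mul j s
    -- `k ∘ exp = G` is continuous and `exp` is open
    rw [ContinuousAt, ← Complex.exp_log hz, hkG]
    rw [← Complex.isOpenMap_exp.map_nhds_eq (Complex.continuous_exp.continuousAt),
      Filter.tendsto_map'_iff]
    have : k ∘ Complex.exp = G := funext hkG
    rw [this]
    exact hGc.continuousAt

namespace IsFoldingChart

variable {X : Type*} [TopologicalSpace X] {index : X → ℕ} {n : ℕ} {φ φ₁ φ₂ : ℂ → X}

/-- Nested folding charts at the same point factor through each other: in the coordinate `z ^ n` of
the quotients this is clear, and the factorization has a continuous `n`-th root. -/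
theorem exists_comp_eq (h₁ : IsFoldingChart index n φ₁) (h₂ : IsFoldingChart index n φ₂)
    (h0 : φ₁ 0 = φ₂ 0) (hr : Set.range φ₁ ⊆ Set.range φ₂) :
    ∃ k : ℂ → ℂ, Continuous k ∧ ∀ z, φ₂ (k z) = φ₁ z := by
  obtain ⟨ψ₁, hψ₁, e₁⟩ := h₁.exists_isOpenEmbedding
  obtain ⟨ψ₂, hψ₂, e₂⟩ := h₂.exists_isOpenEmbedding
  have hex : ∀ z, ∃ w, ψ₂ w = ψ₁ z := by
    intro z
    obtain ⟨y, rfl⟩ := exists_pow_eq n h₁.pos z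
    obtain ⟨x, hx⟩ := hr ⟨y, rfl⟩
    exact ⟨x ^ n, by rw [e₁, e₂, hx]⟩
  choose t ht using hex
  have htc : Continuous t := by
    rw [hψ₂.isEmbedding.continuous_iff]
    convert hψ₁.continuous using 1
    exact funext ht
  have hψ0 : ψ₁ 0 = ψ₂ 0 := by
    have a := e₁ 0
    have b := e₂ 0
    rw [zero_pow h₁.pos.ne'] at a b
    rw [a, b, h0]
  have ht0 : t 0 = 0 := hψ₂.injective (by rw [ht, hψ0])
  have htne : ∀ z, z ≠ 0 → t z ≠ 0 := by
    intro z hz h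
    apply hz
    apply hψ₁.injective
    rw [← ht z, h, hψ0]
  obtain ⟨k, hk, hkt⟩ := exists_continuous_pow_eq_comp_pow htc ht0 htne h₁.pos
  exact ⟨k, hk, fun z => by rw [← e₂, hkt, ht, e₁]⟩

theorem exists_range_comp_discMap_subset (h : IsFoldingChart index n φ) {U : Set X}
    (hU : IsOpen U) (h0 : φ 0 ∈ U) : ∃ c : ℂ, c ≠ 0 ∧ Set.range (φ ∘ discMap 0 c) ⊆ U := by
  obtain ⟨r, hr, hrU⟩ := Metric.isOpen_iff.mp (hU.preimage h.continuous) 0 h0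
  have hr' : (r : ℂ) ≠ 0 := by exact_mod_cast hr.ne'
  refine ⟨r, hr', ?_⟩
  rw [Set.range_comp, range_discMap 0 hr', Complex.norm_real, Real.norm_of_nonneg hr.le]
  rintro _ ⟨z, hz, rfl⟩
  exact hrU hz

/-- A continuous map that takes every point to one of its rotations by an `n`-th root of unity is a
single rotation, because the punctured plane is connected. -/
theorem eq_mul_discMap (h : IsFoldingChart index n φ) {g : ℂ → ℂ} (hg : Continuous g) {c : ℂ}
    (hc : c ≠ 0) (he : ∀ z, φ (g z) = φ (discMap 0 c z)) :
    ∃ ζ : ℂ, ζ ^ n = 1 ∧ ∀ z, g z = ζ * discMap 0 c z := by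
  have hex : ∀ z, ∃ ζ : ℂ, ζ ^ n = 1 ∧ g z = ζ * discMap 0 c z := fun z =>
    (h.fibre _ _).mp (he z).symm
  have hne : ∀ z ∈ ({0}ᶜ : Set ℂ), discMap 0 c z ≠ 0 := fun z hz =>
    fun h => hz ((discMap_eq_iff 0 hc).mp h)
  have hfin : {ζ : ℂ | ζ ^ n = 1}.Finite := by
    have := (Polynomial.nthRoots n (1 : ℂ)).toFinset.finite_toSet
    refine this.subset fun ζ hζ => ?_
    simpa [Polynomial.mem_nthRoots h.pos] using hζ
  have hconn : IsPreconnected ({0}ᶜ : Set ℂ) :=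
    (isConnected_compl_singleton_of_one_lt_rank (by simp) 0).isPreconnected
  obtain ⟨ζ, hζ, hζe⟩ := hconn.eqOn_const_of_mapsTo (T := {ζ : ℂ | ζ ^ n = 1})
    (f := fun z => g z / discMap 0 c z) hfin.isDiscrete
    (hg.continuousOn.div (isOpenEmbedding_discMap 0 hc).continuous.continuousOn hne)
    (fun z hz => by
      obtain ⟨ζ, hζ, hz'⟩ := hex z
      have := hne z hz
      simp only [hz', Set.mem_ofPred_eq, mul_div_cancel_right₀ _ this, hζ]) ⟨1, by simp⟩
  refine ⟨ζ, hζ, fun z => ?_⟩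
  by_cases hz : z = 0
  · obtain ⟨ξ, -, hz'⟩ := hex z
    rw [hz', hz]
    simp
  · have := hζe (show z ∈ ({0}ᶜ : Set ℂ) from hz)
    exact (div_eq_iff (hne z hz)).mp this

/-- Two folding charts at the same point differ by a local homeomorphism of the plane near the
origin. -/
theorem exists_openPartialHomeomorph (h₁ : IsFoldingChart index n φ₁)
    (h₂ : IsFoldingChart index n φ₂) (h0 : φ₁ 0 = φ₂ 0) :
    ∃ e : OpenPartialHomeomorph ℂ ℂ, 0 ∈ e.source ∧ e 0 = 0 ∧ ∀ z ∈ e.source, φ₂ (e z) = φ₁ z := by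
  -- three successively smaller charts, each factoring through the previous one
  obtain ⟨c₁, hc₁, r₁⟩ := h₂.exists_range_comp_discMap_subset h₁.isOpenMap.isOpen_range
    ⟨0, h0⟩
  have g₁ := h₂.comp_discMap hc₁
  obtain ⟨c₂, hc₂, r₂⟩ := h₁.exists_range_comp_discMap_subset g₁.isOpenMap.isOpen_range
    ⟨0, by simp [h0]⟩
  have g₂ := h₁.comp_discMap hc₂
  obtain ⟨c₃, hc₃, r₃⟩ := h₂.exists_range_comp_discMap_subset g₂.isOpenMap.isOpen_range
    ⟨0, by simp [h0]⟩
  have g₃ := h₂.comp_discMap hc₃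
  obtain ⟨k₁, k₁c, k₁e⟩ := g₁.exists_comp_eq h₁ (by simp [h0]) r₁
  obtain ⟨k₂, k₂c, k₂e⟩ := g₂.exists_comp_eq g₁ (by simp [h0]) r₂
  obtain ⟨k₃, k₃c, k₃e⟩ := g₃.exists_comp_eq g₂ (by simp [h0]) r₃
  simp only [Function.comp_apply] at k₁e k₂e k₃e
  have d₁ := isOpenEmbedding_discMap 0 hc₁
  have d₂ := isOpenEmbedding_discMap 0 hc₂
  have d₃ := isOpenEmbedding_discMap 0 hc₃
  obtain ⟨ζ, hζ, hζe⟩ := h₁.eq_mul_discMap (g := k₁ ∘ k₂) (k₁c.comp k₂c) hc₂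
    (fun z => by rw [Function.comp_apply, k₁e, k₂e])
  obtain ⟨ξ, hξ, hξe⟩ := h₂.eq_mul_discMap (g := discMap 0 c₁ ∘ k₂ ∘ k₃)
    (d₁.continuous.comp (k₂c.comp k₃c)) hc₃
    (fun z => by rw [Function.comp_apply, Function.comp_apply, k₂e, k₃e])
  have hζ0 : ζ ≠ 0 := by rintro rfl; simp [h₁.pos.ne'] at hζ
  have hξ0 : ξ ≠ 0 := by rintro rfl; simp [h₁.pos.ne'] at hξ
  set g : ℂ → ℂ := discMap 0 c₁ ∘ k₂ with hg
  have gc : Continuous g := d₁.continuous.comp k₂c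
  have ginj : Function.Injective g := by
    refine d₁.injective.comp fun z w hzw => ?_
    have := hζe z
    rw [Function.comp_apply, hzw, ← Function.comp_apply (f := k₁), hζe w] at this
    exact (d₂.injective (mul_left_cancel₀ hζ0 this)).symm
  have g0 : g 0 = 0 := by
    have h1 : φ₂ (g 0) = φ₂ 0 := by rw [hg, Function.comp_apply, k₂e, discMap_zero, h0]
    exact h₂.eq_zero_iff.mp h1
  -- a right inverse of `g` near the origin
  let D₃ := d₃.toOpenPartialHomeomorph _
  have D₃r : ∀ y ∈ ball (0 : ℂ) ‖c₃‖, discMap 0 c₃ (D₃.symm y) = y := by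
    intro y hy
    rw [← range_discMap 0 hc₃] at hy
    exact d₃.toOpenPartialHomeomorph_right_inv _ hy
  have hξn : ‖ξ⁻¹‖ = 1 := by
    rw [norm_inv, Complex.norm_eq_one_of_pow_eq_one hξ h₁.pos.ne', inv_one]
  have hball : ∀ y ∈ ball (0 : ℂ) ‖c₃‖, ξ⁻¹ * y ∈ ball (0 : ℂ) ‖c₃‖ := by
    intro y hy
    rw [mem_ball_zero_iff] at hy ⊢
    rwa [norm_mul, hξn, one_mul]
  have hright : ∀ y ∈ ball (0 : ℂ) ‖c₃‖, g (k₃ (D₃.symm (ξ⁻¹ * y))) = y := by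
    intro y hy
    have := hξe (D₃.symm (ξ⁻¹ * y))
    simp only [Function.comp_apply] at this
    rw [hg, Function.comp_apply, this, D₃r _ (hball y hy)]
    field_simp
  let E : OpenPartialHomeomorph ℂ ℂ :=
    { toFun := g
      invFun := fun y => k₃ (D₃.symm (ξ⁻¹ * y))
      source := g ⁻¹' ball 0 ‖c₃‖
      target := ball 0 ‖c₃‖
      map_source' := fun z hz => hz
      map_target' := fun y hy => by
        rw [Set.mem_preimage, hright y hy]
        exact hy
      left_inv' := fun z hz => ginj (hright _ hz)
      right_inv' := hright
      open_source := isOpen_ball.preimage gc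
      open_target := isOpen_ball
      continuousOn_toFun := gc.continuousOn
      continuousOn_invFun := by
        refine k₃c.comp_continuousOn ?_
        have h1 : ContinuousOn D₃.symm (ball 0 ‖c₃‖) := by
          have := D₃.continuousOn_symm
          rwa [IsOpenEmbedding.toOpenPartialHomeomorph_target, range_discMap 0 hc₃] at this
        exact h1.comp (by fun_prop) hball }
  let D₂ := d₂.toOpenPartialHomeomorph _
  have D₂0 : D₂.symm 0 = 0 := by
    have := d₂.toOpenPartialHomeomorph_left_inv (x := 0)
    rwa [discMap_zero] at this
  refine ⟨D₂.symm.trans E, ?_, ?_, ?_⟩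
  · rw [OpenPartialHomeomorph.trans_source]
    refine ⟨⟨0, by simp⟩, ?_⟩
    change g (D₂.symm 0) ∈ ball (0 : ℂ) ‖c₃‖
    rw [D₂0, g0]
    exact mem_ball_self (norm_pos_iff.mpr hc₃)
  · change g (D₂.symm 0) = 0
    rw [D₂0, g0]
  · intro z hz
    rw [OpenPartialHomeomorph.trans_source] at hz
    obtain ⟨y, rfl⟩ : z ∈ Set.range (discMap 0 c₂) := by
      simpa [D₂] using hz.1
    change φ₂ (g (D₂.symm (discMap 0 c₂ y))) = _
    rw [show D₂.symm (discMap 0 c₂ y) = y from d₂.toOpenPartialHomeomorph_left_inv]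
    rw [hg, Function.comp_apply, k₂e]

end IsFoldingChart

section Lifting

variable {X : Type*} [TopologicalSpace X]

/-! ### Uniformizations and the coverings induced by multiplication -/

/-- `π : ℂ → X` identifies the orbifold `O` with the quotient of the plane by the group of all maps
`z ↦ ζ z + l`, where `ζ ^ q = 1` and `l` lies in the lattice `ℤ + ℤ ρ`. The index of `π z` is the
order of the stabilizer of `z`, which is described by the rotation parts `ζ` of its elements. -/
structure IsUniformization (O : ConeOrbifold X) (q : ℕ) (ρ : ℂ) (π : ℂ → X) : Prop where
  continuous : Continuous π
  isOpenMap : IsOpenMap π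
  surjective : Function.Surjective π
  fibre : ∀ z w, π z = π w ↔ SameOrbit q ρ z w
  index : ∀ z, O.index (π z) = Nat.card {ζ : ℂ // ζ ^ q = 1 ∧ (1 - ζ) * z ∈ rotLattice ρ}

namespace IsCrystRotation

variable {q : ℕ} {ρ : ℂ} {t : ℤ}

theorem finite_stabilizer (h : IsCrystRotation q ρ t) (z : ℂ) :
    Finite {ζ : ℂ // ζ ^ q = 1 ∧ (1 - ζ) * z ∈ rotLattice ρ} := by
  have : {ζ : ℂ | ζ ^ q = 1 ∧ (1 - ζ) * z ∈ rotLattice ρ}.Finite := by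
    refine ((Polynomial.nthRoots q (1 : ℂ)).toFinset.finite_toSet).subset fun ζ hζ => ?_
    simpa [Polynomial.mem_nthRoots h.q_pos] using hζ.1
  exact this

/-- The rotation parts of the stabilizer of a point form the full group of `n`-th roots of unity,
where `n` is its order. -/
theorem pow_card_stabilizer_eq_one_iff (h : IsCrystRotation q ρ t) (z ζ : ℂ) :
    ζ ^ Nat.card {ζ : ℂ // ζ ^ q = 1 ∧ (1 - ζ) * z ∈ rotLattice ρ} = 1 ↔
      ζ ^ q = 1 ∧ (1 - ζ) * z ∈ rotLattice ρ := by
  let S : Subgroup ℂˣ :=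
    { carrier := {u | (u : ℂ) ^ q = 1 ∧ (1 - (u : ℂ)) * z ∈ rotLattice ρ}
      one_mem' := by simp
      mul_mem' := by
        rintro u v ⟨hu, hu'⟩ ⟨hv, hv'⟩
        refine ⟨by rw [Units.val_mul, mul_pow, hu, hv, one_mul], ?_⟩
        have : (1 - ((u * v : ℂˣ) : ℂ)) * z = (1 - u) * z + u * ((1 - v) * z) := by
          push_cast; ring
        rw [this]
        exact add_mem hu' (h.mul_mem (h.root_mem hu) hv')
      inv_mem' := by
        rintro u ⟨hu, hu'⟩
        have hi : ((u⁻¹ : ℂˣ) : ℂ) ^ q = 1 := by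
          rw [Units.val_inv_eq_inv_val, inv_pow, hu, inv_one]
        refine ⟨hi, ?_⟩
        have : (1 - ((u⁻¹ : ℂˣ) : ℂ)) * z = -(((u⁻¹ : ℂˣ) : ℂ) * ((1 - u) * z)) := by
          have := u.inv_mul
          linear_combination (-z) * this
        rw [this]
        exact neg_mem (h.mul_mem (h.root_mem hi) hu') }
  let e : S ≃ {ζ : ℂ // ζ ^ q = 1 ∧ (1 - ζ) * z ∈ rotLattice ρ} :=
    { toFun := fun u => ⟨(u : ℂˣ), u.2⟩
      invFun := fun ζ => ⟨Units.mk0 ζ.1 (h.root_ne_zero ζ.2.1), ζ.2⟩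
      left_inv := fun u => by ext; rfl
      right_inv := fun ζ => rfl }
  have : Finite S := have := h.finite_stabilizer z; Finite.of_equiv _ e.symm
  rw [← Nat.card_congr e]
  have hpos : 0 < Nat.card S := Nat.card_pos
  have hS : S = rootsOfUnity (Nat.card S) ℂ := by
    have : NeZero (Nat.card S) := ⟨hpos.ne'⟩
    refine Subgroup.eq_of_le_of_card_ge (fun u hu => ?_) ?_
    · have := pow_card_eq_one' (x := (⟨u, hu⟩ : S))
      have := congrArg S.subtype this
      rwa [map_pow, map_one] at this
    · exact card_rootsOfUnity ℂ _
  constructor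
  · intro hζ
    have hu : IsUnit ζ := IsUnit.of_pow_eq_one hζ hpos.ne'
    obtain ⟨u, rfl⟩ := hu
    have : u ∈ S := by
      rw [hS, mem_rootsOfUnity]
      exact Units.ext (by simpa using hζ)
    exact this
  · rintro ⟨h1, h2⟩
    let u : ℂˣ := Units.mk0 ζ (h.root_ne_zero h1)
    have hu : u ∈ S := ⟨h1, h2⟩
    rw [hS, mem_rootsOfUnity] at hu
    simpa [u] using congrArg Units.val hu

end IsCrystRotation

namespace IsUniformization

variable {O : ConeOrbifold X} {q : ℕ} {ρ : ℂ} {t : ℤ} {π : ℂ → X}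

theorem pow_index_eq_one_iff (hπ : IsUniformization O q ρ π) (h : IsCrystRotation q ρ t)
    (z ζ : ℂ) : ζ ^ O.index (π z) = 1 ↔ ζ ^ q = 1 ∧ (1 - ζ) * z ∈ rotLattice ρ := by
  rw [hπ.index, h.pow_card_stabilizer_eq_one_iff]

/-- At an ordinary point the stabilizer is trivial. -/
theorem eq_one_of_index (hπ : IsUniformization O q ρ π) (h : IsCrystRotation q ρ t) {z ζ l : ℂ}
    (hz : O.index (π z) = 1) (hζ : ζ ^ q = 1) (hl : l ∈ rotLattice ρ) (he : z = ζ * z + l) :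
    ζ = 1 := by
  have := (hπ.pow_index_eq_one_iff h z ζ).mpr ⟨hζ, by
    rw [show (1 - ζ) * z = l by linear_combination he]; exact hl⟩
  simpa [hz] using this

/-- Composing `π` with a small disc gives a folding chart. -/
theorem isFoldingChart (hπ : IsUniformization O q ρ π) (h : IsCrystRotation q ρ t) {w c : ℂ}
    (hc : c ≠ 0) (hsep : ∀ ζ l z z' : ℂ, ζ ^ q = 1 → l ∈ rotLattice ρ → z ∈ ball w ‖c‖ →
      z' ∈ ball w ‖c‖ → z' = ζ * z + l → w = ζ * w + l) :
    IsFoldingChart O.index (O.index (π w)) (π ∘ discMap w c) where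
  pos := by
    rw [hπ.index]
    have := h.finite_stabilizer w
    have : Nonempty {ζ : ℂ // ζ ^ q = 1 ∧ (1 - ζ) * w ∈ rotLattice ρ} := ⟨1, by simp⟩
    exact Nat.card_pos
  continuous := hπ.continuous.comp (isOpenEmbedding_discMap w hc).continuous
  isOpenMap := hπ.isOpenMap.comp (isOpenEmbedding_discMap w hc).isOpenMap
  fibre z z' := by
    rw [Function.comp_apply, Function.comp_apply, hπ.fibre]
    have hd : ∀ y, discMap w c y ∈ ball w ‖c‖ := fun y => by
      rw [← range_discMap w hc]; exact ⟨y, rfl⟩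
    constructor
    · rintro ⟨ζ, hζ, l, hl, he⟩
      have hw := hsep ζ l _ _ hζ hl (hd z) (hd z') he
      refine ⟨ζ, (hπ.pow_index_eq_one_iff h w ζ).mpr ⟨hζ, ?_⟩, ?_⟩
      · rw [show (1 - ζ) * w = l by linear_combination hw]; exact hl
      · apply (isOpenEmbedding_discMap w hc).injective
        rw [discMap_mul w c z (h.norm_root hζ), he]
        linear_combination -hw
    · rintro ⟨ζ, hζ, rfl⟩
      obtain ⟨h1, h2⟩ := (hπ.pow_index_eq_one_iff h w ζ).mp hζ
      refine ⟨ζ, h1, _, h2, ?_⟩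
      rw [discMap_mul w c z (h.norm_root h1)]
      ring
  index_zero := by simp
  index_ne_zero z hz := by
    have hd : discMap w c z ∈ ball w ‖c‖ := by
      rw [← range_discMap w hc]; exact ⟨z, rfl⟩
    rw [Function.comp_apply, hπ.index, Nat.card_eq_one_iff_unique]
    refine ⟨⟨?_⟩, ⟨1, by simp⟩⟩
    suffices ∀ ζ : ℂ, ζ ^ q = 1 ∧ (1 - ζ) * discMap w c z ∈ rotLattice ρ → ζ = 1 by
      rintro ⟨a, ha⟩ ⟨b, hb⟩
      rw [Subtype.mk.injEq, this a ha, this b hb]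
    rintro ζ ⟨hζ, hl⟩
    have hw := hsep ζ _ _ _ hζ hl hd hd (by ring)
    have hne : discMap w c z - w ≠ 0 := by
      rw [sub_ne_zero, Ne, discMap_eq_iff w hc]; exact hz
    apply mul_right_cancel₀ hne
    linear_combination hw

theorem exists_isFoldingChart (hπ : IsUniformization O q ρ π) (h : IsCrystRotation q ρ t) (w : ℂ) :
    ∃ c : ℂ, c ≠ 0 ∧ IsFoldingChart O.index (O.index (π w)) (π ∘ discMap w c) := by
  obtain ⟨r, hr, hsep⟩ := h.exists_separation w w
  refine ⟨r, by exact_mod_cast hr.ne', hπ.isFoldingChart h (by exact_mod_cast hr.ne') ?_⟩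
  rw [Complex.norm_real, Real.norm_of_nonneg hr.le]
  exact hsep

/-- Multiplication by a nonzero element `a` of the lattice normalizes the group and induces an
orbifold covering. -/
theorem exists_isCovering (hπ : IsUniformization O q ρ π) (h : IsCrystRotation q ρ t) {a : ℂ}
    (ha : a ∈ rotLattice ρ) (ha0 : a ≠ 0) :
    ∃ f : X → X, (∀ z, f (π z) = π (a * z)) ∧ O.IsCovering O f := by
  choose s hs using hπ.surjective
  have hf : ∀ z, π (a * s (π z)) = π (a * z) := by
    intro z
    obtain ⟨ζ, hζ, l, hl, he⟩ := (hπ.fibre _ _).mp (hs (π z))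
    rw [hπ.fibre]
    exact ⟨ζ, hζ, a * l, h.mul_mem ha hl, by linear_combination a * he⟩
  refine ⟨fun x => π (a * s x), hf, fun p => ?_⟩
  set f : X → X := fun x => π (a * s x)
  obtain ⟨z₀, rfl⟩ := hπ.surjective p
  obtain ⟨r, hr, hsep⟩ := h.exists_orbit_separation z₀
  have hrC : (r : ℂ) ≠ 0 := by exact_mod_cast hr.ne'
  have hrn : ‖(r : ℂ)‖ = r := by rw [Complex.norm_real, Real.norm_of_nonneg hr.le]
  have han : 0 < ‖a‖ := norm_pos_iff.mpr ha0
  have hψ := hπ.isFoldingChart h (w := z₀) hrC (by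
    rw [hrn]
    exact fun ζ l z z' => hsep z₀ z₀ (IsCrystRotation.sameOrbit_refl _ _ _)
      (IsCrystRotation.sameOrbit_refl _ _ _) ζ l z z')
  -- multiplication by `a` scales discs
  have hball : ∀ w z : ℂ, z ∈ ball w (r / ‖a‖) ↔ a * z ∈ ball (a * w) r := by
    intro w z
    rw [mem_ball, mem_ball, dist_eq_norm, dist_eq_norm, ← mul_sub, norm_mul, lt_div_iff₀ han,
      mul_comm]
  have hsep' : ∀ w w' : ℂ, SameOrbit q ρ z₀ (a * w) → SameOrbit q ρ z₀ (a * w') →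
      ∀ ζ l z z' : ℂ, ζ ^ q = 1 → l ∈ rotLattice ρ → z ∈ ball w (r / ‖a‖) →
      z' ∈ ball w' (r / ‖a‖) → z' = ζ * z + l → w' = ζ * w + l := by
    intro w w' hw hw' ζ l z z' hζ hl hz hz' he
    have := hsep _ _ hw hw' ζ (a * l) (a * z) (a * z') hζ (h.mul_mem ha hl) ((hball _ _).mp hz)
      ((hball _ _).mp hz') (by rw [he]; ring)
    apply mul_left_cancel₀ ha0
    linear_combination this
  refine ⟨_, _, hψ, by simp, {V | ∃ w, SameOrbit q ρ z₀ (a * w) ∧ V = π '' ball w (r / ‖a‖)},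
    ?_, ?_, ?_⟩
  · rintro _ ⟨w, hw, rfl⟩ _ ⟨w', hw', rfl⟩ hne
    rw [Function.onFun, id, id, Set.disjoint_left]
    rintro _ ⟨z, hz, rfl⟩ ⟨z', hz', he⟩
    apply hne
    obtain ⟨ζ, hζ, l, hl, rfl⟩ := (hπ.fibre _ _).mp he.symm
    have hw'' := hsep' w w' hw hw' ζ l z _ hζ hl hz hz' rfl
    -- the group element `y ↦ ζ y + l` maps one disc onto the other
    have hon : (fun y => ζ * y + l) '' ball w (r / ‖a‖) = ball w' (r / ‖a‖) := by
      have hζ0 := h.root_ne_zero hζ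
      ext y
      simp only [Set.mem_image, mem_ball, dist_eq_norm]
      constructor
      · rintro ⟨x, hx, rfl⟩
        rw [hw'', show ζ * x + l - (ζ * w + l) = ζ * (x - w) by ring, norm_mul, h.norm_root hζ,
          one_mul]
        exact hx
      · intro hy
        refine ⟨ζ⁻¹ * (y - l), ?_, by field_simp; ring⟩
        rw [hw''] at hy
        rw [show ζ⁻¹ * (y - l) - w = ζ⁻¹ * (y - (ζ * w + l)) by field_simp; ring, norm_mul,
          norm_inv, h.norm_root hζ, inv_one, one_mul]
        exact hy
    rw [← hon, Set.image_image]
    refine Set.image_congr fun y _ => ?_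
    rw [hπ.fibre]
    exact ⟨ζ, hζ, l, hl, rfl⟩
  · ext x
    obtain ⟨z, rfl⟩ := hπ.surjective x
    rw [Set.range_comp, range_discMap z₀ hrC, hrn]
    simp only [Set.mem_preimage, Set.mem_sUnion, f, hf]
    constructor
    · rintro ⟨y, hy, he⟩
      obtain ⟨ζ, hζ, l, hl, he'⟩ := (hπ.fibre _ _).mp he
      refine ⟨_, ⟨(ζ * z₀ + l) / a, ⟨ζ, hζ, l, hl, by field_simp⟩, rfl⟩, z, ?_, rfl⟩
      rw [hball, mul_div_cancel₀ _ ha0, he', mem_ball, dist_eq_norm,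
        show ζ * y + l - (ζ * z₀ + l) = ζ * (y - z₀) by ring, norm_mul, h.norm_root hζ, one_mul]
      simpa [dist_eq_norm] using hy
    · rintro ⟨_, ⟨w, hw, rfl⟩, z', hz', he⟩
      obtain ⟨ζ, hζ, l, hl, he'⟩ := h.sameOrbit_symm hw
      have h2 : π (a * z) = π (a * z') := by
        rw [← hf z, ← hf z', he]
      refine ⟨ζ * (a * z') + l, ?_, ?_⟩
      · rw [he', mem_ball, dist_eq_norm,
          show ζ * (a * z') + l - (ζ * (a * w) + l) = ζ * (a * z' - a * w) by ring, norm_mul,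
          h.norm_root hζ, one_mul]
        simpa [dist_eq_norm] using (hball _ _).mp hz'
      · rw [h2, eq_comm, hπ.fibre]
        exact ⟨ζ, hζ, l, hl, rfl⟩
  · rintro _ ⟨w, hw, rfl⟩
    obtain ⟨ζ, hζ, l, hl, he⟩ := hw
    have hc : ζ * r / a ≠ 0 := div_ne_zero (mul_ne_zero (h.root_ne_zero hζ) hrC) ha0
    have hcn : ‖ζ * r / a‖ = r / ‖a‖ := by
      rw [norm_div, norm_mul, h.norm_root hζ, hrn, one_mul]
    refine ⟨_, π ∘ discMap w (ζ * r / a), hπ.isFoldingChart h hc ?_, ?_, ?_⟩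
    · rw [hcn]
      exact fun ξ k z z' => hsep' w w ⟨ζ, hζ, l, hl, he⟩ ⟨ζ, hζ, l, hl, he⟩ ξ k z z'
    · rw [Set.range_comp, range_discMap w hc, hcn]
    · intro z
      simp only [Function.comp_apply, f, hf]
      rw [eq_comm, hπ.fibre]
      refine ⟨ζ, hζ, l, hl, ?_⟩
      rw [discMap, discMap, mul_add, he]
      field_simp
      ring

end IsUniformization

/-! ### Lifting an orbifold covering to the plane -/

/-- An induction over the subintervals of `ℝ`. -/
theorem interval_induction {Q : ℝ → ℝ → Prop}
    (hloc : ∀ x, ∃ ε > 0, ∀ a b, x - ε < a → a ≤ b → b < x + ε → Q a b)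
    (hadd : ∀ a b c, a ≤ b → b ≤ c → Q a b → Q b c → Q a c) {a b : ℝ} (hab : a ≤ b) : Q a b := by
  set s : Set ℝ := {x | x ≤ b ∧ a ≤ x ∧ Q a x} with hs
  have has : a ∈ s := by
    obtain ⟨ε, hε, h⟩ := hloc a
    exact ⟨hab, le_rfl, h a a (by linarith) le_rfl (by linarith)⟩
  have hbdd : BddAbove s := ⟨b, fun x hx => hx.1⟩
  obtain ⟨ε, hε, h⟩ := hloc (sSup s)
  obtain ⟨x, hx, hxs⟩ := exists_lt_of_lt_csSup ⟨a, has⟩ (show sSup s - ε < sSup s by linarith)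
  have hxle : x ≤ sSup s := le_csSup hbdd hx
  have hxy : x ≤ min b (sSup s + ε / 2) := le_min hx.1 (by linarith)
  have hQ : Q a (min b (sSup s + ε / 2)) := by
    refine hadd a x _ hx.2.1 hxy hx.2.2 (h _ _ hxs hxy ?_)
    exact (min_le_right _ _).trans_lt (by linarith)
  have hmem : min b (sSup s + ε / 2) ∈ s := ⟨min_le_left _ _, hx.2.1.trans hxy, hQ⟩
  have hle := le_csSup hbdd hmem
  rcases min_choice b (sSup s + ε / 2) with hm | hm
  · rwa [hm] at hQ
  · rw [hm] at hle; linarith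

/-- A bounded convex open subset of the plane is homeomorphic to the plane, so it stays connected
when a countable set is removed. -/
theorem Convex.isPreconnected_diff_countable {U S : Set ℂ} (hc : Convex ℝ U) (ho : IsOpen U)
    (hb : Bornology.IsBounded U) (hS : S.Countable) : IsPreconnected (U \ S) := by
  rcases U.eq_empty_or_nonempty with rfl | hne
  · simpa using isPreconnected_empty
  obtain ⟨e, he, -, -⟩ := exists_homeomorph_image_interior_closure_frontier_eq_unitBall hc
    (by rwa [ho.interior_eq]) hb
  rw [ho.interior_eq] at he
  set j : ℂ → ℂ := fun z => e.symm (discMap 0 1 z) with hj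
  have hjc : Continuous j :=
    e.symm.continuous.comp (isOpenEmbedding_discMap 0 one_ne_zero).continuous
  have hji : Function.Injective j :=
    e.symm.injective.comp (isOpenEmbedding_discMap 0 one_ne_zero).injective
  have hU : U = Set.range j := by
    rw [hj, show (fun z => e.symm (discMap 0 1 z)) = e.symm ∘ discMap 0 1 from rfl, Set.range_comp,
      range_discMap 0 one_ne_zero, norm_one, ← he, ← Set.image_comp]
    simp
  have h1 : U \ S = j '' (j ⁻¹' S)ᶜ := by
    rw [hU, ← Set.preimage_compl, Set.image_preimage_eq_inter_range, Set.inter_comm]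
    rfl
  rw [h1]
  exact ((hS.preimage hji).isConnected_compl_of_one_lt_rank
    (by simp)).isPreconnected.image _ hjc.continuousOn

namespace IsUniformization

variable {O : ConeOrbifold X} {q : ℕ} {ρ : ℂ} {t : ℤ} {π : ℂ → X} {g : ℂ → X}

theorem countable_singular (hπ : IsUniformization O q ρ π) (h : IsCrystRotation q ρ t) :
    {z | O.index (π z) ≠ 1}.Countable := by
  have hΛ : (rotLattice ρ : Set ℂ).Countable := by
    have : (rotLattice ρ : Set ℂ) = Set.range fun p : ℤ × ℤ => (p.1 : ℂ) + p.2 * ρ := by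
      ext z
      constructor
      · rintro ⟨m, n, rfl⟩; exact ⟨(m, n), rfl⟩
      · rintro ⟨⟨m, n⟩, rfl⟩; exact ⟨m, n, rfl⟩
    rw [this]
    exact Set.countable_range _
  have hc : (⋃ j : Fin q, (fun l => l / (1 - ρ ^ (j : ℕ))) '' (rotLattice ρ : Set ℂ)).Countable :=
    Set.countable_iUnion fun j => hΛ.image _
  refine hc.mono fun z hz => ?_
  obtain ⟨ζ, ⟨hζ, hl⟩, hne⟩ : ∃ ζ : ℂ, (ζ ^ q = 1 ∧ (1 - ζ) * z ∈ rotLattice ρ) ∧ ζ ≠ 1 := by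
    by_contra hcon
    push Not at hcon
    apply hz
    rw [hπ.index, Nat.card_eq_one_iff_unique]
    exact ⟨⟨fun a b => Subtype.ext ((hcon a a.2).trans (hcon b b.2).symm)⟩, ⟨1, by simp⟩⟩
  obtain ⟨j, hj, rfl⟩ := h.exists_pow hζ
  refine Set.mem_iUnion.mpr ⟨⟨j, hj⟩, _, hl, ?_⟩
  have : 1 - ρ ^ j ≠ 0 := sub_ne_zero.mpr hne.symm
  field_simp

/-- `H` is a continuous lift of `g` to the plane over the set `U`. -/
def IsLiftOn {Y : Type*} (π g : ℂ → Y) (H : ℂ → ℂ) (U : Set ℂ) : Prop :=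
  ContinuousOn H U ∧ ∀ z ∈ U, π (H z) = g z

theorem IsLiftOn.mono {Y : Type*} {π g : ℂ → Y} {H : ℂ → ℂ} {U V : Set ℂ}
    (hH : IsLiftOn π g H V) (hUV : U ⊆ V) : IsLiftOn π g H U :=
  ⟨hH.1.mono hUV, fun z hz => hH.2 z (hUV hz)⟩

theorem IsLiftOn.affine (hπ : IsUniformization O q ρ π) {H : ℂ → ℂ} {U : Set ℂ}
    (hH : IsLiftOn π g H U) {ζ l : ℂ} (hζ : ζ ^ q = 1) (hl : l ∈ rotLattice ρ) :
    IsLiftOn π g (fun z => ζ * H z + l) U :=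
  ⟨(continuousOn_const.mul hH.1).add continuousOn_const, fun z hz => by
    rw [← hH.2 z hz, eq_comm, hπ.fibre]; exact ⟨ζ, hζ, l, hl, rfl⟩⟩

/-- Two lifts differ by an element of the group, as long as the domain stays connected when the
points over singular points are removed. -/
theorem exists_affine_of_isLiftOn (hπ : IsUniformization O q ρ π) (h : IsCrystRotation q ρ t)
    (hS : {z | O.index (g z) ≠ 1}.Countable) {U : Set ℂ} (hU : IsOpen U)
    (hconn : IsPreconnected (U \ {z | O.index (g z) ≠ 1})) {H₁ H₂ : ℂ → ℂ}
    (h₁ : IsLiftOn π g H₁ U) (h₂ : IsLiftOn π g H₂ U) :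
    ∃ ζ : ℂ, ζ ^ q = 1 ∧ ∃ l ∈ rotLattice ρ, ∀ z ∈ U, H₂ z = ζ * H₁ z + l := by
  set S := {z | O.index (g z) ≠ 1}
  have hcl : U ⊆ closure (U \ S) := by
    have := (hS.dense_compl ℝ).open_subset_closure_inter hU
    rwa [← Set.sdiff_eq] at this
  rcases (U \ S).eq_empty_or_nonempty with hemp | ⟨z₁, hz₁⟩
  · rw [hemp, closure_empty] at hcl
    exact ⟨1, by simp, 0, zero_mem _, fun z hz => (hcl hz).elim⟩
  have horb : ∀ z ∈ U, SameOrbit q ρ (H₁ z) (H₂ z) := fun z hz =>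
    (hπ.fibre _ _).mp ((h₁.2 z hz).trans (h₂.2 z hz).symm)
  obtain ⟨ζ, hζ, l, hl, he⟩ := horb z₁ hz₁.1
  refine ⟨ζ, hζ, l, hl, ?_⟩
  have key : Set.EqOn H₂ (fun z => ζ * H₁ z + l) (U \ S) := by
    intro z hz
    have hP := hconn.induction₂ (fun x y => ∀ ζ l : ℂ, ζ ^ q = 1 → l ∈ rotLattice ρ →
      (H₂ x = ζ * H₁ x + l ↔ H₂ y = ζ * H₁ y + l)) ?_ ?_ ?_ hz₁ hz
    · exact (hP ζ l hζ hl).mp he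
    · -- near an ordinary point, one and the same group element relates the two lifts
      intro x hx
      obtain ⟨r, hr, hsep⟩ := h.exists_separation (H₁ x) (H₂ x)
      have e1 : ∀ᶠ y in 𝓝[U \ S] x, H₁ y ∈ ball (H₁ x) r :=
        (h₁.1.mono Set.sdiff_subset x hx).eventually (ball_mem_nhds _ hr)
      have e2 : ∀ᶠ y in 𝓝[U \ S] x, H₂ y ∈ ball (H₂ x) r :=
        (h₂.1.mono Set.sdiff_subset x hx).eventually (ball_mem_nhds _ hr)
      filter_upwards [e1, e2, self_mem_nhdsWithin] with y hy1 hy2 hyU ξ k hξ hk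
      constructor
      · intro hxe
        obtain ⟨ξ', hξ', k', hk', hye⟩ := horb y hyU.1
        have hxe' := hsep ξ' k' _ _ hξ' hk' hy1 hy2 hye
        have hord : O.index (π (H₁ x)) = 1 := by
          rw [h₁.2 x hx.1]; by_contra hc; exact hx.2 hc
        have hξi : ξ⁻¹ ^ q = 1 := by rw [inv_pow, hξ, inv_one]
        have hξ0 := h.root_ne_zero hξ
        have h1 := hπ.eq_one_of_index h hord (ζ := ξ⁻¹ * ξ') (l := ξ⁻¹ * (k' - k))
          (by rw [mul_pow, hξi, hξ', one_mul]) (h.mul_mem (h.root_mem hξi) (sub_mem hk' hk)) (by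
            field_simp
            linear_combination hxe' - hxe)
        have h2 : ξ' = ξ := by
          field_simp at h1
          exact h1
        subst h2
        rw [hye]
        linear_combination hxe - hxe'
      · exact hsep ξ k _ _ hξ hk hy1 hy2
    · intro x y z _ _ _ hxy hyz ξ k hξ hk
      exact (hxy ξ k hξ hk).trans (hyz ξ k hξ hk)
    · intro x y _ _ hxy ξ k hξ hk
      exact (hxy ξ k hξ hk).symm
  exact key.of_subset_closure h₂.1 ((h₁.affine hπ hζ hl).1) Set.sdiff_subset hcl

/-- Lifts over two open sets with convex intersection can be glued, after applying an element of the
group to one of them. -/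
theorem exists_isLiftOn_union (hπ : IsUniformization O q ρ π) (h : IsCrystRotation q ρ t)
    (hS : {z | O.index (g z) ≠ 1}.Countable) {U V : Set ℂ} (hU : IsOpen U) (hV : IsOpen V)
    (hc : Convex ℝ (U ∩ V)) (hb : Bornology.IsBounded (U ∩ V))
    (hHU : ∃ H, IsLiftOn π g H U) (hHV : ∃ H, IsLiftOn π g H V) :
    ∃ H, IsLiftOn π g H (U ∪ V) := by
  classical
  obtain ⟨H₁, h₁⟩ := hHU
  obtain ⟨H₂, h₂⟩ := hHV
  obtain ⟨ζ, hζ, l, hl, he⟩ := hπ.exists_affine_of_isLiftOn h hS (hU.inter hV)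
    (hc.isPreconnected_diff_countable (hU.inter hV) hb hS)
    (h₂.mono Set.inter_subset_right) (h₁.mono Set.inter_subset_left)
  have h₃ := h₂.affine hπ hζ hl
  set H : ℂ → ℂ := fun z => if z ∈ U then H₁ z else ζ * H₂ z + l with hH
  have hHU : Set.EqOn H H₁ U := fun z hz => by simp [hH, hz]
  have hHV : Set.EqOn H (fun z => ζ * H₂ z + l) V := fun z hz => by
    by_cases hzU : z ∈ U
    · rw [hHU hzU]; exact he z ⟨hzU, hz⟩
    · simp [hH, hzU]
  refine ⟨H, ContinuousOn.union_of_isOpen (h₁.1.congr hHU) (h₃.1.congr hHV) hU hV, ?_⟩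
  rintro z (hz | hz)
  · rw [hHU hz]; exact h₁.2 z hz
  · rw [hHV hz]; exact h₃.2 z hz

/-- The open rectangle `(a, b) × (c, d)` in the plane. -/
def openBox (a b c d : ℝ) : Set ℂ := {z | (a < z.re ∧ z.re < b) ∧ (c < z.im ∧ z.im < d)}

theorem openBox_eq (a b c d : ℝ) : openBox a b c d = Set.Ioo a b ×ℂ Set.Ioo c d := rfl

theorem isOpen_openBox (a b c d : ℝ) : IsOpen (openBox a b c d) := by
  rw [openBox_eq]; exact isOpen_Ioo.reProdIm isOpen_Ioo

theorem convex_openBox (a b c d : ℝ) : Convex ℝ (openBox a b c d) := by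
  exact ((convex_Ioo a b).linear_preimage Complex.reLm).inter
    ((convex_Ioo c d).linear_preimage Complex.imLm)

theorem isBounded_openBox (a b c d : ℝ) : Bornology.IsBounded (openBox a b c d) := by
  rw [openBox_eq]; exact (isBounded_Ioo a b).reProdIm (isBounded_Ioo c d)

theorem openBox_subset {a b c d a' b' c' d' : ℝ} (ha : a' ≤ a) (hb : b ≤ b') (hc : c' ≤ c)
    (hd : d ≤ d') : openBox a b c d ⊆ openBox a' b' c' d' := fun _ hz =>
  ⟨⟨ha.trans_lt hz.1.1, hz.1.2.trans_le hb⟩, hc.trans_lt hz.2.1, hz.2.2.trans_le hd⟩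

theorem exists_isLiftOn_openBox (hπ : IsUniformization O q ρ π) (h : IsCrystRotation q ρ t)
    (hS : {z | O.index (g z) ≠ 1}.Countable)
    (hloc : ∀ z₀ : ℂ, ∃ U, IsOpen U ∧ z₀ ∈ U ∧ ∃ H, IsLiftOn π g H U) {a b c d : ℝ} (hab : a ≤ b)
    (hcd : c ≤ d) : ∃ H, IsLiftOn π g H (openBox a b c d) := by
  have hglue : ∀ {U V W : Set ℂ} {a b c d : ℝ}, IsOpen U → IsOpen V → W ⊆ U ∪ V →
      U ∩ V = openBox a b c d → (∃ H, IsLiftOn π g H U) → (∃ H, IsLiftOn π g H V) →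
      ∃ H, IsLiftOn π g H W := by
    intro U V W a b c d hU hV hW hi h1 h2
    obtain ⟨H, hH⟩ := hπ.exists_isLiftOn_union h hS hU hV
      (by rw [hi]; exact convex_openBox a b c d) (by rw [hi]; exact isBounded_openBox a b c d) h1 h2
    exact ⟨H, hH.mono hW⟩
  -- thin horizontal rectangles
  have hstrip : ∀ y a b : ℝ, a ≤ b →
      ∃ ε > 0, ∃ H, IsLiftOn π g H (openBox (a - ε) (b + ε) (y - ε) (y + ε)) := by
    intro y a b hab
    refine interval_induction (Q := fun a b =>
      ∃ ε > 0, ∃ H, IsLiftOn π g H (openBox (a - ε) (b + ε) (y - ε) (y + ε))) ?_ ?_ hab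
    · intro x
      obtain ⟨U, hU, hxU, H, hH⟩ := hloc ⟨x, y⟩
      obtain ⟨δ, hδ, hδU⟩ := Metric.isOpen_iff.mp hU _ hxU
      refine ⟨δ / 4, by positivity, fun a b ha hab hb => ⟨δ / 4, by positivity, H, hH.mono ?_⟩⟩
      rintro z ⟨⟨h1, h2⟩, h3, h4⟩
      apply hδU
      rw [mem_ball, dist_eq_norm]
      refine (Complex.norm_le_abs_re_add_abs_im _).trans_lt ?_
      have h5 : |z.re - x| < δ / 2 := abs_lt.mpr ⟨by linarith, by linarith⟩
      have h6 : |z.im - y| < δ / 2 := abs_lt.mpr ⟨by linarith, by linarith⟩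
      simp only [Complex.sub_re, Complex.sub_im]
      linarith
    · rintro a b c hab hbc ⟨ε₁, hε₁, H₁, h₁⟩ ⟨ε₂, hε₂, H₂, h₂⟩
      have hm : 0 < min ε₁ ε₂ := lt_min hε₁ hε₂
      have hm1 := min_le_left ε₁ ε₂
      have hm2 := min_le_right ε₁ ε₂
      set ε := min ε₁ ε₂
      refine ⟨ε, hm, hglue (a := b - ε) (b := b + ε) (c := y - ε) (d := y + ε)
        (isOpen_openBox _ _ _ _) (isOpen_openBox _ _ _ _) ?_ ?_
        ⟨H₁, h₁.mono (openBox_subset (a := a - ε) (b := b + ε) (c := y - ε) (d := y + ε)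
          (by linarith) (by linarith) (by linarith) (by linarith))⟩
        ⟨H₂, h₂.mono (openBox_subset (a := b - ε) (b := c + ε) (c := y - ε) (d := y + ε)
          (by linarith) (by linarith) (by linarith) (by linarith))⟩⟩
      · rintro z ⟨⟨h1, h2⟩, h3⟩
        rcases lt_or_ge z.re (b + ε) with h4 | h4
        · exact Or.inl ⟨⟨h1, h4⟩, h3⟩
        · exact Or.inr ⟨⟨by linarith, h2⟩, h3⟩
      · ext z
        constructor
        · rintro ⟨⟨⟨h1, h2⟩, h3⟩, ⟨h4, h5⟩, h6⟩
          exact ⟨⟨h4, h2⟩, h3⟩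
        · rintro ⟨⟨h1, h2⟩, h3⟩
          exact ⟨⟨⟨by linarith, h2⟩, h3⟩, ⟨h1, by linarith⟩, h3⟩
  have hbox : ∃ ε > 0, ∃ H, IsLiftOn π g H (openBox (a - ε) (b + ε) (c - ε) (d + ε)) := by
    refine interval_induction (Q := fun c d =>
      ∃ ε > 0, ∃ H, IsLiftOn π g H (openBox (a - ε) (b + ε) (c - ε) (d + ε))) ?_ ?_ hcd
    · intro y
      obtain ⟨ε, hε, H, hH⟩ := hstrip y a b hab
      refine ⟨ε / 2, by positivity, fun c d hc hcd hd => ⟨ε / 2, by positivity, H, hH.mono ?_⟩⟩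
      exact openBox_subset (by linarith) (by linarith) (by linarith) (by linarith)
    · rintro c d e hcd hde ⟨ε₁, hε₁, H₁, h₁⟩ ⟨ε₂, hε₂, H₂, h₂⟩
      have hm : 0 < min ε₁ ε₂ := lt_min hε₁ hε₂
      have hm1 := min_le_left ε₁ ε₂
      have hm2 := min_le_right ε₁ ε₂
      set ε := min ε₁ ε₂
      refine ⟨ε, hm, hglue (a := a - ε) (b := b + ε) (c := d - ε) (d := d + ε)
        (isOpen_openBox _ _ _ _) (isOpen_openBox _ _ _ _) ?_ ?_
        ⟨H₁, h₁.mono (openBox_subset (a := a - ε) (b := b + ε) (c := c - ε) (d := d + ε)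
          (by linarith) (by linarith) (by linarith) (by linarith))⟩
        ⟨H₂, h₂.mono (openBox_subset (a := a - ε) (b := b + ε) (c := d - ε) (d := e + ε)
          (by linarith) (by linarith) (by linarith) (by linarith))⟩⟩
      · rintro z ⟨h3, h1, h2⟩
        rcases lt_or_ge z.im (d + ε) with h4 | h4
        · exact Or.inl ⟨h3, h1, h4⟩
        · exact Or.inr ⟨h3, by linarith, h2⟩
      · ext z
        constructor
        · rintro ⟨⟨h3, h1, h2⟩, h6, h4, h5⟩
          exact ⟨h3, h4, h2⟩
        · rintro ⟨h3, h1, h2⟩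
          exact ⟨⟨h3, by linarith, h2⟩, h3, h1, by linarith⟩
  obtain ⟨ε, hε, H, hH⟩ := hbox
  exact ⟨H, hH.mono (openBox_subset (by linarith) (by linarith) (by linarith) (by linarith))⟩

/-- A map from the plane that lifts locally lifts globally: the lifts over growing squares are
normalized at one point and then agree. -/
theorem exists_isLiftOn_univ (hπ : IsUniformization O q ρ π) (h : IsCrystRotation q ρ t)
    (hS : {z | O.index (g z) ≠ 1}.Countable)
    (hloc : ∀ z₀ : ℂ, ∃ U, IsOpen U ∧ z₀ ∈ U ∧ ∃ H, IsLiftOn π g H U) :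
    ∃ F, IsLiftOn π g F Set.univ := by
  set B : ℕ → Set ℂ := fun n => openBox (-(n + 1)) (n + 1) (-(n + 1)) (n + 1) with hB
  have hBo : ∀ n, IsOpen (B n) := fun n => isOpen_openBox _ _ _ _
  have hBmono : ∀ m n, m ≤ n → B m ⊆ B n := fun m n hmn => by
    have : (m : ℝ) ≤ n := by exact_mod_cast hmn
    exact openBox_subset (by linarith) (by linarith) (by linarith) (by linarith)
  have hBmem : ∀ z : ℂ, z ∈ B ⌈‖z‖⌉₊ := by
    intro z
    have h1 := Nat.le_ceil ‖z‖
    have h2 := abs_le.mp (Complex.abs_re_le_norm z)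
    have h3 := abs_le.mp (Complex.abs_im_le_norm z)
    exact ⟨⟨by linarith, by linarith⟩, by linarith, by linarith⟩
  obtain ⟨z₁, hz₁S, hz₁B⟩ : ∃ z₁, O.index (g z₁) = 1 ∧ z₁ ∈ B 0 := by
    obtain ⟨z, hz, hz'⟩ := (hS.dense_compl ℝ).inter_open_nonempty (B 0) (hBo 0)
      ⟨0, by simp [hB, openBox]⟩
    exact ⟨z, by simpa using hz', hz⟩
  have hz₁n : ∀ n, z₁ ∈ B n := fun n => hBmono 0 n n.zero_le hz₁B
  obtain ⟨w₁, hw₁⟩ := hπ.surjective (g z₁)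
  have hex : ∀ n, ∃ H, IsLiftOn π g H (B n) ∧ H z₁ = w₁ := by
    intro n
    have hn : (0 : ℝ) ≤ n := n.cast_nonneg
    obtain ⟨H, hH⟩ := hπ.exists_isLiftOn_openBox h hS hloc (a := -(n + 1)) (b := n + 1)
      (c := -(n + 1)) (d := n + 1) (by linarith) (by linarith)
    obtain ⟨ζ, hζ, l, hl, he⟩ := (hπ.fibre _ _).mp ((hH.2 z₁ (hz₁n n)).trans hw₁.symm)
    exact ⟨_, hH.affine hπ hζ hl, he.symm⟩
  choose H hH hHz using hex
  have hagree : ∀ m n, m ≤ n → Set.EqOn (H n) (H m) (B m) := by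
    intro m n hmn z hz
    obtain ⟨ζ, hζ, l, hl, he⟩ := hπ.exists_affine_of_isLiftOn h hS (hBo m)
      ((convex_openBox _ _ _ _).isPreconnected_diff_countable (hBo m) (isBounded_openBox _ _ _ _)
        hS) (hH m) ((hH n).mono (hBmono m n hmn))
    have h1 := he z₁ (hz₁n m)
    rw [hHz, hHz] at h1
    have h2 := hπ.eq_one_of_index h (by rw [hw₁]; exact hz₁S) hζ hl h1
    rw [he z hz]
    subst h2
    linear_combination -h1
  set F : ℂ → ℂ := fun z => H ⌈‖z‖⌉₊ z with hF
  have hFH : ∀ n, Set.EqOn F (H n) (B n) := by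
    intro n z hz
    rcases le_total n ⌈‖z‖⌉₊ with hle | hle
    · exact hagree _ _ hle hz
    · exact (hagree _ _ hle (hBmem z)).symm
  refine ⟨F, ?_, fun z _ => (hH _).2 z (hBmem z)⟩
  rw [continuousOn_univ, continuous_iff_continuousAt]
  intro z
  have hnh := (hBo _).mem_nhds (hBmem z)
  exact (((hH _).1.continuousAt hnh)).congr ((hFH _).symm.eventuallyEq_of_mem hnh)

/-- Every orbifold covering lifts locally to a local homeomorphism of the plane. -/
theorem exists_local_lift (hπ : IsUniformization O q ρ π) (h : IsCrystRotation q ρ t) {f : X → X}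
    (hf : O.IsCovering O f) (z₀ : ℂ) :
    ∃ e : OpenPartialHomeomorph ℂ ℂ, z₀ ∈ e.source ∧ ∀ z ∈ e.source, π (e z) = f (π z) := by
  obtain ⟨w₀, hw₀⟩ := hπ.surjective (f (π z₀))
  obtain ⟨b, ψ, hψ, hψ0, 𝒱, -, h𝒱, hV⟩ := hf (f (π z₀))
  have hmem : π z₀ ∈ ⋃₀ 𝒱 := by rw [← h𝒱]; exact ⟨0, hψ0⟩
  obtain ⟨V, hV𝒱, hzV⟩ := hmem
  obtain ⟨a, φ, hφ, rfl, hfφ⟩ := hV V hV𝒱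
  obtain ⟨y, hy⟩ := hzV
  have hy0 : y = 0 := by
    rw [← hψ.eq_zero_iff, ← hfφ, hy, hψ0]
  subst hy0
  obtain ⟨c₁, hc₁, hP₁⟩ := hπ.exists_isFoldingChart h z₀
  obtain ⟨c₂, hc₂, hP₂⟩ := hπ.exists_isFoldingChart h w₀
  have ha : a = O.index (π z₀) := by rw [← hφ.index_zero, hy]
  have hb : b = O.index (π w₀) := by rw [← hψ.index_zero, hψ0, hw₀]
  subst ha hb
  obtain ⟨e₁, he₁0, he₁, hφe₁⟩ := hP₁.exists_openPartialHomeomorph hφ (by simp [hy])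
  obtain ⟨e₂, he₂0, he₂, hψe₂⟩ := hψ.exists_openPartialHomeomorph hP₂ (by simp [hψ0, hw₀])
  have d₁ := isOpenEmbedding_discMap z₀ hc₁
  have d₂ := isOpenEmbedding_discMap w₀ hc₂
  set D₁ := d₁.toOpenPartialHomeomorph _ with hD₁
  set D₂ := d₂.toOpenPartialHomeomorph _ with hD₂
  have hD₁s : ∀ y, D₁.symm (discMap z₀ c₁ y) = y := fun y => d₁.toOpenPartialHomeomorph_left_inv
  have hD₁0 : D₁.symm z₀ = 0 := by
    have := hD₁s 0
    rwa [discMap_zero] at this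
  refine ⟨D₁.symm.trans (e₁.trans (e₂.trans D₂)), ?_, ?_⟩
  · simp only [OpenPartialHomeomorph.trans_source, Set.mem_inter_iff, Set.mem_preimage, hD₁0, he₁,
      he₂, he₁0, he₂0, true_and]
    refine ⟨?_, ?_⟩
    · simp only [hD₁, OpenPartialHomeomorph.symm_source,
        IsOpenEmbedding.toOpenPartialHomeomorph_target]
      exact ⟨0, by simp⟩
    · simp [hD₂]
  · intro z hz
    simp only [OpenPartialHomeomorph.trans_source, Set.mem_inter_iff, Set.mem_preimage] at hz
    obtain ⟨hz1, hz2, hz3, -⟩ := hz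
    obtain ⟨y, rfl⟩ : z ∈ Set.range (discMap z₀ c₁) := by simpa [hD₁] using hz1
    rw [hD₁s] at hz2 hz3
    change π (discMap w₀ c₂ (e₂ (e₁ (D₁.symm (discMap z₀ c₁ y))))) = _
    rw [hD₁s]
    have h1 := hψe₂ _ hz3
    have h2 := hφe₁ _ hz2
    simp only [Function.comp_apply] at h1 h2
    rw [h1, ← hfφ, h2]

theorem countable_singular_comp (hπ : IsUniformization O q ρ π) (h : IsCrystRotation q ρ t)
    {f : X → X} (hf : O.IsCovering O f) : {z | O.index (f (π z)) ≠ 1}.Countable := by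
  choose e he hπe using hπ.exists_local_lift h hf
  obtain ⟨s, hs, hcov⟩ := TopologicalSpace.countable_cover_nhds
    (f := fun z => (e z).source) fun z => (e z).open_source.mem_nhds (he z)
  have : {z | O.index (f (π z)) ≠ 1} ⊆
      ⋃ x ∈ s, (e x).source ∩ e x ⁻¹' {w | O.index (π w) ≠ 1} := by
    intro z hz
    have hzu : z ∈ ⋃ x ∈ s, (e x).source := by rw [hcov]; trivial
    simp only [Set.mem_iUnion] at hzu ⊢
    obtain ⟨x, hx, hzx⟩ := hzu
    refine ⟨x, hx, hzx, ?_⟩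
    rw [Set.mem_preimage, Set.mem_ofPred_eq, hπe x z hzx]
    exact hz
  refine (hs.biUnion fun x _ => ?_).mono this
  refine Set.MapsTo.countable_of_injOn (f := e x) (fun z hz => hz.2)
    ((e x).injOn.mono Set.inter_subset_left) (hπ.countable_singular h)

/-- Every orbifold covering lifts to a local homeomorphism of the plane. -/
theorem exists_lift (hπ : IsUniformization O q ρ π) (h : IsCrystRotation q ρ t)
    {f : X → X} (hf : O.IsCovering O f) :
    ∃ F : ℂ → ℂ, IsLocalHomeomorph F ∧ ∀ z, π (F z) = f (π z) := by
  have hS := hπ.countable_singular_comp h hf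
  obtain ⟨F, hF⟩ := hπ.exists_isLiftOn_univ h hS fun z₀ => by
    obtain ⟨e, he, hπe⟩ := hπ.exists_local_lift h hf z₀
    exact ⟨e.source, e.open_source, he, e, e.continuousOn, hπe⟩
  refine ⟨F, IsLocalHomeomorph.mk F fun z₀ => ?_, fun z => hF.2 z trivial⟩
  obtain ⟨e, he, hπe⟩ := hπ.exists_local_lift h hf z₀
  obtain ⟨r, hr, hre⟩ := Metric.isOpen_iff.mp e.open_source z₀ he
  obtain ⟨ζ, hζ, l, hl, heq⟩ := hπ.exists_affine_of_isLiftOn h hS (isOpen_ball (x := z₀) (ε := r))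
    ((convex_ball z₀ r).isPreconnected_diff_countable isOpen_ball isBounded_ball hS)
    (show IsLiftOn π (fun z => f (π z)) e (ball z₀ r) from
      ⟨e.continuousOn.mono hre, fun z hz => hπe z (hre hz)⟩) (hF.mono (Set.subset_univ _))
  refine ⟨(e.restrOpen (ball z₀ r) isOpen_ball).transHomeomorph
    ((Homeomorph.mulLeft₀ ζ (h.root_ne_zero hζ)).trans (Homeomorph.addRight l)), ?_, ?_⟩
  · simpa using ⟨he, hr⟩
  · intro z hz
    have hz' : z ∈ ball z₀ r := by
      have : z ∈ e.source ∩ ball z₀ r := by simpa using hz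
      exact this.2
    exact heq z hz'

/-- A lift of a map of the orbifold carries the group action to itself. -/
theorem exists_affine_comp (hπ : IsUniformization O q ρ π) (h : IsCrystRotation q ρ t)
    {f : X → X} (hS : {z | O.index (f (π z)) ≠ 1}.Countable) {F : ℂ → ℂ} (hFc : Continuous F)
    (hF : ∀ z, π (F z) = f (π z)) {ζ l : ℂ} (hζ : ζ ^ q = 1) (hl : l ∈ rotLattice ρ) :
    ∃ ξ : ℂ, ξ ^ q = 1 ∧ ∃ k ∈ rotLattice ρ, ∀ z, F (ζ * z + l) = ξ * F z + k := by
  have h1 : IsLiftOn π (fun z => f (π z)) F Set.univ := ⟨hFc.continuousOn, fun z _ => hF z⟩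
  have h2 : IsLiftOn π (fun z => f (π z)) (fun z => F (ζ * z + l)) Set.univ := by
    refine ⟨by fun_prop, fun z _ => ?_⟩
    rw [hF]
    congr 1
    rw [eq_comm, hπ.fibre]
    exact ⟨ζ, hζ, l, hl, rfl⟩
  obtain ⟨ξ, hξ, k, hk, he⟩ := hπ.exists_affine_of_isLiftOn h hS isOpen_univ (by
    rw [← Set.compl_eq_univ_sdiff]
    exact (hS.isConnected_compl_of_one_lt_rank (by simp)).isPreconnected) h1 h2
  exact ⟨ξ, hξ, k, hk, fun z => he z trivial⟩

end IsUniformization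

/-! ### The lift is a homeomorphism, and the degree is a norm -/

/-- A local homeomorphism of the plane that is proper is bijective: it is a covering map and the
plane is simply connected. -/
theorem IsLocalHomeomorph.bijective_of_isProperMap {F : ℂ → ℂ} (hF : IsLocalHomeomorph F)
    (hp : IsProperMap F) : Function.Bijective F := by
  have hcov : IsCoveringMap F := by
    rw [isCoveringMap_iff_isCoveringMapOn_univ]
    refine hp.isClosedMap.isCoveringMapOn_of_isLocalHomeomorphOn (fun x _ => ?_)
      (fun x _ => hF x)
    refine (hp.isCompact_preimage isCompact_singleton).finite
      (IsDiscrete.of_openPartialHomeomorph F subset_rfl fun e _ => ?_)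
    obtain ⟨φ, hφ, he⟩ := hF e
    exact ⟨φ, hφ, he.symm⟩
  have hlift : ∀ x, ∃ s : C(ℂ, ℂ), s (F x) = x ∧ F ∘ s = id := by
    intro x
    obtain ⟨s, hs, -⟩ := hcov.existsUnique_continuousMap_lifts (ContinuousMap.id ℂ) (F x) x rfl
    exact ⟨s, hs⟩
  constructor
  · intro x y hxy
    obtain ⟨s, hsx, hs⟩ := hlift x
    have : s ∘ F = id := by
      refine hcov.eq_of_comp_eq (s.continuous.comp hcov.continuous) continuous_id ?_ x hsx
      rw [← Function.comp_assoc, hs]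
      rfl
    have hy := congrFun this y
    simp only [Function.comp_apply, id] at hy
    rw [← hy, ← hxy, hsx]
  · obtain ⟨s, -, hs⟩ := hlift 0
    exact fun y => ⟨s y, congrFun hs y⟩

theorem apply_add_int_mul {F : ℂ → ℂ} {c A : ℂ} (h : ∀ z, F (z + c) = F z + A) (m : ℤ) (z : ℂ) :
    F (z + m * c) = F z + m * A := by
  induction m using Int.induction_on with
  | zero => simp
  | succ i ih =>
    have : z + ((i + 1 : ℤ) : ℂ) * c = z + (i : ℤ) * c + c := by push_cast; ring
    rw [this, h, ih]
    push_cast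
    ring
  | pred i ih =>
    have h1 := h (z + ((-i - 1 : ℤ) : ℂ) * c)
    have : z + ((-i - 1 : ℤ) : ℂ) * c + c = z + (-i : ℤ) * c := by push_cast; ring
    rw [this, ih] at h1
    push_cast at h1 ⊢
    linear_combination -h1

namespace IsCrystRotation

variable {q : ℕ} {ρ : ℂ} {t : ℤ}

/-- Every point of the plane is close to the sublattice `q Λ`. -/
theorem exists_norm_sub_le (h : IsCrystRotation q ρ t) (z : ℂ) :
    ∃ m n : ℤ, ‖z - q * (m + n * ρ)‖ ≤ 2 * q := by
  have hq : (q : ℝ) ≠ 0 := by exact_mod_cast h.q_pos.ne'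
  set y : ℝ := z.im / (q * ρ.im) with hy
  set x : ℝ := z.re / q - y * ρ.re with hx
  have hz : z = q * (x + y * ρ) := by
    apply Complex.ext
    · simp [hx]
      field_simp
    · have hyq : q * (y * ρ.im) = z.im := by
        have := h.im_ne_zero
        rw [hy]
        field_simp
      simp [hyq]
  refine ⟨⌊x⌋, ⌊y⌋, ?_⟩
  have h1 : z - q * ((⌊x⌋ : ℂ) + ⌊y⌋ * ρ) =
      q * ((Int.fract x : ℝ) + (Int.fract y : ℝ) * ρ) := by
    rw [hz, Int.fract, Int.fract]
    push_cast
    ring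
  rw [h1, norm_mul, Complex.norm_natCast, mul_comm]
  gcongr
  refine (norm_add_le _ _).trans ?_
  rw [norm_mul, h.norm_eq_one, Complex.norm_real, Complex.norm_real, mul_one,
    Real.norm_of_nonneg (Int.fract_nonneg x), Real.norm_of_nonneg (Int.fract_nonneg y)]
  linarith [Int.fract_lt_one x, Int.fract_lt_one y]

/-- A continuous function that is invariant under `q Λ` is bounded. -/
theorem exists_norm_le_of_periodic (h : IsCrystRotation q ρ t) {G : ℂ → ℂ} (hG : Continuous G)
    (hper : ∀ (m n : ℤ) z, G (z + q * (m + n * ρ)) = G z) : ∃ C, ∀ z, ‖G z‖ ≤ C := by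
  obtain ⟨C, hC⟩ := (isCompact_closedBall (0 : ℂ) (2 * q)).exists_bound_of_continuousOn
    hG.continuousOn
  refine ⟨C, fun z => ?_⟩
  obtain ⟨m, n, hmn⟩ := h.exists_norm_sub_le z
  have := hper m n (z - q * (m + n * ρ))
  rw [sub_add_cancel] at this
  rw [this]
  exact hC _ (by simpa using hmn)

end IsCrystRotation

/-- `F` intertwines the action of the group with itself, through the endomorphism given on
translations by `l ↦ a σ(l)` and on rotation parts by `σ`, where `σ` is the identity or complex
conjugation. -/
structure IsEquivariantLift (q : ℕ) (ρ : ℂ) (F : ℂ → ℂ) (a : ℂ) (σ : ℂ →+* ℂ) : Prop where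
  bijective : Function.Bijective F
  id_or_conj : σ = RingHom.id ℂ ∨ σ = starRingEnd ℂ
  map_add : ∀ l ∈ rotLattice ρ, ∀ z, F (z + l) = F z + a * σ l
  map_mul : ∀ ζ : ℂ, ζ ^ q = 1 → ∃ k ∈ rotLattice ρ, ∀ z, F (ζ * z) = σ ζ * F z + k

namespace IsUniformization

variable {O : ConeOrbifold X} {q : ℕ} {ρ : ℂ} {t : ℤ} {π : ℂ → X}

theorem isEquivariantLift_mul {a : ℂ} (ha0 : a ≠ 0) :
    IsEquivariantLift q ρ (fun z => a * z) a (RingHom.id ℂ) where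
  bijective := mulLeft_bijective₀ a ha0
  id_or_conj := Or.inl rfl
  map_add l _ z := by simp [mul_add]
  map_mul ζ _ := ⟨0, zero_mem _, fun z => by simp; ring⟩

/-- The lift of an orbifold covering differs from a real-linear map `z ↦ a z` or `z ↦ a z̄` by a
bounded function: on the lattice the lift is additive up to a bounded error, and it is compatible
with the rotation by `ρ`. Therefore the lift is proper, hence bijective, and then it is exactly
equivariant. -/
theorem exists_isEquivariantLift (hπ : IsUniformization O q ρ π) (h : IsCrystRotation q ρ t)
    {f : X → X} (hf : O.IsCovering O f) :
    ∃ (F : ℂ → ℂ) (a : ℂ) (σ : ℂ →+* ℂ), (∀ z, π (F z) = f (π z)) ∧ a ∈ rotLattice ρ ∧ a ≠ 0 ∧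
      IsEquivariantLift q ρ F a σ := by
  obtain ⟨F, hFl, hF⟩ := hπ.exists_lift h hf
  have hS := hπ.countable_singular_comp h hf
  have hFc : Continuous F := hFl.continuous
  have haff := fun {ζ l : ℂ} => hπ.exists_affine_comp h hS hFc hF (ζ := ζ) (l := l)
  have hq0 : (q : ℂ) ≠ 0 := by exact_mod_cast h.q_pos.ne'
  -- iterating `F (z + l) = ξ F z + k` gives a translation after `q` steps, as `ξ ^ q = 1`
  have hiter : ∀ {l ξ k : ℂ}, ξ ^ q = 1 → (∀ z, F (z + l) = ξ * F z + k) →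
      ∀ z, F (z + q * l) = F z + (∑ i ∈ Finset.range q, ξ ^ i) * k := by
    intro l ξ k hξ hl z
    have : ∀ j : ℕ, F (z + j * l) = ξ ^ j * F z + (∑ i ∈ Finset.range j, ξ ^ i) * k := by
      intro j
      induction j with
      | zero => simp
      | succ j ih =>
        have e : z + ((j + 1 : ℕ) : ℂ) * l = z + j * l + l := by push_cast; ring
        rw [e, hl, ih, geom_sum_succ]
        ring
    rw [this q, hξ, one_mul]
  have htrans : ∀ l ∈ rotLattice ρ, ∃ ξ : ℂ, ξ ^ q = 1 ∧ ∃ k ∈ rotLattice ρ,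
      ∀ z, F (z + l) = ξ * F z + k := by
    intro l hl
    simpa using haff (one_pow q) hl
  obtain ⟨A, hA⟩ : ∃ A, ∀ z, F (z + q) = F z + A := by
    obtain ⟨ξ, hξ, k, -, he⟩ := htrans 1 (one_mem_rotLattice ρ)
    exact ⟨_, by simpa using hiter hξ he⟩
  obtain ⟨B, hB⟩ : ∃ B, ∀ z, F (z + q * ρ) = F z + B := by
    obtain ⟨ξ, hξ, k, -, he⟩ := htrans ρ (self_mem_rotLattice ρ)
    exact ⟨_, hiter hξ he⟩
  have hAB : ∀ (m n : ℤ) z, F (z + q * (m + n * ρ)) = F z + (m * A + n * B) := by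
    intro m n z
    have : z + q * ((m : ℂ) + n * ρ) = z + m * q + n * (q * ρ) := by ring
    rw [this, apply_add_int_mul hB, apply_add_int_mul hA]
    ring
  obtain ⟨ξ, hξ, ν, hν, hrot⟩ : ∃ ξ : ℂ, ξ ^ q = 1 ∧ ∃ ν ∈ rotLattice ρ,
      ∀ z, F (ρ * z) = ξ * F z + ν := by
    simpa using haff h.prim.pow_eq_one (zero_mem (rotLattice ρ))
  have hBA : B = ξ * A := by
    have h1 := hrot (0 + q)
    rw [hA, mul_add, mul_zero, zero_add, mul_comm ρ] at h1
    have h2 := hB 0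
    rw [zero_add] at h2
    have h3 := hrot 0
    rw [mul_zero] at h3
    linear_combination h1 - h2 - h3
  have hquad : A * (ξ ^ 2 - t * ξ + 1) = 0 := by
    have h1 := hrot (0 + q * ρ)
    rw [hB] at h1
    have h2 := hAB (-1) t 0
    have e : ρ * (0 + q * ρ) = 0 + q * (((-1 : ℤ) : ℂ) + t * ρ) := by
      push_cast
      linear_combination (q : ℂ) * h.sq
    rw [e, h2] at h1
    have h3 := hrot 0
    rw [mul_zero] at h3
    push_cast at h1
    rw [hBA] at h1
    linear_combination -h1 + h3
  have hA0 : A ≠ 0 := by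
    -- otherwise the image of `F` is compact, open and nonempty
    rintro rfl
    rw [mul_zero] at hBA
    subst hBA
    obtain ⟨C, hC⟩ := h.exists_norm_le_of_periodic hFc fun m n z => by rw [hAB]; simp
    have himg : Set.range F = F '' closedBall 0 (2 * q) := by
      refine subset_antisymm ?_ (Set.image_subset_range _ _)
      rintro _ ⟨z, rfl⟩
      obtain ⟨m, n, hmn⟩ := h.exists_norm_sub_le z
      refine ⟨z - q * (m + n * ρ), by simpa using hmn, ?_⟩
      have := hAB m n (z - q * (m + n * ρ))
      rw [sub_add_cancel] at this
      rw [this]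
      simp
    have hclosed : IsClosed (Set.range F) := by
      rw [himg]
      exact ((isCompact_closedBall _ _).image hFc).isClosed
    have huniv := IsClopen.eq_univ ⟨hclosed, hFl.isOpenMap.isOpen_range⟩ ⟨F 0, 0, rfl⟩
    obtain ⟨z, hz⟩ : ((|C| + 1 : ℝ) : ℂ) ∈ Set.range F := by rw [huniv]; trivial
    have h1 := hC z
    rw [hz, Complex.norm_real, Real.norm_of_nonneg (by positivity)] at h1
    linarith [le_abs_self C]
  obtain ⟨σ, hσ, hσρ⟩ : ∃ σ : ℂ →+* ℂ, (σ = RingHom.id ℂ ∨ σ = starRingEnd ℂ) ∧ σ ρ = ξ := by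
    have h1 : (ξ - ρ) * (ξ - starRingEnd ℂ ρ) = 0 := by
      rw [h.conj_eq]
      have := (mul_eq_zero.mp hquad).resolve_left hA0
      linear_combination this - h.sq
    rcases mul_eq_zero.mp h1 with h2 | h2
    · exact ⟨RingHom.id ℂ, Or.inl rfl, (sub_eq_zero.mp h2).symm⟩
    · exact ⟨starRingEnd ℂ, Or.inr rfl, (sub_eq_zero.mp h2).symm⟩
  have hσc : Continuous σ := by
    rcases hσ with rfl | rfl
    · exact continuous_id
    · exact Complex.continuous_conj
  have hσn : ∀ z, ‖σ z‖ = ‖z‖ := by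
    rcases hσ with rfl | rfl
    · simp
    · exact Complex.norm_conj
  set a := A / q with ha
  have ha0 : a ≠ 0 := div_ne_zero hA0 hq0
  have hFq : ∀ l ∈ rotLattice ρ, ∀ z, F (z + q * l) = F z + q * (a * σ l) := by
    rintro _ ⟨m, n, rfl⟩ z
    rw [hAB, hBA, ha, RingHom.map_add, RingHom.map_mul, map_intCast, map_intCast, hσρ]
    field_simp
  have hproper : IsProperMap F := by
    obtain ⟨C, hC⟩ := h.exists_norm_le_of_periodic (G := fun z => F z - a * σ z) (by fun_prop)
      fun m n z => by
        rw [hFq _ ⟨m, n, rfl⟩, RingHom.map_add σ z, RingHom.map_mul σ (q : ℂ), map_natCast]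
        ring
    rw [isProperMap_iff_tendsto_cocompact]
    refine ⟨hFc, ?_⟩
    rw [← Metric.cobounded_eq_cocompact, ← comap_norm_atTop, Filter.tendsto_comap_iff]
    have h1 : Filter.Tendsto (fun z : ℂ => ‖a‖ * ‖z‖ - C) (Filter.comap norm Filter.atTop)
        Filter.atTop := by
      refine Filter.tendsto_atTop_add_const_right _ _ ?_
      exact Filter.Tendsto.const_mul_atTop (norm_pos_iff.mpr ha0) Filter.tendsto_comap
    refine Filter.tendsto_atTop_mono (fun z => ?_) h1
    have h2 := norm_sub_norm_le (a * σ z) (F z)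
    rw [norm_mul, hσn, norm_sub_rev] at h2
    have h3 := hC z
    simp only [Function.comp_apply]
    linarith
  have hbij := hFl.bijective_of_isProperMap hproper
  have hadd : ∀ l ∈ rotLattice ρ, (∀ z, F (z + l) = F z + a * σ l) ∧ a * σ l ∈ rotLattice ρ := by
    intro l hl
    by_cases hl0 : l = 0
    · subst hl0
      simp
    obtain ⟨η, hη, k, hk, he⟩ := htrans l hl
    have h1 := hiter hη he 0
    rw [hFq l hl] at h1
    have h2 : (q : ℂ) * (a * σ l) = (∑ i ∈ Finset.range q, η ^ i) * k := by
      linear_combination h1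
    have hη1 : η = 1 := by
      by_contra hne
      have h3 := mul_geom_sum η q
      rw [hη, sub_self] at h3
      have h4 := (mul_eq_zero.mp h3).resolve_left (sub_ne_zero.mpr hne)
      rw [h4, zero_mul] at h2
      have h5 : σ l ≠ 0 := by simpa using hl0
      exact mul_ne_zero hq0 (mul_ne_zero ha0 h5) h2
    subst hη1
    have h6 : a * σ l = k := by
      apply mul_left_cancel₀ hq0
      rw [h2]
      simp
    rw [h6]
    exact ⟨fun z => by rw [he, one_mul], hk⟩
  refine ⟨F, a, σ, hF, ?_, ha0, hbij, hσ, fun l hl => (hadd l hl).1, ?_⟩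
  · have := (hadd 1 (one_mem_rotLattice ρ)).2
    rwa [map_one, mul_one] at this
  · intro ζ hζ
    obtain ⟨j, -, rfl⟩ := h.exists_pow hζ
    clear hζ
    induction j with
    | zero => exact ⟨0, zero_mem _, fun z => by simp⟩
    | succ j ih =>
      obtain ⟨k, hk, he⟩ := ih
      refine ⟨ξ * k + ν, add_mem (h.mul_mem (h.root_mem hξ) hk) hν, fun z => ?_⟩
      rw [pow_succ', mul_assoc, hrot, he, map_mul, hσρ]
      ring

/-- The fibre over an ordinary point `π w` corresponds to the lattice modulo `a Λ`: it consists of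
the points `π (F⁻¹ (w + l))` for `l` in the lattice. -/
theorem hasDegree_of_isEquivariantLift (hπ : IsUniformization O q ρ π)
    (h : IsCrystRotation q ρ t) {f : X → X} {F : ℂ → ℂ} {σ : ℂ →+* ℂ} {m n : ℤ}
    (hmn : (m, n) ≠ (0, 0)) (hFf : ∀ z, π (F z) = f (π z))
    (hF : IsEquivariantLift q ρ F (m + n * ρ) σ) :
    O.HasDegree f (m ^ 2 + t * m * n + n ^ 2).natAbs := by
  obtain ⟨N, hN, hcard⟩ := h.exists_sublattice m n hmn
  set a : ℂ := m + n * ρ with ha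
  have haΛ : a ∈ rotLattice ρ := ⟨m, n, rfl⟩
  have hσΛ : ∀ l ∈ rotLattice ρ, σ l ∈ rotLattice ρ := by
    intro l hl
    rcases hF.id_or_conj with rfl | rfl
    · exact hl
    · exact h.conj_mem hl
  have hσσ : ∀ z, σ (σ z) = z := by
    rcases hF.id_or_conj with rfl | rfl
    · exact fun z => rfl
    · exact Complex.conj_conj
  have hσq : ∀ {ζ : ℂ}, ζ ^ q = 1 → σ ζ ^ q = 1 := fun hζ => by rw [← map_pow, hζ, map_one]
  intro y hy
  obtain ⟨w, rfl⟩ := hπ.surjective y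
  let E := Equiv.ofBijective F hF.bijective
  have hE : ∀ z, F (E.symm z) = z := fun z => E.apply_symm_apply z
  have hE' : ∀ {z u}, F u = z → E.symm z = u := fun hz => by
    rw [← hz]; exact E.symm_apply_apply _
  let g : (Fin 2 → ℤ) → X := fun v => π (E.symm (w + ((v 0 : ℂ) + v 1 * ρ)))
  have hg : ∀ v v', g v = g v' ↔ v - v' ∈ N := by
    intro v v'
    rw [hN]
    have hvΛ : ((v 0 : ℂ) + v 1 * ρ) ∈ rotLattice ρ := ⟨v 0, v 1, rfl⟩
    have hvΛ' : ((v' 0 : ℂ) + v' 1 * ρ) ∈ rotLattice ρ := ⟨v' 0, v' 1, rfl⟩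
    have hsub : (((v - v') 0 : ℤ) : ℂ) + ((v - v') 1 : ℤ) * ρ =
        ((v 0 : ℂ) + v 1 * ρ) - ((v' 0 : ℂ) + v' 1 * ρ) := by
      simp only [Pi.sub_apply]
      push_cast
      ring
    rw [hsub]
    set u : ℂ := (v 0 : ℂ) + v 1 * ρ
    set u' : ℂ := (v' 0 : ℂ) + v' 1 * ρ
    constructor
    · intro he
      obtain ⟨ζ, hζ, l, hl, hz⟩ := (hπ.fibre _ _).mp he
      obtain ⟨k, hk, hmul⟩ := hF.map_mul ζ hζ
      have h1 := hF.map_add l hl (ζ * E.symm (w + u))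
      rw [← hz, hmul, hE, hE] at h1
      have h2 := hπ.eq_one_of_index h hy (hσq hζ) (l := σ ζ * u + k + a * σ l - u')
        (sub_mem (add_mem (add_mem (h.mul_mem (h.root_mem (hσq hζ)) hvΛ) hk)
          (h.mul_mem haΛ (hσΛ l hl))) hvΛ') (by linear_combination h1)
      have h3 : ζ = 1 := by rw [← hσσ ζ, h2, map_one]
      subst h3
      rw [one_mul] at hz
      have h4 := hF.map_add l hl (E.symm (w + u))
      rw [← hz, hE, hE] at h4
      exact ⟨-σ l, neg_mem (hσΛ l hl), by linear_combination -h4⟩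
    · rintro ⟨l, hl, he⟩
      have h1 := hF.map_add (σ l) (hσΛ l hl) (E.symm (w + u'))
      rw [hE, hσσ] at h1
      have h2 : E.symm (w + u) = E.symm (w + u') + σ l := hE' (by
        rw [h1]; linear_combination -he)
      change π (E.symm (w + u)) = π (E.symm (w + u'))
      rw [h2, eq_comm, hπ.fibre]
      exact ⟨1, one_pow _, σ l, hσΛ l hl, by ring⟩
  let G : ((Fin 2 → ℤ) ⧸ N) → X := fun x => g x.out
  have hGg : ∀ v, G (Submodule.Quotient.mk v) = g v := by
    intro v
    rw [hg, ← Submodule.Quotient.eq]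
    exact Quotient.out_eq _
  have hGinj : Function.Injective G := by
    intro x x' hxx
    induction x using Submodule.Quotient.induction_on with | _ v => ?_
    induction x' using Submodule.Quotient.induction_on with | _ v' => ?_
    rw [hGg, hGg, hg] at hxx
    rwa [Submodule.Quotient.eq]
  have hrange : f ⁻¹' {π w} = Set.range G := by
    ext x
    constructor
    · intro hx
      obtain ⟨z, rfl⟩ := hπ.surjective x
      rw [Set.mem_preimage, Set.mem_singleton_iff, ← hFf] at hx
      obtain ⟨ζ, hζ, l, hl, he⟩ := (hπ.fibre _ _).mp hx
      obtain ⟨k, hk, hmul⟩ := hF.map_mul (σ ζ) (hσq hζ)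
      obtain ⟨i, j, hij⟩ : k - l ∈ rotLattice ρ := sub_mem hk hl
      refine ⟨Submodule.Quotient.mk ![i, j], ?_⟩
      rw [hGg]
      have h1 : E.symm (w + ((i : ℂ) + j * ρ)) = σ ζ * z := hE' (by
        rw [hmul, hσσ, ← hij, he]; ring)
      change π (E.symm (w + ((i : ℂ) + j * ρ))) = π z
      rw [h1, eq_comm, hπ.fibre]
      exact ⟨σ ζ, hσq hζ, 0, zero_mem _, by ring⟩
    · rintro ⟨x, rfl⟩
      induction x using Submodule.Quotient.induction_on with | _ v => ?_
      rw [hGg, Set.mem_preimage, Set.mem_singleton_iff]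
      change f (π _) = _
      rw [← hFf, hE, eq_comm, hπ.fibre]
      exact ⟨1, one_pow _, _, ⟨v 0, v 1, rfl⟩, by ring⟩
  have hpos := h.quadForm_pos hmn
  have : Finite ((Fin 2 → ℤ) ⧸ N) := Nat.finite_of_card_ne_zero (by rw [hcard]; omega)
  rw [hrange, ← Set.image_univ, hGinj.encard_image, Set.encard_univ, ← hcard,
    ENat.card_eq_coe_natCard]

theorem exists_hasDegree (hπ : IsUniformization O q ρ π) (h : IsCrystRotation q ρ t)
    {f : X → X} (hf : O.IsCovering O f) :
    ∃ m n : ℤ, (m, n) ≠ (0, 0) ∧ O.HasDegree f (m ^ 2 + t * m * n + n ^ 2).natAbs := by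
  obtain ⟨F, a, σ, hF, ⟨m, n, rfl⟩, ha0, hl⟩ := hπ.exists_isEquivariantLift h hf
  have hmn : (m, n) ≠ (0, 0) := by
    intro he
    simp only [Prod.mk.injEq] at he
    simp [he.1, he.2] at ha0
  exact ⟨m, n, hmn, hπ.hasDegree_of_isEquivariantLift h hmn hF hl⟩

theorem hasDegree_unique (hπ : IsUniformization O q ρ π) (h : IsCrystRotation q ρ t)
    {f : X → X} {d d' : ℕ} (hd : O.HasDegree f d) (hd' : O.HasDegree f d') : d = d' := by
  obtain ⟨z, hz⟩ := ((hπ.countable_singular h).dense_compl ℝ).nonempty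
  have hz' : O.index (π z) = 1 := by simpa using hz
  have := (hd _ hz').symm.trans (hd' _ hz')
  exact_mod_cast this

theorem selfCoveringDegrees_eq (hπ : IsUniformization O q ρ π) (h : IsCrystRotation q ρ t) :
    O.selfCoveringDegrees =
      {d : ℕ | ∃ m n : ℤ, (m, n) ≠ (0, 0) ∧ (d : ℤ) = m ^ 2 + t * m * n + n ^ 2} := by
  ext d
  constructor
  · rintro ⟨f, hf, hd⟩
    obtain ⟨m, n, hmn, hd'⟩ := hπ.exists_hasDegree h hf
    refine ⟨m, n, hmn, ?_⟩
    rw [hπ.hasDegree_unique h hd hd']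
    exact Int.natAbs_of_nonneg (h.quadForm_pos hmn).le
  · rintro ⟨m, n, hmn, hd⟩
    have ha0 : (m : ℂ) + n * ρ ≠ 0 := by
      intro h0
      obtain ⟨rfl, rfl⟩ := h.add_mul_eq_zero h0
      exact hmn rfl
    obtain ⟨f, hfπ, hf⟩ := hπ.exists_isCovering h ⟨m, n, rfl⟩ ha0
    refine ⟨f, hf, ?_⟩
    have := hπ.hasDegree_of_isEquivariantLift h hmn (fun z => (hfπ z).symm)
      (isEquivariantLift_mul ha0)
    rwa [← hd, Int.natAbs_natCast] at this

end IsUniformization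

/-! ### Local degrees and covering data -/

theorem ncard_pow_eq_one {n : ℕ} (hn : 0 < n) : {z : ℂ | z ^ n = 1}.ncard = n := by
  have hζ := Complex.isPrimitiveRoot_exp n hn.ne'
  refine Eq.trans ?_ hζ.card_nthRootsFinset
  rw [← Set.ncard_coe_finset]
  congr 1
  ext z
  simp [Polynomial.mem_nthRootsFinset hn]

/-- On a sheet `f ∘ φ = ψ` of an orbifold covering, with folding charts `φ` and `ψ` of orders `a`
and `b`, the map is `z ↦ z ^ (b / a)` in the coordinates `z ^ a` and `z ^ b` of the quotients. -/
theorem exists_localDegree_of_isFoldingChart {index₁ index₂ : X → ℕ} {a b : ℕ} {φ ψ : ℂ → X}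
    {f : X → X} (hφ : IsFoldingChart index₁ a φ) (hψ : IsFoldingChart index₂ b ψ)
    (hf : ∀ z, f (φ z) = ψ z) :
    ∃ e : ℕ, e * a = b ∧ ConeOrbifold.HasLocalDegree f (φ 0) e ∧
      (f ⁻¹' {ψ 1} ∩ Set.range φ).ncard = e := by
  have hab : a ∣ b := by
    have hζ := Complex.isPrimitiveRoot_exp a hφ.pos.ne'
    set ζ := Complex.exp (2 * Real.pi * Complex.I / a)
    have h1 : φ 1 = φ ζ := (hφ.fibre 1 ζ).mpr ⟨ζ, hζ.pow_eq_one, by simp⟩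
    have h2 : ψ 1 = ψ ζ := by rw [← hf, ← hf, h1]
    obtain ⟨ξ, hξ, he⟩ := (hψ.fibre 1 ζ).mp h2
    rw [mul_one] at he
    exact hζ.dvd_of_pow_eq_one b (by rw [he, hξ])
  obtain ⟨e, rfl⟩ := hab
  have he : 0 < e := Nat.pos_of_mul_pos_left hψ.pos
  obtain ⟨φ', hφ', eφ⟩ := hφ.exists_isOpenEmbedding
  obtain ⟨ψ', hψ', eψ⟩ := hψ.exists_isOpenEmbedding
  have hfφ' : ∀ z, f (φ' z) = ψ' (z ^ e) := by
    intro z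
    obtain ⟨y, rfl⟩ := exists_pow_eq a hφ.pos z
    rw [eφ, hf, ← eψ, pow_mul]
  have hφ0 : φ' 0 = φ 0 := by rw [← eφ, zero_pow hφ.pos.ne']
  have hψ0 : ψ' 0 = ψ 0 := by rw [← eψ, zero_pow hψ.pos.ne']
  have hψ1 : ψ' 1 = ψ 1 := by rw [← eψ, one_pow]
  refine ⟨e, mul_comm _ _, ⟨he, φ', ψ', hφ', hψ', hφ0, by rw [hψ0, hf], hfφ'⟩, ?_⟩
  have hset : f ⁻¹' {ψ 1} ∩ Set.range φ = φ' '' {z : ℂ | z ^ e = 1} := by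
    ext x
    constructor
    · rintro ⟨hx, z, rfl⟩
      refine ⟨z ^ a, ?_, eφ z⟩
      rw [Set.mem_preimage, Set.mem_singleton_iff, ← eφ, hfφ', ← hψ1] at hx
      exact hψ'.injective hx
    · rintro ⟨z, hz, rfl⟩
      refine ⟨?_, ?_⟩
      · rw [Set.mem_preimage, hfφ', show z ^ e = 1 from hz, hψ1]
        rfl
      · obtain ⟨y, rfl⟩ := exists_pow_eq a hφ.pos z
        exact ⟨y, (eφ y).symm⟩
  rw [hset, Set.ncard_image_of_injective _ hφ'.injective, ncard_pow_eq_one he]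

namespace ConeOrbifold

/-- The local degrees of an orbifold covering of degree `d` at the points over `p` multiply the
indices to the index of `p`, and they add up to `d`, as one sees by counting the preimages of an
ordinary point near `p`. -/
theorem exists_localDegrees (O : ConeOrbifold X) {f : X → X} {d : ℕ} (hf : O.IsCovering O f)
    (hd : O.HasDegree f d) (p : X) :
    ∃ (hfin : (f ⁻¹' {p}).Finite) (e : X → ℕ),
      (∀ x ∈ f ⁻¹' {p}, e x * O.index x = O.index p ∧ HasLocalDegree f x (e x)) ∧
      ∑ x ∈ hfin.toFinset, e x = d := by
  classical
  obtain ⟨b, ψ, hψ, hψp, 𝒱, hdisj, hpre, hV⟩ := hf p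
  have hb : O.index p = b := by rw [← hψp, hψ.index_zero]
  -- every sheet has a chart, centred at its point over `p`
  have hsheet : ∀ V ∈ 𝒱, ∃ x e, f x = p ∧ x ∈ V ∧ (∀ y ∈ V, f y = p → y = x) ∧
      e * O.index x = b ∧ HasLocalDegree f x e ∧ (f ⁻¹' {ψ 1} ∩ V).ncard = e := by
    intro V hV𝒱
    obtain ⟨a, φ, hφ, rfl, hfφ⟩ := hV V hV𝒱
    obtain ⟨e, he, hloc, hcard⟩ := exists_localDegree_of_isFoldingChart hφ hψ hfφ
    refine ⟨φ 0, e, by rw [hfφ, hψp], ⟨0, rfl⟩, ?_, by rw [hφ.index_zero, he], hloc, hcard⟩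
    rintro _ ⟨z, rfl⟩ hz
    rw [hfφ, ← hψp, hψ.eq_zero_iff] at hz
    rw [hz]
  have : Nonempty X := ⟨p⟩
  choose! c e hcp hcV hcu hce hcl hcc using hsheet
  have hmem : ∀ y, f y ∈ Set.range ψ → ∃ V ∈ 𝒱, y ∈ V := by
    intro y hy
    have : y ∈ f ⁻¹' Set.range ψ := hy
    rw [hpre] at this
    exact this
  choose! W hW𝒱 hyW using hmem
  have hpψ : p ∈ Set.range ψ := ⟨0, hψp⟩
  have hWV : ∀ V ∈ 𝒱, ∀ y ∈ V, f y ∈ Set.range ψ → W y = V := by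
    intro V hV𝒱 y hy hfy
    by_contra hne
    exact Set.disjoint_left.mp (hdisj (hW𝒱 y hfy) hV𝒱 hne) (hyW y hfy) hy
  have hord : O.index (ψ 1) = 1 := hψ.index_ne_zero 1 one_ne_zero
  have hy := hd _ hord
  have hyfin : (f ⁻¹' {ψ 1}).Finite := Set.finite_of_encard_eq_coe hy
  have h1ψ : ∀ y ∈ f ⁻¹' {ψ 1}, f y ∈ Set.range ψ := fun y hy => ⟨1, hy.symm⟩
  have hsplit : ∀ V ∈ 𝒱, e V = (hyfin.toFinset.filter fun y => W y = V).card := by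
    intro V hV𝒱
    rw [← hcc V hV𝒱, ← Set.ncard_coe_finset]
    congr 1
    ext y
    simp only [Set.mem_inter_iff, Finset.coe_filter, Set.Finite.mem_toFinset, Set.mem_ofPred_eq]
    refine and_congr_right fun hyf => ⟨fun hyV => hWV V hV𝒱 y hyV (h1ψ y hyf), ?_⟩
    rintro rfl
    exact hyW y (h1ψ y hyf)
  have hcW : ∀ x ∈ f ⁻¹' {p}, W x ∈ 𝒱 ∧ c (W x) = x := by
    intro x hx
    have hx' : f x ∈ Set.range ψ := by rw [show f x = p from hx]; exact hpψ
    exact ⟨hW𝒱 x hx', (hcu _ (hW𝒱 x hx') x (hyW x hx') hx).symm⟩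
  have hfin : (f ⁻¹' {p}).Finite := by
    refine (hyfin.image fun y => c (W y)).subset fun x hx => ?_
    obtain ⟨hW, hc⟩ := hcW x hx
    have hpos : 0 < (hyfin.toFinset.filter fun y => W y = W x).card := by
      rw [← hsplit _ hW]; exact (hcl _ hW).1
    obtain ⟨y, hy⟩ := Finset.card_pos.mp hpos
    rw [Finset.mem_filter, Set.Finite.mem_toFinset] at hy
    exact ⟨y, hy.1, by simp only [hy.2, hc]⟩
  refine ⟨hfin, fun x => e (W x), fun x hx => ?_, ?_⟩
  · obtain ⟨hW, hc⟩ := hcW x hx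
    have h1 := hce _ hW
    have h2 := hcl _ hW
    rw [hc] at h1 h2
    exact ⟨by rw [h1, hb], h2⟩
  · have hcard : hyfin.toFinset.card = d := by
      have := hyfin.encard_eq_coe_toFinset_card
      rw [hy] at this
      exact_mod_cast this.symm
    rw [← hcard, Finset.card_eq_sum_card_fiberwise (f := fun y => c (W y))
      (t := hfin.toFinset) (fun y hy => by
        have hy' : y ∈ f ⁻¹' {ψ 1} := by simpa using hy
        simpa using hcp _ (hW𝒱 y (h1ψ y hy')))]
    refine Finset.sum_congr rfl fun x hx => ?_
    obtain ⟨hW, hc⟩ := hcW x (by simpa using hx)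
    change e (W x) = _
    rw [hsplit _ hW]
    congr 1
    ext y
    simp only [Finset.mem_filter, Set.Finite.mem_toFinset]
    refine and_congr_right fun hyf => ⟨fun h => by rw [h, hc], fun h => ?_⟩
    have hWy := hW𝒱 y (h1ψ y hyf)
    rw [← hWV (W y) hWy x (by rw [← h]; exact hcV _ hWy) (by
      rw [show f x = p by simpa using hx]; exact hpψ)]

/-- Covering data over a point of index `Q` when the degree is `1` modulo `Q`. The only points of
the fibre with local degree different from `Q` are singular ones, and the arithmetic hypothesis
says that the sum of the local degrees leaves room for exactly one of these, of local degree `1`. -/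
theorem hasCoveringData_of_arith {O : ConeOrbifold X} {q : Fin 3 → ℕ} {x : Fin 3 → X}
    (hO : O.IsSphereWith q x) {f : X → X} {Q n d : ℕ} (hf : O.IsCovering O f)
    (hd : O.HasDegree f d) (hdn : d = Q * n + 1) {p : X} (hp : O.index p = Q) (hQ : 0 < Q)
    (harith : ∀ (ε : Fin 3 → ℕ) (N : ℕ), (∀ i, ε i = 0 ∨ ε i * q i = Q) →
      Q * N + (ε 0 + ε 1 + ε 2) = Q * n + 1 → ∃ i, ε i = 1 ∧ ∀ j, j ≠ i → ε j = 0) :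
    HasCoveringData f p (Multiset.replicate n Q + {1}) := by
  classical
  obtain ⟨hfin, e, he, hsum⟩ := O.exists_localDegrees hf hd p
  set s := hfin.toFinset with hs
  have hes : ∀ y ∈ s, e y * O.index y = Q := fun y hy => by
    rw [(he y (by simpa [hs] using hy)).1, hp]
  have heord : ∀ y ∈ s, y ∉ Finset.univ.image x → e y = Q := by
    intro y hy hyx
    have h1 := hO.index_eq_one y (by simpa using hyx)
    have := hes y hy
    rwa [h1, mul_one] at this
  set ε : Fin 3 → ℕ := fun i => if x i ∈ s then e (x i) else 0 with hε
  have hsplit : Q * (s.filter fun y => y ∉ Finset.univ.image x).card + (ε 0 + ε 1 + ε 2) =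
      Q * n + 1 := by
    rw [← hdn, ← hsum, ← Finset.sum_filter_add_sum_filter_not s (fun y => y ∈ Finset.univ.image x),
      add_comm]
    congr 1
    · have h1 : s.filter (fun y => y ∈ Finset.univ.image x) =
          (Finset.univ.image x).filter fun y => y ∈ s := by
        ext y; simp [and_comm]
      rw [h1, Finset.sum_filter, Finset.sum_image fun i _ j _ hij => hO.injective hij,
        Fin.sum_univ_three]
    · rw [Finset.sum_congr rfl (fun y hy => heord y (Finset.mem_filter.mp hy).1
        (Finset.mem_filter.mp hy).2), Finset.sum_const, smul_eq_mul, mul_comm]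
  obtain ⟨i, hi, hj⟩ := harith ε _ (fun i => by
    by_cases hxi : x i ∈ s
    · right
      simp only [hε, hxi, if_true]
      rw [← hO.index_eq, hes _ hxi]
    · left
      simp [hε, hxi]) hsplit
  have hxi : x i ∈ s := by
    by_contra hc
    simp [hε, hc] at hi
  have hei : e (x i) = 1 := by simpa [hε, hxi] using hi
  have hrest : ∀ y ∈ s.erase (x i), e y = Q := by
    intro y hy
    obtain ⟨hne, hys⟩ := Finset.mem_erase.mp hy
    refine heord y hys fun hyx => ?_
    obtain ⟨j, -, rfl⟩ := Finset.mem_image.mp hyx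
    have h0 := hj j (by rintro rfl; exact hne rfl)
    have h1 := hes _ hys
    simp only [hε, hys, if_true] at h0
    rw [h0, zero_mul] at h1
    omega
  have hcard : (s.erase (x i)).card = n := by
    rw [← Finset.add_sum_erase _ _ hxi, Finset.sum_congr rfl hrest, Finset.sum_const, hei,
      smul_eq_mul, hdn] at hsum
    have : Q * n = (s.erase (x i)).card * Q := by omega
    rw [mul_comm] at this
    exact (Nat.eq_of_mul_eq_mul_right hQ this).symm
  refine ⟨hfin, e, fun y hy => (he y hy).2, ?_⟩
  rw [← hs, ← Finset.insert_erase hxi, Finset.insert_val_of_notMem (Finset.notMem_erase _ _),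
    Multiset.map_cons, hei, Multiset.map_congr rfl hrest, Multiset.map_const', add_comm,
    Multiset.singleton_add]
  congr 2
  exact hcard.symm

end ConeOrbifold

end Lifting

/-! ### From invariant functions to a uniformization of the sphere -/

/-- Homeomorphisms act transitively on triples of distinct points of the sphere: stereographic
projection from the first point makes it the point at infinity, and an affine map of the plane
moves the other two. -/
theorem exists_homeomorph_sphere {a b : Fin 3 → sphere (0 : EuclideanSpace ℝ (Fin 3)) 1}
    (ha : Function.Injective a) (hb : Function.Injective b) :
    ∃ M : sphere (0 : EuclideanSpace ℝ (Fin 3)) 1 ≃ₜ sphere (0 : EuclideanSpace ℝ (Fin 3)) 1,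
      ∀ i, M (a i) = b i := by
  have key : ∀ a : Fin 3 → sphere (0 : EuclideanSpace ℝ (Fin 3)) 1, Function.Injective a →
      ∃ N : OnePoint ℂ ≃ₜ sphere (0 : EuclideanSpace ℝ (Fin 3)) 1,
        N OnePoint.infty = a 0 ∧ N (0 : ℂ) = a 1 ∧ N (1 : ℂ) = a 2 := by
    intro a ha
    have hv : ‖(a 0 : EuclideanSpace ℝ (Fin 3))‖ = 1 := by simp
    have hv0 : (a 0 : EuclideanSpace ℝ (Fin 3)) ≠ 0 := by
      intro h
      rw [h, norm_zero] at hv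
      exact zero_ne_one hv
    have : Fact (Module.finrank ℝ (EuclideanSpace ℝ (Fin 3)) = 2 + 1) := ⟨by simp⟩
    have hV : Module.finrank ℝ ℂ =
        Module.finrank ℝ (ℝ ∙ (a 0 : EuclideanSpace ℝ (Fin 3)))ᗮ := by
      rw [Submodule.finrank_orthogonal_span_singleton (n := 2) hv0, Complex.finrank_real_complex]
    obtain ⟨e⟩ : Nonempty (ℂ ≃L[ℝ] (ℝ ∙ (a 0 : EuclideanSpace ℝ (Fin 3)))ᗮ) :=
      FiniteDimensional.nonempty_continuousLinearEquiv_of_finrank_eq hV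
    let N₀ : OnePoint ℂ ≃ₜ sphere (0 : EuclideanSpace ℝ (Fin 3)) 1 :=
      (e.toHomeomorph.onePointCongr).trans (onePointHyperplaneHomeoUnitSphere hv)
    have hN₀ : N₀ OnePoint.infty = a 0 := rfl
    have hfin : ∀ i, i ≠ 0 → ∃ z : ℂ, N₀ z = a i := by
      intro i hi
      obtain ⟨y, hy⟩ := N₀.surjective (a i)
      induction y using OnePoint.rec with
      | infty => exact absurd (ha (hN₀.symm.trans hy)).symm hi
      | coe z => exact ⟨z, hy⟩
    obtain ⟨z₁, hz₁⟩ := hfin 1 (by decide)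
    obtain ⟨z₂, hz₂⟩ := hfin 2 (by decide)
    have hne : z₂ - z₁ ≠ 0 := by
      rw [sub_ne_zero]
      rintro rfl
      exact absurd (ha (hz₁.symm.trans hz₂)) (by decide)
    let A : ℂ ≃ₜ ℂ := (Homeomorph.mulLeft₀ (z₂ - z₁) hne).trans (Homeomorph.addRight z₁)
    refine ⟨A.onePointCongr.trans N₀, hN₀, ?_, ?_⟩
    · change N₀ ((A 0 : ℂ) : OnePoint ℂ) = _
      rw [← hz₁]
      simp [A]
    · change N₀ ((A 1 : ℂ) : OnePoint ℂ) = _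
      rw [← hz₂]
      simp [A]
  obtain ⟨N, h0, h1, h2⟩ := key a ha
  obtain ⟨N', h0', h1', h2'⟩ := key b hb
  refine ⟨N.symm.trans N', fun i => ?_⟩
  fin_cases i
  · change N' (N.symm (a 0)) = b 0
    rw [← h0, N.symm_apply_apply, h0']
  · change N' (N.symm (a 1)) = b 1
    rw [← h1, N.symm_apply_apply, h1']
  · change N' (N.symm (a 2)) = b 2
    rw [← h2, N.symm_apply_apply, h2']

namespace IsCrystRotation

variable {q : ℕ} {ρ : ℂ} {t : ℤ}

/-- The group acts cocompactly, so a continuous map to a Hausdorff space whose fibres are the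
orbits is open. -/
theorem isOpenMap_of_fibre (h : IsCrystRotation q ρ t) {Y : Type*} [TopologicalSpace Y]
    [T2Space Y] {p : ℂ → Y} (hp : Continuous p) (hs : Function.Surjective p)
    (hfib : ∀ z w, p z = p w ↔ SameOrbit q ρ z w) : IsOpenMap p := by
  intro U hU
  have hV : IsOpen (p ⁻¹' (p '' U)) := by
    rw [isOpen_iff_mem_nhds]
    rintro w ⟨z, hz, he⟩
    obtain ⟨ζ, hζ, l, hl, hzw⟩ := (hfib _ _).mp he.symm
    have hc : Continuous fun y => ζ * y + l := by fun_prop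
    filter_upwards [hc.continuousAt.preimage_mem_nhds (by rw [← hzw]; exact hU.mem_nhds hz)]
      with y hy
    refine ⟨ζ * y + l, hy, ?_⟩
    rw [eq_comm, hfib]
    exact ⟨ζ, hζ, l, hl, rfl⟩
  have himg : p '' U = (p '' ((p ⁻¹' (p '' U))ᶜ ∩ closedBall 0 (2 * q)))ᶜ := by
    ext y
    constructor
    · rintro hy ⟨z, ⟨hz, -⟩, rfl⟩
      exact hz hy
    · intro hy
      by_contra hyU
      apply hy
      obtain ⟨z, rfl⟩ := hs y
      obtain ⟨m, n, hmn⟩ := h.exists_norm_sub_le z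
      have he : p (z - q * (m + n * ρ)) = p z := by
        rw [hfib]
        exact ⟨1, one_pow _, q * (m + n * ρ), ⟨q * m, q * n, by push_cast; ring⟩, by ring⟩
      exact ⟨z - q * (m + n * ρ), ⟨by rwa [Set.mem_compl_iff, Set.mem_preimage, he],
        by simpa using hmn⟩, he⟩
  rw [himg, isOpen_compl_iff]
  refine IsCompact.isClosed (IsCompact.image ?_ hp)
  exact (isCompact_closedBall _ _).inter_left hV.isClosed_compl

theorem stabilizer_congr (h : IsCrystRotation q ρ t) {z w : ℂ} (hzw : SameOrbit q ρ z w) (ζ : ℂ) :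
    ζ ^ q = 1 ∧ (1 - ζ) * z ∈ rotLattice ρ ↔ ζ ^ q = 1 ∧ (1 - ζ) * w ∈ rotLattice ρ := by
  have key : ∀ {z w : ℂ}, SameOrbit q ρ z w → ζ ^ q = 1 → (1 - ζ) * z ∈ rotLattice ρ →
      (1 - ζ) * w ∈ rotLattice ρ := by
    rintro z _ ⟨ξ, hξ, l, hl, rfl⟩ hζ hz
    rw [show (1 - ζ) * (ξ * z + l) = ξ * ((1 - ζ) * z) + (1 - ζ) * l by ring]
    exact add_mem (h.mul_mem (h.root_mem hξ) hz)
      (h.mul_mem (sub_mem (one_mem_rotLattice ρ) (h.root_mem hζ)) hl)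
  exact and_congr_right fun hζ => ⟨key hzw hζ, key (h.sameOrbit_symm hzw) hζ⟩

theorem card_stabilizer_congr (h : IsCrystRotation q ρ t) {z w : ℂ} (hzw : SameOrbit q ρ z w) :
    Nat.card {ζ : ℂ // ζ ^ q = 1 ∧ (1 - ζ) * z ∈ rotLattice ρ} =
      Nat.card {ζ : ℂ // ζ ^ q = 1 ∧ (1 - ζ) * w ∈ rotLattice ρ} :=
  Nat.card_congr (Equiv.subtypeEquivRight (h.stabilizer_congr hzw))

theorem apply_eq_of_sameOrbit (h : IsCrystRotation q ρ t) {Y : Type*} {v : ℂ → Y}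
    (h1 : ∀ z, v (z + 1) = v z) (hρ : ∀ z, v (z + ρ) = v z) (hr : ∀ z, v (ρ * z) = v z)
    {z w : ℂ} (hzw : SameOrbit q ρ z w) : v z = v w := by
  obtain ⟨ζ, hζ, _, ⟨m, n, rfl⟩, rfl⟩ := hzw
  obtain ⟨j, -, rfl⟩ := h.exists_pow hζ
  have hp1 : Function.Periodic v 1 := h1
  have hp2 : Function.Periodic v ρ := hρ
  rw [← add_assoc, hp2.int_mul n, ← mul_one (m : ℂ), hp1.int_mul m]
  clear hζ
  induction j with
  | zero => simp
  | succ j ih => rw [pow_succ', mul_assoc, hr, ← ih]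

end IsCrystRotation

/-- A continuous invariant map `v` to `ℝ³ ∖ 0` whose values meet every ray from the origin, and
which meets the same ray only at points of one orbit, gives a uniformization of the sphere. The
points `c i` represent the orbits with nontrivial stabilizer. -/
theorem exists_isUniformization {X : Type*} [TopologicalSpace X] {O : ConeOrbifold X} {q : ℕ}
    {ρ : ℂ} {t : ℤ} (h : IsCrystRotation q ρ t) {Q : Fin 3 → ℕ} {x : Fin 3 → X}
    (hO : O.IsSphereWith Q x) {v : ℂ → ℝ × ℂ} (hvc : Continuous v) (hv0 : ∀ z, v z ≠ 0)
    (hinv : ∀ z w, SameOrbit q ρ z w → v z = v w)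
    (hray : ∀ z w, ∀ k : ℝ, 0 < k → v z = k • v w → SameOrbit q ρ z w)
    (hsurj : ∀ u : ℝ × ℂ, u ≠ 0 → ∃ z, ∃ k : ℝ, 0 < k ∧ v z = k • u) {c : Fin 3 → ℂ}
    (hc : ∀ i j, SameOrbit q ρ (c i) (c j) → i = j)
    (hstab : ∀ i, Nat.card {ζ : ℂ // ζ ^ q = 1 ∧ (1 - ζ) * c i ∈ rotLattice ρ} = Q i)
    (hord : ∀ z ζ, ζ ^ q = 1 → ζ ≠ 1 → (1 - ζ) * z ∈ rotLattice ρ →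
      ∃ i, SameOrbit q ρ (c i) z) :
    ∃ π : ℂ → X, IsUniformization O q ρ π := by
  obtain ⟨T⟩ : Nonempty ((ℝ × ℂ) ≃L[ℝ] EuclideanSpace ℝ (Fin 3)) :=
    FiniteDimensional.nonempty_continuousLinearEquiv_of_finrank_eq (by simp)
  have hT0 : ∀ z, T (v z) ≠ 0 := fun z => by simpa using hv0 z
  have hTn : ∀ z, ‖T (v z)‖ ≠ 0 := fun z => norm_ne_zero_iff.mpr (hT0 z)
  let p : ℂ → sphere (0 : EuclideanSpace ℝ (Fin 3)) 1 := fun z =>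
    ⟨‖T (v z)‖⁻¹ • T (v z), by
      rw [mem_sphere_zero_iff_norm, norm_smul, norm_inv, norm_norm, inv_mul_cancel₀ (hTn z)]⟩
  have hpc : Continuous p := by
    have h1 : Continuous fun z => T (v z) := T.continuous.comp hvc
    exact Continuous.subtype_mk ((h1.norm.inv₀ hTn).smul h1) _
  have hfib : ∀ z w, p z = p w ↔ SameOrbit q ρ z w := by
    intro z w
    constructor
    · intro he
      have he' : ‖T (v z)‖⁻¹ • T (v z) = ‖T (v w)‖⁻¹ • T (v w) := congrArg Subtype.val he
      refine hray z w (‖T (v z)‖ * ‖T (v w)‖⁻¹) ?_ (T.injective ?_)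
      · have := norm_pos_iff.mpr (hT0 z)
        have := norm_pos_iff.mpr (hT0 w)
        positivity
      · rw [map_smul, mul_smul, ← he', smul_smul, mul_inv_cancel₀ (hTn z), one_smul]
    · intro he
      simp only [p, hinv z w he]
  have hps : Function.Surjective p := by
    rintro ⟨u, hu⟩
    have hu' : ‖u‖ = 1 := by simpa using hu
    obtain ⟨z, k, hk, hz⟩ := hsurj (T.symm u) (by
      intro h0
      have : u = 0 := by simpa using h0
      rw [this, norm_zero] at hu'
      exact zero_ne_one hu')
    refine ⟨z, Subtype.ext ?_⟩
    change ‖T (v z)‖⁻¹ • T (v z) = u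
    rw [hz, map_smul, T.apply_symm_apply, norm_smul, hu', Real.norm_of_nonneg hk.le, mul_one,
      smul_smul, inv_mul_cancel₀ hk.ne', one_smul]
  obtain ⟨hX⟩ := hO.homeo
  obtain ⟨M, hM⟩ := exists_homeomorph_sphere (a := fun i => p (c i)) (b := fun i => hX (x i))
    (fun i j hij => hc i j ((hfib _ _).mp hij)) (hX.injective.comp hO.injective)
  let π : ℂ → X := fun z => hX.symm (M (p z))
  have hπfib : ∀ z w, π z = π w ↔ SameOrbit q ρ z w := by
    intro z w
    rw [← hfib, hX.symm.injective.eq_iff, M.injective.eq_iff]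
  have hπc : ∀ i, π (c i) = x i := fun i => by
    change hX.symm (M (p (c i))) = x i
    rw [hM, hX.symm_apply_apply]
  refine ⟨π, hX.symm.continuous.comp (M.continuous.comp hpc),
    hX.symm.isOpenMap.comp (M.isOpenMap.comp (h.isOpenMap_of_fibre hpc hps hfib)),
    hX.symm.surjective.comp (M.surjective.comp hps), hπfib, fun z => ?_⟩
  by_cases hex : ∃ i, SameOrbit q ρ (c i) z
  · obtain ⟨i, hi⟩ := hex
    rw [← (hπfib _ _).mpr hi, hπc, hO.index_eq, ← h.card_stabilizer_congr hi, hstab]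
  · rw [hO.index_eq_one, eq_comm, Nat.card_eq_one_iff_unique]
    · have huniq : ∀ ζ : ℂ, ζ ^ q = 1 ∧ (1 - ζ) * z ∈ rotLattice ρ → ζ = 1 := by
        rintro ζ ⟨hζ, hl⟩
        by_contra hne
        exact hex (hord z ζ hζ hne hl)
      exact ⟨⟨fun a b => Subtype.ext ((huniq _ a.2).trans (huniq _ b.2).symm)⟩, ⟨1, by simp⟩⟩
    · rintro ⟨i, hi⟩
      exact hex ⟨i, (hπfib _ _).mp (by rw [hπc, hi])⟩

/-- The squaring map of the plane normalized so as to preserve norms. -/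
noncomputable def normSquare (w : ℂ) : ℂ := w ^ 2 / ‖w‖

theorem norm_normSquare (w : ℂ) : ‖normSquare w‖ = ‖w‖ := by
  by_cases hw : w = 0
  · simp [normSquare, hw]
  · have : ‖w‖ ≠ 0 := norm_ne_zero_iff.mpr hw
    rw [normSquare, norm_div, norm_pow, Complex.norm_real, norm_norm]
    field_simp

theorem continuous_normSquare : Continuous normSquare := by
  rw [continuous_iff_continuousAt]
  intro w
  by_cases hw : w = 0
  · subst hw
    have h0 : normSquare 0 = 0 := by simp [normSquare]
    rw [ContinuousAt, h0, tendsto_zero_iff_norm_tendsto_zero]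
    simp_rw [norm_normSquare]
    simpa using (continuous_norm (E := ℂ)).tendsto 0
  · have : (‖w‖ : ℂ) ≠ 0 := by exact_mod_cast norm_ne_zero_iff.mpr hw
    have h1 : Continuous fun w : ℂ => (‖w‖ : ℂ) := Complex.continuous_ofReal.comp continuous_norm
    exact (continuous_pow 2).continuousAt.div h1.continuousAt this

theorem normSquare_neg (w : ℂ) : normSquare (-w) = normSquare w := by simp [normSquare]

theorem normSquare_smul {k : ℝ} (hk : 0 < k) (w : ℂ) : normSquare (k • w) = k • normSquare w := by
  have : (k : ℂ) ≠ 0 := by exact_mod_cast hk.ne'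
  rw [normSquare, normSquare, norm_smul, Real.norm_of_nonneg hk.le, Complex.real_smul,
    Complex.real_smul]
  push_cast
  by_cases hw : w = 0
  · simp [hw]
  · have : (‖w‖ : ℂ) ≠ 0 := by exact_mod_cast norm_ne_zero_iff.mpr hw
    field_simp

theorem eq_or_eq_neg_of_normSquare_eq {w w' : ℂ} (h : normSquare w = normSquare w') :
    w = w' ∨ w = -w' := by
  have hn : ‖w‖ = ‖w'‖ := by rw [← norm_normSquare, h, norm_normSquare]
  by_cases hw : w = 0
  · left
    rw [hw, norm_zero] at hn
    rw [hw, norm_eq_zero.mp hn.symm]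
  · have : (‖w‖ : ℂ) ≠ 0 := by exact_mod_cast norm_ne_zero_iff.mpr hw
    rw [normSquare, normSquare, ← hn, div_left_inj' this] at h
    exact sq_eq_sq_iff_eq_or_eq_neg.mp h

theorem exists_normSquare_eq (w : ℂ) : ∃ w', normSquare w' = w := by
  obtain ⟨u, hu⟩ := exists_pow_eq 2 two_pos w
  by_cases hw : w = 0
  · exact ⟨0, by simp [normSquare, hw]⟩
  · have hu0 : u ≠ 0 := by rintro rfl; simp at hu; exact hw hu.symm
    have hun : 0 < ‖u‖ := norm_pos_iff.mpr hu0
    refine ⟨‖u‖ • u, ?_⟩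
    have : (‖u‖ : ℂ) ≠ 0 := by exact_mod_cast hun.ne'
    rw [normSquare_smul hun, normSquare, hu, Complex.real_smul]
    field_simp

/-- Passage to a group twice as large: if `ρ` acts on the values of `v` by the half-turn
`(h, w) ↦ (h, -w)`, then squaring the second coordinate gives a map invariant under `ρ`, as the
quotient of the sphere by a half-turn is a sphere. -/
theorem exists_isUniformization_of_halfTurn {X : Type*} [TopologicalSpace X] {O : ConeOrbifold X}
    {q : ℕ} {ρ : ℂ} {t : ℤ} (h : IsCrystRotation q ρ t) {Q : Fin 3 → ℕ} {x : Fin 3 → X}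
    (hO : O.IsSphereWith Q x) {v : ℂ → ℝ × ℂ} (hvc : Continuous v) (hv0 : ∀ z, v z ≠ 0)
    (h1 : ∀ z, v (z + 1) = v z) (hρ : ∀ z, v (z + ρ) = v z)
    (hr : ∀ z, v (ρ * z) = ((v z).1, -(v z).2))
    (hray : ∀ z w, ∀ k : ℝ, 0 < k → v z = k • v w → SameOrbit q ρ z w)
    (hsurj : ∀ u : ℝ × ℂ, u ≠ 0 → ∃ z, ∃ k : ℝ, 0 < k ∧ v z = k • u) {c : Fin 3 → ℂ}
    (hc : ∀ i j, SameOrbit q ρ (c i) (c j) → i = j)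
    (hstab : ∀ i, Nat.card {ζ : ℂ // ζ ^ q = 1 ∧ (1 - ζ) * c i ∈ rotLattice ρ} = Q i)
    (hord : ∀ z ζ, ζ ^ q = 1 → ζ ≠ 1 → (1 - ζ) * z ∈ rotLattice ρ →
      ∃ i, SameOrbit q ρ (c i) z) :
    ∃ π : ℂ → X, IsUniformization O q ρ π := by
  refine exists_isUniformization h hO (v := fun z => ((v z).1, normSquare (v z).2))
    (hvc.fst.prodMk (continuous_normSquare.comp hvc.snd)) ?_ ?_ ?_ ?_ hc hstab hord
  · intro z hz
    apply hv0 z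
    rw [Prod.mk_eq_zero] at hz
    have hn := norm_normSquare (v z).2
    rw [hz.2, norm_zero] at hn
    exact Prod.ext hz.1 (norm_eq_zero.mp hn.symm)
  · intro z w hzw
    refine h.apply_eq_of_sameOrbit (v := fun z => ((v z).1, normSquare (v z).2)) ?_ ?_ ?_ hzw
    · intro z; simp only [h1]
    · intro z; simp only [hρ]
    · intro z; simp only [hr, normSquare_neg]
  · intro z w k hk he
    rw [Prod.smul_mk, Prod.mk.injEq, ← normSquare_smul hk] at he
    rcases eq_or_eq_neg_of_normSquare_eq he.2 with h2 | h2
    · exact hray z w k hk (Prod.ext he.1 h2)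
    · have h3 := hray (ρ * z) w k hk (by
        rw [hr, h2, neg_neg]
        exact Prod.ext he.1 rfl)
      exact h.sameOrbit_trans ⟨ρ, h.prim.pow_eq_one, 0, zero_mem _, by ring⟩ h3
  · rintro ⟨a, w⟩ hu
    obtain ⟨w', rfl⟩ := exists_normSquare_eq w
    obtain ⟨z, k, hk, hz⟩ := hsurj (a, w') (by
      intro h0
      rw [Prod.mk_eq_zero] at h0
      apply hu
      simp [h0.1, h0.2, normSquare])
    refine ⟨z, k, hk, ?_⟩
    rw [hz]
    exact Prod.ext rfl (normSquare_smul hk w')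

/-! ### Triples of complex numbers of norm one with product one -/

/-- The alternating product of the differences of three numbers. -/
def altProd (a b c : ℂ) : ℂ := (a - b) * (b - c) * (c - a)

/-- Three complex numbers of norm one whose product is one: the eigenvalues of a matrix in the
special unitary group. -/
structure IsUnitTriple (a b c : ℂ) : Prop where
  norm_fst : ‖a‖ = 1
  norm_snd : ‖b‖ = 1
  norm_trd : ‖c‖ = 1
  mul_eq : a * b * c = 1

theorem altProd_sq_of_mul_eq {a b c : ℂ} (h : a * b * c = 1) :
    altProd a b c ^ 2 = (a + b + c) ^ 2 * (a * b + b * c + c * a) ^ 2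
      - 4 * (a * b + b * c + c * a) ^ 3 - 4 * (a + b + c) ^ 3
      + 18 * (a + b + c) * (a * b + b * c + c * a) - 27 := by
  have key : altProd a b c ^ 2 = (a + b + c) ^ 2 * (a * b + b * c + c * a) ^ 2
      - 4 * (a * b + b * c + c * a) ^ 3 - 4 * (a + b + c) ^ 3 * (a * b * c)
      + 18 * (a + b + c) * (a * b + b * c + c * a) * (a * b * c) - 27 * (a * b * c) ^ 2 := by
    rw [altProd]; ring
  rw [key, h]; ring

theorem conj_mul_self_of_norm_eq_one {a : ℂ} (ha : ‖a‖ = 1) : conj a * a = 1 := by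
  rw [Complex.conj_mul', ha]; norm_num

namespace IsUnitTriple

variable {a b c a' b' c' : ℂ}

theorem rotate (h : IsUnitTriple a b c) : IsUnitTriple b c a :=
  ⟨h.norm_snd, h.norm_trd, h.norm_fst, by rw [← h.mul_eq]; ring⟩

theorem conj_fst (h : IsUnitTriple a b c) : conj a = b * c := by
  have h1 := conj_mul_self_of_norm_eq_one h.norm_fst
  linear_combination (b * c) * h1 - conj a * h.mul_eq

theorem conj_sum (h : IsUnitTriple a b c) : conj (a + b + c) = a * b + b * c + c * a := by
  rw [map_add, map_add, h.conj_fst, h.rotate.conj_fst, h.rotate.rotate.conj_fst]; ring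

theorem conj_altProd (h : IsUnitTriple a b c) : conj (altProd a b c) = -altProd a b c := by
  rw [altProd, map_mul, map_mul, map_sub, map_sub, map_sub, h.conj_fst, h.rotate.conj_fst,
    h.rotate.rotate.conj_fst]
  linear_combination (-((a - b) * (b - c) * (c - a))) * h.mul_eq

theorem altProd_eq (h : IsUnitTriple a b c) :
    altProd a b c = (altProd a b c).im * Complex.I := by
  have h1 := congrArg Complex.re h.conj_altProd
  rw [Complex.conj_re, Complex.neg_re] at h1
  have h2 : (altProd a b c).re = 0 := by linarith
  apply Complex.ext <;> simp [h2]

/-- The discriminant relation between the sum of a unit triple and its alternating product. -/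
theorem altProd_im_sq (h : IsUnitTriple a b c) :
    (altProd a b c).im ^ 2 = 27 - 18 * ‖a + b + c‖ ^ 2 + 8 * ((a + b + c) ^ 3).re
      - ‖a + b + c‖ ^ 4 := by
  have h1 := altProd_sq_of_mul_eq h.mul_eq
  rw [← h.conj_sum, h.altProd_eq] at h1
  generalize a + b + c = σ at *
  have h2 : σ * conj σ = (‖σ‖ : ℂ) ^ 2 := Complex.mul_conj' σ
  have h3 : σ ^ 3 + conj σ ^ 3 = 2 * (σ ^ 3).re := by
    rw [← map_pow, Complex.add_conj]; push_cast; ring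
  have h4 : (((altProd a b c).im ^ 2 : ℝ) : ℂ) =
      ((27 - 18 * ‖σ‖ ^ 2 + 8 * (σ ^ 3).re - ‖σ‖ ^ 4 : ℝ) : ℂ) := by
    push_cast
    linear_combination -h1 + ((altProd a b c).im : ℂ) ^ 2 * Complex.I_sq
      - (18 + σ * conj σ + (‖σ‖ : ℂ) ^ 2) * h2 + 4 * h3
  exact_mod_cast h4

theorem altProd_im_ne_zero_of_sum_eq_zero (h : IsUnitTriple a b c) (h0 : a + b + c = 0) :
    (altProd a b c).im ≠ 0 := by
  intro hs
  have := h.altProd_im_sq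
  rw [h0, hs] at this
  norm_num at this

/-- The surface given by the discriminant relation meets every ray from the origin at most once. The
cubic in `k` that expresses two intersections has the factor `k - 1`, and its cofactor is positive
because of `Re (σ ^ 3) ≤ |σ| ^ 3`. -/
theorem eq_one_of_smul (h : IsUnitTriple a b c) (h' : IsUnitTriple a' b' c') {k : ℝ} (hk : 0 < k)
    (hs : a + b + c = k * (a' + b' + c')) (hv : (altProd a b c).im = k * (altProd a' b' c').im) :
    k = 1 := by
  have e := h.altProd_im_sq
  have e' := h'.altProd_im_sq
  rw [hs, hv, norm_mul, Complex.norm_real, Real.norm_of_nonneg hk.le, mul_pow (k : ℂ),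
    ← Complex.ofReal_pow, Complex.re_ofReal_mul] at e
  have hB : ((a' + b' + c') ^ 3).re ≤ ‖a' + b' + c'‖ ^ 3 := by
    rw [← norm_pow]; exact Complex.re_le_norm _
  generalize ((a' + b' + c') ^ 3).re = B at *
  have hA0 : 0 ≤ ‖a' + b' + c'‖ := norm_nonneg _
  generalize ‖a' + b' + c'‖ = A at *
  generalize (altProd a' b' c').im = s at *
  by_contra hne
  have h1 : (k + 1) * (27 + A ^ 4 * k ^ 2) - 8 * B * k ^ 2 = 0 := by
    have : (k - 1) * ((k + 1) * (27 + A ^ 4 * k ^ 2) - 8 * B * k ^ 2) = 0 := by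
      linear_combination e - k ^ 2 * e'
    exact (mul_eq_zero.mp this).resolve_left (sub_ne_zero.mpr hne)
  obtain ⟨m, hm, rfl⟩ : ∃ m : ℝ, 0 < m ∧ m ^ 2 = k := ⟨√k, Real.sqrt_pos.mpr hk, Real.sq_sqrt hk.le⟩
  have hm1 : 0 < (m - 1) ^ 2 := by
    refine sq_pos_of_ne_zero fun h0 => hne ?_
    rw [sub_eq_zero.mp h0]; norm_num
  have h2 : 0 < (m - 1) ^ 2 * (27 + A ^ 4 * m ^ 4) := by positivity
  have h3 : 0 ≤ 2 * m * ((A * m - 3) ^ 2 * ((A * m) ^ 2 + 2 * (A * m) + 3)) := by positivity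
  have h4 : 8 * B * (m ^ 2) ^ 2 ≤ 8 * A ^ 3 * (m ^ 2) ^ 2 := by gcongr
  nlinarith

/-- A unit triple is determined up to rotation by the ray through its sum and its alternating
product: the sum gives the cubic polynomial with these roots, and the alternating product their
cyclic order. -/
theorem eq_rotate_of_smul (h : IsUnitTriple a b c) (h' : IsUnitTriple a' b' c') {k : ℝ}
    (hk : 0 < k) (hs : a + b + c = k * (a' + b' + c'))
    (hv : (altProd a b c).im = k * (altProd a' b' c').im) :
    (a = a' ∧ b = b' ∧ c = c') ∨ (a = b' ∧ b = c' ∧ c = a') ∨ (a = c' ∧ b = a' ∧ c = b') := by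
  obtain rfl := h.eq_one_of_smul h' hk hs hv
  rw [Complex.ofReal_one, one_mul] at hs
  rw [one_mul] at hv
  have hv' : altProd a b c = altProd a' b' c' := by rw [h.altProd_eq, h'.altProd_eq, hv]
  have hs2 := congrArg conj hs
  rw [h.conj_sum, h'.conj_sum] at hs2
  -- if the first entries agree, so do the others: an exchange would change the sign of the product
  have key : ∀ {x y z u v : ℂ}, IsUnitTriple x y z → IsUnitTriple x u v → x + y + z = x + u + v →
      altProd x y z = altProd x u v →
      (y = u ∧ z = v) ∨ (x = u ∧ y = v ∧ z = x) ∨ (x = v ∧ y = x ∧ z = u) := by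
    intro x y z u v h1 h2 e1 e2
    have hx : x ≠ 0 := by
      rintro rfl
      simpa using h1.norm_fst
    have e3 : y * z = u * v := by
      have := h1.mul_eq.trans h2.mul_eq.symm
      rw [mul_assoc, mul_assoc] at this
      exact mul_left_cancel₀ hx this
    have e4 : (y - u) * (y - v) = 0 := by linear_combination y * e1 - e3
    rcases mul_eq_zero.mp e4 with e5 | e5
    · have : y = u := sub_eq_zero.mp e5
      exact Or.inl ⟨this, by linear_combination e1 - this⟩
    · have hyv : y = v := sub_eq_zero.mp e5
      have hzu : z = u := by linear_combination e1 - hyv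
      subst hyv hzu
      have e6 : (x - y) * (y - z) * (z - x) = 0 := by
        simp only [altProd] at e2
        linear_combination e2 / 2
      rcases mul_eq_zero.mp e6 with e7 | e7
      · rcases mul_eq_zero.mp e7 with e8 | e8
        · exact Or.inr (Or.inr ⟨sub_eq_zero.mp e8, (sub_eq_zero.mp e8).symm, rfl⟩)
        · exact Or.inl ⟨sub_eq_zero.mp e8, (sub_eq_zero.mp e8).symm⟩
      · exact Or.inr (Or.inl ⟨(sub_eq_zero.mp e7).symm, rfl, sub_eq_zero.mp e7⟩)
  have hroot : (a - a') * ((a - b') * (a - c')) = 0 := by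
    linear_combination a ^ 2 * hs - a * hs2 + h.mul_eq - h'.mul_eq
  rcases mul_eq_zero.mp hroot with e | e
  · obtain rfl := sub_eq_zero.mp e
    rcases key h h' hs hv' with ⟨h1, h2⟩ | ⟨h1, h2, h3⟩ | ⟨h1, h2, h3⟩ <;> simp [*]
  · rcases mul_eq_zero.mp e with e | e
    · obtain rfl := sub_eq_zero.mp e
      rcases key h h'.rotate (by rw [hs]; ring) (by rw [hv', altProd, altProd]; ring)
        with ⟨h1, h2⟩ | ⟨h1, h2, h3⟩ | ⟨h1, h2, h3⟩ <;> simp [*]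
    · obtain rfl := sub_eq_zero.mp e
      rcases key h h'.rotate.rotate (by rw [hs]; ring) (by rw [hv', altProd, altProd]; ring)
        with ⟨h1, h2⟩ | ⟨h1, h2, h3⟩ | ⟨h1, h2, h3⟩ <;> simp [*]

end IsUnitTriple

/-- If two of three numbers with product one are exchanged by inversion in the unit circle, their
alternating product is real. -/
theorem norm_eq_one_of_conj_mul_eq_one {a b c : ℂ} {s : ℝ} (hm : a * b * c = 1)
    (hab : conj a * b = 1) (hs : altProd a b c ^ 2 = -(s : ℂ) ^ 2) : ‖a‖ = 1 := by
  have ha : a ≠ 0 := by rintro rfl; simp at hm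
  have ha' : conj a ≠ 0 := by rintro h0; rw [h0] at hab; simp at hab
  have hb : b = 1 / conj a := by rw [eq_div_iff ha']; linear_combination hab
  have hc : c = conj a / a := by
    rw [eq_div_iff ha]
    linear_combination conj a * hm - a * c * hab
  have hcc : conj c = a / conj a := by rw [hc, map_div₀, Complex.conj_conj]
  have hV : altProd a b c * (a * conj a) = (a * conj a - 1) * ((c - a) * conj (c - a)) := by
    rw [altProd, map_sub, hcc, hb, hc]
    field_simp
  rw [Complex.mul_conj', Complex.mul_conj'] at hV
  have h1 : (((‖a‖ ^ 2 - 1) * ‖c - a‖ ^ 2) ^ 2 : ℝ) = -(s ^ 2 * (‖a‖ ^ 2) ^ 2) := by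
    have : ((((‖a‖ ^ 2 - 1) * ‖c - a‖ ^ 2) ^ 2 : ℝ) : ℂ) =
        ((-(s ^ 2 * (‖a‖ ^ 2) ^ 2) : ℝ) : ℂ) := by
      push_cast
      rw [← hV, mul_pow, hs]
      ring
    exact_mod_cast this
  have h2 : (‖a‖ ^ 2 - 1) * ‖c - a‖ ^ 2 = 0 := by
    have := sq_nonneg (s * ‖a‖ ^ 2)
    have h3 := sq_nonneg ((‖a‖ ^ 2 - 1) * ‖c - a‖ ^ 2)
    refine pow_eq_zero_iff two_ne_zero |>.mp (le_antisymm ?_ h3)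
    nlinarith
  rcases mul_eq_zero.mp h2 with h3 | h3
  · exact (pow_eq_one_iff_of_nonneg (norm_nonneg a) two_ne_zero).mp (by linarith)
  · have : c = a := by
      rw [pow_eq_zero_iff two_ne_zero, norm_eq_zero, sub_eq_zero] at h3
      exact h3
    rw [← this, hc, norm_div, RCLike.norm_conj, div_self (norm_ne_zero_iff.mpr ha)]

theorem exists_roots_of_cubic (σ τ : ℂ) :
    ∃ a b c : ℂ, a + b + c = σ ∧ a * b + b * c + c * a = τ ∧ a * b * c = 1 := by
  let P : Cubic ℂ := ⟨1, -σ, τ, -1⟩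
  have ha : P.a ≠ 0 := one_ne_zero
  obtain ⟨a, b, c, h⟩ := (Cubic.splits_iff_roots_eq_three (φ := RingHom.id ℂ) ha).mp
    (IsAlgClosed.splits _)
  have h1 := Cubic.b_eq_three_roots ha h
  have h2 := Cubic.c_eq_three_roots ha h
  have h3 := Cubic.d_eq_three_roots ha h
  simp only [P, RingHom.id_apply] at h1 h2 h3
  exact ⟨a, b, c, by linear_combination h1, by linear_combination -h2, by linear_combination h3⟩

/-- Every point satisfying the discriminant relation comes from a unit triple. -/
theorem exists_isUnitTriple_of_sq_eq {σ : ℂ} {s : ℝ}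
    (hs : s ^ 2 = 27 - 18 * ‖σ‖ ^ 2 + 8 * (σ ^ 3).re - ‖σ‖ ^ 4) :
    ∃ a b c : ℂ, IsUnitTriple a b c ∧ a + b + c = σ ∧ (altProd a b c).im = s := by
  obtain ⟨a, b, c, h1, h2, h3⟩ := exists_roots_of_cubic σ (conj σ)
  have hV : altProd a b c ^ 2 = -(s : ℂ) ^ 2 := by
    rw [altProd_sq_of_mul_eq h3, h1, h2]
    have hs' : (s : ℂ) ^ 2 = 27 - 18 * (‖σ‖ : ℂ) ^ 2 + 8 * ((σ ^ 3).re : ℂ) - (‖σ‖ : ℂ) ^ 4 := by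
      exact_mod_cast congrArg Complex.ofReal hs
    have h4 : σ * conj σ = (‖σ‖ : ℂ) ^ 2 := Complex.mul_conj' σ
    have h5 : σ ^ 3 + conj σ ^ 3 = 2 * (σ ^ 3).re := by
      rw [← map_pow, Complex.add_conj]; push_cast; ring
    linear_combination hs' + (18 + σ * conj σ + (‖σ‖ : ℂ) ^ 2) * h4 - 4 * h5
  -- the set of roots is stable under inversion in the unit circle
  have key : ∀ {a b c : ℂ}, a + b + c = σ → a * b + b * c + c * a = conj σ → a * b * c = 1 →
      altProd a b c ^ 2 = -(s : ℂ) ^ 2 → ‖a‖ = 1 := by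
    intro a b c h1 h2 h3 hV
    have e1 := congrArg conj h1
    have e2 := congrArg conj h2
    have e3 := congrArg conj h3
    simp only [map_add, map_mul, map_one, Complex.conj_conj] at e1 e2 e3
    have hroot : (conj a * a - 1) * ((conj a * b - 1) * (conj a * c - 1)) = 0 := by
      linear_combination conj a ^ 3 * h3 - conj a ^ 2 * (h2 - e1) + conj a * (h1 - e2) + e3
    rcases mul_eq_zero.mp hroot with e | e
    · rw [Complex.conj_mul', sub_eq_zero] at e
      have : ‖a‖ ^ 2 = 1 := by exact_mod_cast e
      exact (pow_eq_one_iff_of_nonneg (norm_nonneg a) two_ne_zero).mp this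
    · rcases mul_eq_zero.mp e with e | e
      · exact norm_eq_one_of_conj_mul_eq_one h3 (sub_eq_zero.mp e) hV
      · refine norm_eq_one_of_conj_mul_eq_one (b := c) (c := b) (s := s) ?_ (sub_eq_zero.mp e) ?_
        · rw [← h3]; ring
        · rw [← hV, altProd, altProd]; ring
  have hT : IsUnitTriple a b c := by
    refine ⟨key h1 h2 h3 hV, key (b := c) (c := a) ?_ ?_ ?_ ?_,
      key (b := a) (c := b) ?_ ?_ ?_ ?_, h3⟩
    · rw [← h1]; ring
    · rw [← h2]; ring
    · rw [← h3]; ring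
    · rw [← hV, altProd, altProd]; ring
    · rw [← h1]; ring
    · rw [← h2]; ring
    · rw [← h3]; ring
    · rw [← hV, altProd, altProd]; ring
  have him : (altProd a b c).im ^ 2 = s ^ 2 := by rw [hT.altProd_im_sq, h1, hs]
  rcases sq_eq_sq_iff_eq_or_eq_neg.mp him with h4 | h4
  · exact ⟨a, b, c, hT, h1, h4⟩
  · refine ⟨a, c, b, ⟨hT.norm_fst, hT.norm_trd, hT.norm_snd, ?_⟩, ?_, ?_⟩
    · rw [← h3]; ring
    · rw [← h1]; ring
    · rw [← neg_eq_iff_eq_neg] at h4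
      rw [← h4, ← Complex.neg_im, altProd, altProd]
      congr 1
      ring

/-- Every ray from the origin contains the invariants of a unit triple. -/
theorem exists_isUnitTriple_smul {σ : ℂ} {s : ℝ} (h0 : σ ≠ 0 ∨ s ≠ 0) :
    ∃ k : ℝ, 0 < k ∧ ∃ a b c : ℂ, IsUnitTriple a b c ∧ a + b + c = k * σ ∧
      (altProd a b c).im = k * s := by
  let F : ℝ → ℝ := fun k => 27 - 18 * (k * ‖σ‖) ^ 2 + 8 * (k ^ 3 * (σ ^ 3).re) - (k * ‖σ‖) ^ 4
    - (k * s) ^ 2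
  have hF : Continuous F := by fun_prop
  obtain ⟨K, hK, hFK⟩ : ∃ K, 0 ≤ K ∧ F K ≤ 0 := by
    by_cases hσ : σ = 0
    · have hs : s ≠ 0 := h0.resolve_left (not_not.mpr hσ)
      refine ⟨6 / |s|, by positivity, ?_⟩
      have h1 : (6 / |s| * s) ^ 2 = 36 := by
        rw [mul_pow, div_pow, sq_abs]
        field_simp
        norm_num
      simp only [F, hσ, h1]
      norm_num
    · have hn : ‖σ‖ ≠ 0 := norm_ne_zero_iff.mpr hσ
      refine ⟨9 / ‖σ‖, by positivity, ?_⟩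
      have h1 : 9 / ‖σ‖ * ‖σ‖ = 9 := div_mul_cancel₀ _ hn
      have h2 : (9 / ‖σ‖) ^ 3 * (σ ^ 3).re ≤ 9 ^ 3 := by
        have : (σ ^ 3).re ≤ ‖σ‖ ^ 3 := by rw [← norm_pow]; exact Complex.re_le_norm _
        calc (9 / ‖σ‖) ^ 3 * (σ ^ 3).re ≤ (9 / ‖σ‖) ^ 3 * ‖σ‖ ^ 3 := by gcongr
          _ = 9 ^ 3 := by rw [← mul_pow, h1]
      simp only [F, h1]
      nlinarith [sq_nonneg (9 / ‖σ‖ * s)]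
  obtain ⟨k, hk, hFk⟩ := intermediate_value_Icc' hK hF.continuousOn
    (show (0 : ℝ) ∈ Set.Icc (F K) (F 0) from ⟨hFK, by simp [F]⟩)
  have hk0 : 0 < k := by
    refine lt_of_le_of_ne hk.1 ?_
    rintro rfl
    simp [F] at hFk
  refine ⟨k, hk0, exists_isUnitTriple_of_sq_eq ?_⟩
  rw [norm_mul, Complex.norm_real, Real.norm_of_nonneg hk0.le, mul_pow (k : ℂ),
    ← Complex.ofReal_pow, Complex.re_ofReal_mul]
  simp only [F] at hFk
  linarith

/-! ### Pairs of complex numbers of norm one -/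

theorem re_sq_add_im_sq_of_norm_eq_one {a : ℂ} (ha : ‖a‖ = 1) : a.re ^ 2 + a.im ^ 2 = 1 := by
  rw [← one_pow 2, ← ha, Complex.sq_norm, Complex.normSq_apply]; ring

/-- A pair of complex numbers of norm one is determined up to simultaneous conjugation by the ray
through its real parts and the product of its imaginary parts. -/
theorem eq_or_eq_conj_of_smul {a b a' b' : ℂ} (ha : ‖a‖ = 1) (hb : ‖b‖ = 1) (ha' : ‖a'‖ = 1)
    (hb' : ‖b'‖ = 1) {k : ℝ} (hk : 0 < k) (h1 : a.re = k * a'.re) (h2 : b.re = k * b'.re)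
    (h3 : a.im * b.im = k * (a'.im * b'.im)) :
    (a = a' ∧ b = b') ∨ (a = conj a' ∧ b = conj b') := by
  have ea := re_sq_add_im_sq_of_norm_eq_one ha
  have eb := re_sq_add_im_sq_of_norm_eq_one hb
  have ea' := re_sq_add_im_sq_of_norm_eq_one ha'
  have eb' := re_sq_add_im_sq_of_norm_eq_one hb'
  have hk1 : k = 1 := by
    by_contra hne
    have e1 : (k ^ 2 - 1) * (1 - k ^ 2 * (a'.re ^ 2 * b'.re ^ 2)) = 0 := by
      have e2 : (1 - a.re ^ 2) * (1 - b.re ^ 2) =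
          k ^ 2 * ((1 - a'.re ^ 2) * (1 - b'.re ^ 2)) := by
        have := congrArg (· ^ 2) h3
        simp only [mul_pow] at this
        rw [show 1 - a.re ^ 2 = a.im ^ 2 by linarith, show 1 - b.re ^ 2 = b.im ^ 2 by linarith,
          show 1 - a'.re ^ 2 = a'.im ^ 2 by linarith, show 1 - b'.re ^ 2 = b'.im ^ 2 by linarith]
        exact this
      rw [h1, h2] at e2
      linear_combination -e2
    have e3 : k ^ 2 - 1 ≠ 0 := by
      intro h0
      exact hne ((pow_eq_one_iff_of_nonneg hk.le two_ne_zero).mp (by linarith))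
    have e4 := (mul_eq_zero.mp e1).resolve_left e3
    have e5 : a.re ^ 2 * b'.re ^ 2 = 1 := by rw [h1]; linear_combination -e4
    have e6 : a'.re ^ 2 * b.re ^ 2 = 1 := by rw [h2]; linear_combination -e4
    have f1 : a.re ^ 2 = 1 := by nlinarith [sq_nonneg a.im, sq_nonneg b'.im, sq_nonneg a.re]
    have f2 : a'.re ^ 2 = 1 := by nlinarith [sq_nonneg a'.im, sq_nonneg b.im, sq_nonneg a'.re]
    rw [h1, mul_pow, f2, mul_one] at f1
    exact e3 (by linarith)
  subst hk1
  rw [one_mul] at h1 h2 h3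
  have sa : a.im = a'.im ∨ a.im = -a'.im :=
    sq_eq_sq_iff_eq_or_eq_neg.mp (by rw [h1] at ea; linarith)
  have sb : b.im = b'.im ∨ b.im = -b'.im :=
    sq_eq_sq_iff_eq_or_eq_neg.mp (by rw [h2] at eb; linarith)
  simp only [Complex.ext_iff, Complex.conj_re, Complex.conj_im, h1, h2, true_and]
  rcases sa with sa | sa <;> rcases sb with sb | sb
  · exact Or.inl ⟨sa, sb⟩
  · have : a'.im * b'.im = 0 := by rw [sa, sb] at h3; linarith
    rcases mul_eq_zero.mp this with h0 | h0
    · exact Or.inr ⟨by rw [sa, h0, neg_zero], sb⟩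
    · exact Or.inl ⟨sa, by rw [sb, h0, neg_zero]⟩
  · have : a'.im * b'.im = 0 := by rw [sa, sb] at h3; linarith
    rcases mul_eq_zero.mp this with h0 | h0
    · exact Or.inl ⟨by rw [sa, h0, neg_zero], sb⟩
    · exact Or.inr ⟨sa, by rw [sb, h0, neg_zero]⟩
  · exact Or.inr ⟨sa, sb⟩

theorem exists_norm_eq_one_of_sq_eq {x y s : ℝ} (hx : x ^ 2 ≤ 1) (hy : y ^ 2 ≤ 1)
    (hs : s ^ 2 = (1 - x ^ 2) * (1 - y ^ 2)) :
    ∃ a b : ℂ, ‖a‖ = 1 ∧ ‖b‖ = 1 ∧ a.re = x ∧ b.re = y ∧ a.im * b.im = s := by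
  have key : ∀ {x u : ℝ}, x ^ 2 + u ^ 2 = 1 → ‖(⟨x, u⟩ : ℂ)‖ = 1 := by
    intro x u h
    rw [← pow_eq_one_iff_of_nonneg (norm_nonneg _) two_ne_zero, Complex.sq_norm,
      Complex.normSq_apply, ← h]
    ring
  have hx' := Real.sq_sqrt (sub_nonneg.mpr hx)
  have hy' := Real.sq_sqrt (sub_nonneg.mpr hy)
  have hprod : (√(1 - x ^ 2) * √(1 - y ^ 2)) ^ 2 = s ^ 2 := by rw [mul_pow, hx', hy', hs]
  rcases sq_eq_sq_iff_eq_or_eq_neg.mp hprod with h | h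
  · exact ⟨⟨x, √(1 - x ^ 2)⟩, ⟨y, √(1 - y ^ 2)⟩, key (by linarith), key (by linarith), rfl, rfl, h⟩
  · exact ⟨⟨x, √(1 - x ^ 2)⟩, ⟨y, -√(1 - y ^ 2)⟩, key (by linarith), key (by linarith), rfl, rfl,
      by simp only; linarith⟩

/-- Every ray from the origin contains the invariants of a pair of complex numbers of norm one. -/
theorem exists_norm_eq_one_smul {x y s : ℝ} (h0 : x ≠ 0 ∨ y ≠ 0 ∨ s ≠ 0) :
    ∃ k : ℝ, 0 < k ∧ ∃ a b : ℂ, ‖a‖ = 1 ∧ ‖b‖ = 1 ∧ a.re = k * x ∧ b.re = k * y ∧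
      a.im * b.im = k * s := by
  rcases (le_max_of_le_left (abs_nonneg x) : 0 ≤ max |x| |y|).eq_or_lt with hM | hM
  · have hx : x = 0 := abs_eq_zero.mp (le_antisymm (hM ▸ le_max_left _ _) (abs_nonneg x))
    have hy : y = 0 := abs_eq_zero.mp (le_antisymm (hM ▸ le_max_right _ _) (abs_nonneg y))
    subst hx hy
    have hs : s ≠ 0 := by simpa using h0
    refine ⟨|s|⁻¹, by positivity, exists_norm_eq_one_of_sq_eq (by simp) (by simp) ?_⟩
    rw [mul_pow, inv_pow, sq_abs, inv_mul_cancel₀ (pow_ne_zero 2 hs)]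
    simp
  · set M := max |x| |y|
    have hle : ∀ {u k : ℝ}, |u| ≤ M → 0 ≤ k → k ≤ M⁻¹ → (k * u) ^ 2 ≤ 1 := by
      intro u k hu hk hkM
      rw [sq_le_one_iff_abs_le_one, abs_mul, abs_of_nonneg hk]
      calc k * |u| ≤ M⁻¹ * M := by gcongr
        _ = 1 := inv_mul_cancel₀ hM.ne'
    let F : ℝ → ℝ := fun k => (1 - (k * x) ^ 2) * (1 - (k * y) ^ 2) - (k * s) ^ 2
    have hF : Continuous F := by fun_prop
    have hFM : F M⁻¹ ≤ 0 := by
      have h1 : (1 - (M⁻¹ * x) ^ 2) * (1 - (M⁻¹ * y) ^ 2) = 0 := by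
        have key : ∀ {u : ℝ}, |u| = M → 1 - (M⁻¹ * u) ^ 2 = 0 := by
          intro u hu
          rw [mul_pow, ← sq_abs u, hu, ← mul_pow, inv_mul_cancel₀ hM.ne']
          norm_num
        rcases max_choice |x| |y| with h | h
        · rw [key h.symm, zero_mul]
        · rw [key h.symm, mul_zero]
      simp only [F, h1]
      nlinarith [sq_nonneg (M⁻¹ * s)]
    obtain ⟨k, hk, hFk⟩ := intermediate_value_Icc' (inv_nonneg.mpr hM.le) hF.continuousOn
      (show (0 : ℝ) ∈ Set.Icc (F M⁻¹) (F 0) from ⟨hFM, by simp [F]⟩)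
    have hk0 : 0 < k := by
      refine lt_of_le_of_ne hk.1 ?_
      rintro rfl
      simp [F] at hFk
    refine ⟨k, hk0, exists_norm_eq_one_of_sq_eq (hle (le_max_left _ _) hk.1 hk.2)
      (hle (le_max_right _ _) hk.1 hk.2) ?_⟩
    simp only [F] at hFk
    linarith

/-! ### Characters of the lattice -/

/-- The point `exp (2 π i r)` of the unit circle. -/
noncomputable def unitExp (r : ℝ) : ℂ := Complex.exp ((2 * Real.pi * r : ℝ) * Complex.I)

theorem continuous_unitExp : Continuous unitExp := by unfold unitExp; fun_prop

theorem norm_unitExp (r : ℝ) : ‖unitExp r‖ = 1 := Complex.norm_exp_ofReal_mul_I _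

theorem unitExp_add (r s : ℝ) : unitExp (r + s) = unitExp r * unitExp s := by
  rw [unitExp, unitExp, unitExp, ← Complex.exp_add]
  congr 1
  push_cast
  ring

theorem unitExp_neg (r : ℝ) : unitExp (-r) = conj (unitExp r) := by
  rw [unitExp, unitExp, ← Complex.exp_conj, map_mul, Complex.conj_ofReal, Complex.conj_I]
  congr 1
  push_cast
  ring

theorem unitExp_eq_iff {r s : ℝ} : unitExp r = unitExp s ↔ ∃ n : ℤ, r = s + n := by
  have h : (2 * Real.pi : ℂ) * Complex.I ≠ 0 := Complex.two_pi_I_ne_zero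
  rw [unitExp, unitExp, Complex.exp_eq_exp_iff_exists_int]
  refine exists_congr fun n => ?_
  have h1 : ((2 * Real.pi * r : ℝ) : ℂ) * Complex.I =
      ((2 * Real.pi * s : ℝ) : ℂ) * Complex.I + n * (2 * Real.pi * Complex.I) ↔
      (2 * Real.pi : ℂ) * Complex.I * r = (2 * Real.pi : ℂ) * Complex.I * ((s + n : ℝ) : ℂ) := by
    push_cast
    constructor <;> intro h <;> linear_combination h
  rw [h1, mul_right_inj' h, Complex.ofReal_inj]

theorem exists_unitExp_eq {a : ℂ} (ha : ‖a‖ = 1) : ∃ r, unitExp r = a := by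
  refine ⟨a.arg / (2 * Real.pi), ?_⟩
  rw [unitExp, mul_div_cancel₀ _ (by positivity)]
  simpa [ha] using Complex.norm_mul_exp_arg_mul_I a

/-- The character `x + y ρ ↦ exp (2 π i x)`, for real `x` and `y`. -/
noncomputable def charFst (ρ z : ℂ) : ℂ := unitExp (z.re - z.im / ρ.im * ρ.re)

/-- The character `x + y ρ ↦ exp (2 π i y)`, for real `x` and `y`. -/
noncomputable def charSnd (ρ z : ℂ) : ℂ := unitExp (z.im / ρ.im)

theorem continuous_charFst (ρ : ℂ) : Continuous (charFst ρ) :=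
  continuous_unitExp.comp (by fun_prop)

theorem continuous_charSnd (ρ : ℂ) : Continuous (charSnd ρ) :=
  continuous_unitExp.comp (by fun_prop)

theorem norm_charFst (ρ z : ℂ) : ‖charFst ρ z‖ = 1 := norm_unitExp _

theorem norm_charSnd (ρ z : ℂ) : ‖charSnd ρ z‖ = 1 := norm_unitExp _

theorem sameOrbit_of_sub_mem (q : ℕ) {ρ z w : ℂ} (h : w - z ∈ rotLattice ρ) :
    SameOrbit q ρ z w := ⟨1, one_pow _, w - z, h, by ring⟩

theorem sameOrbit_zero_iff (q : ℕ) {ρ z : ℂ} : SameOrbit q ρ 0 z ↔ z ∈ rotLattice ρ := by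
  constructor
  · rintro ⟨ζ, -, l, hl, rfl⟩
    simpa using hl
  · intro hz
    exact sameOrbit_of_sub_mem q (by simpa using hz)

namespace IsCrystRotation

variable {q : ℕ} {ρ : ℂ} {t : ℤ}

theorem charFst_add_mul (h : IsCrystRotation q ρ t) (x y : ℝ) :
    charFst ρ (x + y * ρ) = unitExp x := by
  have := h.im_ne_zero
  rw [charFst]
  congr 1
  simp
  field_simp
  ring

theorem charSnd_add_mul (h : IsCrystRotation q ρ t) (x y : ℝ) :
    charSnd ρ (x + y * ρ) = unitExp y := by
  have := h.im_ne_zero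
  rw [charSnd]
  congr 1
  simp
  field_simp

theorem exists_eq_add_mul (h : IsCrystRotation q ρ t) (z : ℂ) : ∃ x y : ℝ, z = x + y * ρ := by
  have := h.im_ne_zero
  refine ⟨z.re - z.im / ρ.im * ρ.re, z.im / ρ.im, ?_⟩
  apply Complex.ext
  · simp
  · simp
    field_simp

theorem char_add_mem (h : IsCrystRotation q ρ t) (z : ℂ) {l : ℂ} (hl : l ∈ rotLattice ρ) :
    charFst ρ (z + l) = charFst ρ z ∧ charSnd ρ (z + l) = charSnd ρ z := by
  obtain ⟨m, n, rfl⟩ := hl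
  obtain ⟨x, y, rfl⟩ := h.exists_eq_add_mul z
  rw [show (x : ℂ) + y * ρ + (m + n * ρ) = ((x + m : ℝ) : ℂ) + ((y + n : ℝ) : ℂ) * ρ by
    push_cast; ring, h.charFst_add_mul, h.charSnd_add_mul, h.charFst_add_mul, h.charSnd_add_mul]
  exact ⟨unitExp_eq_iff.mpr ⟨m, rfl⟩, unitExp_eq_iff.mpr ⟨n, rfl⟩⟩

theorem charFst_mul (h : IsCrystRotation q ρ t) (z : ℂ) :
    charFst ρ (ρ * z) = conj (charSnd ρ z) := by
  obtain ⟨x, y, rfl⟩ := h.exists_eq_add_mul z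
  rw [show ρ * ((x : ℂ) + y * ρ) = ((-y : ℝ) : ℂ) + ((x + t * y : ℝ) : ℂ) * ρ by
    push_cast; linear_combination (y : ℂ) * h.sq, h.charFst_add_mul, h.charSnd_add_mul, unitExp_neg]

theorem charSnd_mul (h : IsCrystRotation q ρ t) (z : ℂ) :
    charSnd ρ (ρ * z) = charFst ρ z * charSnd ρ z ^ t := by
  obtain ⟨x, y, rfl⟩ := h.exists_eq_add_mul z
  rw [show ρ * ((x : ℂ) + y * ρ) = ((-y : ℝ) : ℂ) + ((x + t * y : ℝ) : ℂ) * ρ by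
    push_cast; linear_combination (y : ℂ) * h.sq, h.charSnd_add_mul, h.charFst_add_mul,
    h.charSnd_add_mul, unitExp_add]
  congr 1
  rw [unitExp, unitExp, ← Complex.exp_int_mul]
  congr 1
  push_cast
  ring

theorem char_neg (h : IsCrystRotation q ρ t) (z : ℂ) :
    charFst ρ (-z) = conj (charFst ρ z) ∧ charSnd ρ (-z) = conj (charSnd ρ z) := by
  obtain ⟨x, y, rfl⟩ := h.exists_eq_add_mul z
  rw [show -((x : ℂ) + y * ρ) = ((-x : ℝ) : ℂ) + ((-y : ℝ) : ℂ) * ρ by push_cast; ring,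
    h.charFst_add_mul, h.charSnd_add_mul, h.charFst_add_mul, h.charSnd_add_mul, unitExp_neg,
    unitExp_neg]
  exact ⟨rfl, rfl⟩

theorem sameOrbit_of_char_eq (h : IsCrystRotation q ρ t) {z w : ℂ}
    (h1 : charFst ρ z = charFst ρ w) (h2 : charSnd ρ z = charSnd ρ w) : SameOrbit q ρ z w := by
  obtain ⟨x, y, rfl⟩ := h.exists_eq_add_mul z
  obtain ⟨x', y', rfl⟩ := h.exists_eq_add_mul w
  rw [h.charFst_add_mul, h.charFst_add_mul, unitExp_eq_iff] at h1
  rw [h.charSnd_add_mul, h.charSnd_add_mul, unitExp_eq_iff] at h2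
  obtain ⟨m, rfl⟩ := h1
  obtain ⟨n, rfl⟩ := h2
  refine sameOrbit_of_sub_mem q ⟨-m, -n, ?_⟩
  push_cast
  ring

theorem exists_char_eq (h : IsCrystRotation q ρ t) {a b : ℂ} (ha : ‖a‖ = 1) (hb : ‖b‖ = 1) :
    ∃ z, charFst ρ z = a ∧ charSnd ρ z = b := by
  obtain ⟨x, rfl⟩ := exists_unitExp_eq ha
  obtain ⟨y, rfl⟩ := exists_unitExp_eq hb
  exact ⟨x + y * ρ, h.charFst_add_mul x y, h.charSnd_add_mul x y⟩

theorem sameOrbit_mul_iff (h : IsCrystRotation q ρ t) {z w : ℂ} :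
    SameOrbit q ρ z (ρ * w) ↔ SameOrbit q ρ z w := by
  have h1 : SameOrbit q ρ w (ρ * w) := ⟨ρ, h.prim.pow_eq_one, 0, zero_mem _, by ring⟩
  exact ⟨fun h2 => h.sameOrbit_trans h2 (h.sameOrbit_symm h1), fun h2 => h.sameOrbit_trans h2 h1⟩

/-! ### Orbits with nontrivial stabilizer -/

theorem mem_rotLattice_iff_dvd (h : IsCrystRotation q ρ t) {z : ℂ} (N m n : ℤ) (hN : N ≠ 0)
    (hz : N * z = m + n * ρ) : z ∈ rotLattice ρ ↔ N ∣ m ∧ N ∣ n := by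
  constructor
  · rintro ⟨a, b, rfl⟩
    have h1 : (((N * a - m : ℤ) : ℝ) : ℂ) + ((N * b - n : ℤ) : ℝ) * ρ = 0 := by
      push_cast
      linear_combination hz
    have him := h.im_ne_zero
    have h2 := congrArg Complex.im h1
    simp only [Complex.add_im, Complex.ofReal_im, Complex.im_ofReal_mul, zero_add,
      Complex.zero_im, mul_eq_zero, him, or_false] at h2
    have h3 := congrArg Complex.re h1
    simp only [Complex.add_re, Complex.ofReal_re, Complex.re_ofReal_mul, h2, zero_mul, add_zero,
      Complex.zero_re] at h3
    have h4 : N * b - n = 0 := by exact_mod_cast h2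
    have h5 : N * a - m = 0 := by exact_mod_cast h3
    exact ⟨⟨a, by linarith⟩, ⟨b, by linarith⟩⟩
  · rintro ⟨⟨a, rfl⟩, ⟨b, rfl⟩⟩
    have hN' : (N : ℂ) ≠ 0 := by exact_mod_cast hN
    refine ⟨a, b, mul_left_cancel₀ hN' ?_⟩
    rw [hz]
    push_cast
    ring

/-- The order of the stabilizer of a point from the list of the rotations that fix it modulo the
lattice. -/
theorem card_stabilizer (h : IsCrystRotation q ρ t) {c : ℂ} {n : ℕ} (hn : n ∣ q)
    (H : ∀ j < q, (1 - ρ ^ j) * c ∈ rotLattice ρ ↔ q ∣ j * n) :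
    Nat.card {ζ : ℂ // ζ ^ q = 1 ∧ (1 - ζ) * c ∈ rotLattice ρ} = n := by
  have hset : ∀ ζ : ℂ, (ζ ^ q = 1 ∧ (1 - ζ) * c ∈ rotLattice ρ) ↔ ζ ^ n = 1 := by
    intro ζ
    have key : ζ ^ q = 1 → ((1 - ζ) * c ∈ rotLattice ρ ↔ ζ ^ n = 1) := by
      intro hζ
      obtain ⟨j, hj, rfl⟩ := h.exists_pow hζ
      rw [H j hj, ← pow_mul, h.prim.pow_eq_one_iff_dvd]
    constructor
    · rintro ⟨hζ, hl⟩
      exact (key hζ).mp hl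
    · intro hζ
      obtain ⟨r, rfl⟩ := hn
      have hζq : ζ ^ (n * r) = 1 := by rw [pow_mul, hζ, one_pow]
      exact ⟨hζq, (key hζq).mpr hζ⟩
  rw [Nat.card_congr (Equiv.subtypeEquivRight hset)]
  exact ncard_pow_eq_one (Nat.pos_of_dvd_of_pos hn h.q_pos)

theorem card_stabilizer_zero (h : IsCrystRotation q ρ t) :
    Nat.card {ζ : ℂ // ζ ^ q = 1 ∧ (1 - ζ) * (0 : ℂ) ∈ rotLattice ρ} = q := by
  refine h.card_stabilizer dvd_rfl fun j _ => ?_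
  simp

end IsCrystRotation

/-! ### Uniformization of the three spherical orbifolds -/

namespace IsCrystRotation

variable {ρ : ℂ}

theorem isUnitTriple_char_three (ρ z : ℂ) :
    IsUnitTriple (charFst ρ z) (conj (charSnd ρ z)) (charSnd ρ z * conj (charFst ρ z)) := by
  refine ⟨norm_charFst ρ z, ?_, ?_, ?_⟩
  · rw [RCLike.norm_conj, norm_charSnd]
  · rw [norm_mul, RCLike.norm_conj, norm_charSnd, norm_charFst, one_mul]
  · linear_combination conj_mul_self_of_norm_eq_one (norm_charFst ρ z)
      * (conj (charSnd ρ z) * charSnd ρ z) + conj_mul_self_of_norm_eq_one (norm_charSnd ρ z)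

/-- The uniformization of `S²(3,3,3)`: the group permutes the triple
`(exp (2πix), exp (-2πiy), exp (2πi(y-x)))` cyclically, and the sum of the triple together with
its alternating product separates the orbits. -/
theorem exists_isUniformization_three (h : IsCrystRotation 3 ρ (-1)) {X : Type*}
    [TopologicalSpace X] {O : ConeOrbifold X} {x : Fin 3 → X} (hO : O.IsSphereWith ![3, 3, 3] x) :
    ∃ π : ℂ → X, IsUniformization O 3 ρ π := by
  have hsq : ρ ^ 2 = -ρ - 1 := by simpa using h.sq
  let v : ℂ → ℝ × ℂ := fun z =>
    ((altProd (charFst ρ z) (conj (charSnd ρ z)) (charSnd ρ z * conj (charFst ρ z))).im,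
      charFst ρ z + conj (charSnd ρ z) + charSnd ρ z * conj (charFst ρ z))
  have hcA := continuous_charFst ρ
  have hcB := continuous_charSnd ρ
  have hvc : Continuous v := by
    have hcA' : Continuous fun z => conj (charFst ρ z) := Complex.continuous_conj.comp hcA
    have hcB' : Continuous fun z => conj (charSnd ρ z) := Complex.continuous_conj.comp hcB
    refine (Complex.continuous_im.comp ?_).prodMk (by fun_prop)
    unfold altProd
    fun_prop
  have hA : ∀ z, charFst ρ (ρ * z) = conj (charSnd ρ z) := h.charFst_mul
  have hB : ∀ z, charSnd ρ (ρ * z) = charFst ρ z * conj (charSnd ρ z) := by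
    intro z
    rw [h.charSnd_mul, zpow_neg_one, Complex.inv_def, Complex.normSq_eq_norm_sq, norm_charSnd]
    simp
  have hC : ∀ z, charSnd ρ (ρ * z) * conj (charFst ρ (ρ * z)) = charFst ρ z := by
    intro z
    rw [hA, hB, Complex.conj_conj]
    linear_combination charFst ρ z * conj_mul_self_of_norm_eq_one (norm_charSnd ρ z)
  have hB' : ∀ z, conj (charSnd ρ (ρ * z)) = charSnd ρ z * conj (charFst ρ z) := by
    intro z
    rw [hB, map_mul, Complex.conj_conj, mul_comm]
  have hinv : ∀ z w, SameOrbit 3 ρ z w → v z = v w := by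
    refine fun z w => h.apply_eq_of_sameOrbit ?_ ?_ ?_
    · intro z
      simp only [v, (h.char_add_mem z (one_mem_rotLattice ρ)).1,
        (h.char_add_mem z (one_mem_rotLattice ρ)).2]
    · intro z
      simp only [v, (h.char_add_mem z (self_mem_rotLattice ρ)).1,
        (h.char_add_mem z (self_mem_rotLattice ρ)).2]
    · intro z
      simp only [v]
      rw [hC, hB', hA]
      refine Prod.ext ?_ ?_
      · simp only [altProd]
        congr 1
        ring
      · simp only
        ring
  have horb : ∀ z w, charFst ρ z = charFst ρ w → conj (charSnd ρ z) = conj (charSnd ρ w) →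
      SameOrbit 3 ρ z w :=
    fun z w h1 h2 => h.sameOrbit_of_char_eq h1 ((starRingEnd ℂ).injective h2)
  -- `κ` is the centre of rotation with `(1 - ρ) κ = 1`
  let κ : ℂ := (2 + ρ) / 3
  have hκ : 3 * κ = 2 + ρ := by simp only [κ]; ring
  have hκρ : (1 - ρ) * κ = 1 := by linear_combination (1 - ρ) / 3 * hκ - hsq / 3
  have hκm : κ ∉ rotLattice ρ := by
    rw [h.mem_rotLattice_iff_dvd 3 2 1 (by norm_num) (by push_cast; linear_combination hκ)]
    decide
  have h3κ : 3 * κ ∈ rotLattice ρ := ⟨2, 1, by push_cast; linear_combination hκ⟩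
  have hκfix : ∀ {ζ : ℂ}, ζ ^ 3 = 1 → (1 - ζ) * κ ∈ rotLattice ρ := by
    intro ζ hζ
    obtain ⟨j, hj, rfl⟩ := h.exists_pow hζ
    interval_cases j
    · simp
    · exact ⟨1, 0, by push_cast; linear_combination hκρ⟩
    · exact ⟨1, 1, by push_cast; linear_combination (1 + ρ) * hκρ⟩
  refine exists_isUniformization h hO (c := ![0, κ, -κ]) hvc ?_ hinv ?_ ?_ ?_ ?_ ?_
  · intro z hz
    rw [Prod.mk_eq_zero] at hz
    exact (isUnitTriple_char_three ρ z).altProd_im_ne_zero_of_sum_eq_zero hz.2 hz.1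
  · intro z w k hk he
    rw [Prod.smul_mk, Prod.mk.injEq, smul_eq_mul, Complex.real_smul] at he
    rcases (isUnitTriple_char_three ρ z).eq_rotate_of_smul (isUnitTriple_char_three ρ w) hk
      he.2 he.1 with ⟨h1, h2, -⟩ | ⟨h1, h2, -⟩ | ⟨h1, h2, -⟩
    · exact horb z w h1 h2
    · exact h.sameOrbit_mul_iff.mp (horb z (ρ * w) (by rw [h1, hA]) (by rw [h2, hB']))
    · refine h.sameOrbit_mul_iff.mp (h.sameOrbit_mul_iff.mp (horb z (ρ * (ρ * w)) ?_ ?_))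
      · rw [h1, hA, hB']
      · rw [h2, hB', hC]
  · rintro ⟨s, σ⟩ hu
    obtain ⟨k, hk, a, b, c, hT, h1, h2⟩ := exists_isUnitTriple_smul (σ := σ) (s := s) (by
      by_contra! h0
      exact hu (Prod.ext h0.2 h0.1))
    obtain ⟨z, hz1, hz2⟩ := h.exists_char_eq hT.norm_fst
      (b := conj b) (by rw [RCLike.norm_conj]; exact hT.norm_snd)
    refine ⟨z, k, hk, ?_⟩
    have hc : charSnd ρ z * conj (charFst ρ z) = c := by
      rw [hz1, hz2, ← map_mul, mul_comm b, ← hT.rotate.rotate.conj_fst, Complex.conj_conj]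
    rw [Prod.smul_mk, smul_eq_mul, Complex.real_smul, ← h1, ← h2]
    simp only [v]
    rw [hc, hz1, hz2, Complex.conj_conj]
  · have h12 : ¬SameOrbit 3 ρ κ (-κ) := by
      rintro ⟨ζ, hζ, l, hl, he⟩
      have h1 : κ ∈ rotLattice ρ := by
        have h2 : κ = 3 * κ + l - (1 - ζ) * κ := by linear_combination he
        rw [h2]
        exact sub_mem (add_mem h3κ hl) (hκfix hζ)
      exact hκm h1
    have h01 : ¬SameOrbit 3 ρ 0 κ := by rwa [sameOrbit_zero_iff]
    have h02 : ¬SameOrbit 3 ρ 0 (-κ) := by rwa [sameOrbit_zero_iff, neg_mem_iff]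
    intro i j hij
    have hji := h.sameOrbit_symm hij
    fin_cases i <;> fin_cases j <;> first | rfl | contradiction
  · intro i
    fin_cases i
    · exact h.card_stabilizer_zero
    · refine h.card_stabilizer dvd_rfl fun j _ => iff_of_true ?_ (dvd_mul_left _ _)
      exact hκfix (by rw [← pow_mul, mul_comm, pow_mul, h.prim.pow_eq_one, one_pow])
    · refine h.card_stabilizer dvd_rfl fun j _ => iff_of_true ?_ (dvd_mul_left _ _)
      change (1 - ρ ^ j) * (-κ) ∈ _
      rw [mul_neg, neg_mem_iff]
      exact hκfix (by rw [← pow_mul, mul_comm, pow_mul, h.prim.pow_eq_one, one_pow])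
  · intro z ζ hζ hne hl
    have hl' : (1 - ρ) * z ∈ rotLattice ρ := by
      obtain ⟨j, hj, rfl⟩ := h.exists_pow hζ
      interval_cases j
      · simp at hne
      · simpa using hl
      · have := neg_mem (h.mul_mem (self_mem_rotLattice ρ) hl)
        rwa [show -(ρ * ((1 - ρ ^ 2) * z)) = (1 - ρ) * z by
          linear_combination (z * ρ - z) * hsq] at this
    obtain ⟨m, n, hmn⟩ := hl'
    have hz : z = (m + n) * κ - n := by
      linear_combination κ * hmn - (n + z) * hκρ
    obtain ⟨r, hr | hr | hr⟩ : ∃ r : ℤ, m + n = 3 * r ∨ m + n = 3 * r + 1 ∨ m + n = 3 * r - 1 := by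
      refine ⟨(m + n + 1) / 3, ?_⟩
      omega
    · refine ⟨0, (sameOrbit_zero_iff 3).mpr ⟨2 * r - n, r, ?_⟩⟩
      have hr' : (m + n : ℂ) = 3 * r := by exact_mod_cast hr
      rw [hz, hr']
      push_cast
      linear_combination r * hκ
    · refine ⟨1, sameOrbit_of_sub_mem 3 ⟨2 * r - n, r, ?_⟩⟩
      have hr' : (m + n : ℂ) = 3 * r + 1 := by exact_mod_cast hr
      change z - κ = _
      rw [hz, hr']
      push_cast
      linear_combination r * hκ
    · refine ⟨2, sameOrbit_of_sub_mem 3 ⟨2 * r - n, r, ?_⟩⟩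
      have hr' : (m + n : ℂ) = 3 * r - 1 := by exact_mod_cast hr
      change z - -κ = _
      rw [hz, hr']
      push_cast
      linear_combination r * hκ

theorem isUnitTriple_char_six (ρ z : ℂ) :
    IsUnitTriple (charFst ρ z * charSnd ρ z) (conj (charSnd ρ z)) (conj (charFst ρ z)) := by
  refine ⟨?_, ?_, ?_, ?_⟩
  · rw [norm_mul, norm_charFst, norm_charSnd, one_mul]
  · rw [RCLike.norm_conj, norm_charSnd]
  · rw [RCLike.norm_conj, norm_charFst]
  · linear_combination conj_mul_self_of_norm_eq_one (norm_charFst ρ z)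
      * (conj (charSnd ρ z) * charSnd ρ z) + conj_mul_self_of_norm_eq_one (norm_charSnd ρ z)

/-- The uniformization of `S²(2,3,6)`: the rotation of order three again permutes a triple
cyclically, and `ρ` itself acts on the invariants of the triple by a half-turn. -/
theorem exists_isUniformization_six (h : IsCrystRotation 6 ρ 1) {X : Type*}
    [TopologicalSpace X] {O : ConeOrbifold X} {x : Fin 3 → X} (hO : O.IsSphereWith ![2, 3, 6] x) :
    ∃ π : ℂ → X, IsUniformization O 6 ρ π := by
  have hsq : ρ ^ 2 = ρ - 1 := by simpa using h.sq
  have hρ3 : ρ ^ 3 = -1 := by linear_combination (ρ + 1) * hsq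
  have hρ4 : ρ ^ 4 = -ρ := by linear_combination ρ * hρ3
  have hρ5 : ρ ^ 5 = 1 - ρ := by linear_combination ρ ^ 2 * hρ3 - hsq
  let σ : ℂ → ℂ := fun z => charFst ρ z * charSnd ρ z + conj (charSnd ρ z) + conj (charFst ρ z)
  let s : ℂ → ℝ := fun z =>
    (altProd (charFst ρ z * charSnd ρ z) (conj (charSnd ρ z)) (conj (charFst ρ z))).im
  let v : ℂ → ℝ × ℂ := fun z => ((σ z).re, ((σ z).im : ℂ) + s z * Complex.I)
  have hcA := continuous_charFst ρ
  have hcB := continuous_charSnd ρ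
  have hcA' : Continuous fun z => conj (charFst ρ z) := Complex.continuous_conj.comp hcA
  have hcB' : Continuous fun z => conj (charSnd ρ z) := Complex.continuous_conj.comp hcB
  have hσc : Continuous σ := by fun_prop
  have hsc : Continuous s := by
    refine Complex.continuous_im.comp ?_
    unfold altProd
    fun_prop
  have hvc : Continuous v := by
    refine (Complex.continuous_re.comp hσc).prodMk ?_
    exact (Complex.continuous_ofReal.comp (Complex.continuous_im.comp hσc)).add
      ((Complex.continuous_ofReal.comp hsc).mul continuous_const)
  have hA : ∀ z, charFst ρ (ρ * z) = conj (charSnd ρ z) := h.charFst_mul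
  have hB : ∀ z, charSnd ρ (ρ * z) = charFst ρ z * charSnd ρ z := by
    intro z
    rw [h.charSnd_mul, zpow_one]
  have hAB : ∀ z, charFst ρ (ρ * z) * charSnd ρ (ρ * z) = charFst ρ z := by
    intro z
    rw [hA, hB]
    linear_combination charFst ρ z * conj_mul_self_of_norm_eq_one (norm_charSnd ρ z)
  have hadd : ∀ z l, l ∈ rotLattice ρ → v (z + l) = v z := by
    intro z l hl
    simp only [v, σ, s, (h.char_add_mem z hl).1, (h.char_add_mem z hl).2]
  have hr : ∀ z, v (ρ * z) = ((v z).1, -(v z).2) := by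
    intro z
    have h1 : σ (ρ * z) = conj (σ z) := by
      simp only [σ]
      rw [hAB, hA, hB]
      simp only [map_add, map_mul, Complex.conj_conj]
      ring
    have h2 : s (ρ * z) = -s z := by
      simp only [s]
      rw [hAB, hA, hB, ← Complex.conj_im]
      simp only [altProd, map_sub, map_mul, Complex.conj_conj]
      congr 1
      ring
    simp only [v, h1, h2, Complex.conj_re, Complex.conj_im]
    refine Prod.ext rfl ?_
    push_cast
    ring
  have horb : ∀ z w, conj (charSnd ρ z) = conj (charSnd ρ w) →
      conj (charFst ρ z) = conj (charFst ρ w) → SameOrbit 6 ρ z w := fun z w h1 h2 =>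
    h.sameOrbit_of_char_eq ((starRingEnd ℂ).injective h2) ((starRingEnd ℂ).injective h1)
  have hA2 : ∀ z, conj (charFst ρ (ρ * (ρ * z))) = charFst ρ z * charSnd ρ z := by
    intro z
    rw [hA, hB, Complex.conj_conj]
  have hB2 : ∀ z, conj (charSnd ρ (ρ * (ρ * z))) = conj (charFst ρ z) := by
    intro z
    rw [hB, hAB]
  have hAB2 : ∀ z, charFst ρ (ρ * (ρ * z)) * charSnd ρ (ρ * (ρ * z)) = conj (charSnd ρ z) := by
    intro z
    rw [hAB, hA]
  -- `κ` is the centre of rotation with `(1 - ρ ^ 2) κ = 1`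
  let κ : ℂ := (1 + ρ) / 3
  have hκ : 3 * κ = 1 + ρ := by simp only [κ]; ring
  have hκρ : (2 - ρ) * κ = 1 := by linear_combination (2 - ρ) / 3 * hκ - hsq / 3
  have hstab : ∀ i, Nat.card {ζ : ℂ // ζ ^ 6 = 1 ∧
      (1 - ζ) * (![1 / 2, κ, 0] : Fin 3 → ℂ) i ∈ rotLattice ρ} = (![2, 3, 6] : Fin 3 → ℕ) i := by
    intro i
    fin_cases i
    · refine h.card_stabilizer (by norm_num) fun j hj => ?_
      change (1 - ρ ^ j) * (1 / 2) ∈ _ ↔ _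
      interval_cases j
      · simp
      · rw [h.mem_rotLattice_iff_dvd 2 1 (-1) (by norm_num) (by push_cast; ring)]
        decide
      · rw [h.mem_rotLattice_iff_dvd 2 2 (-1) (by norm_num)
          (by push_cast; linear_combination -hsq)]
        decide
      · rw [h.mem_rotLattice_iff_dvd 2 2 0 (by norm_num) (by push_cast; linear_combination -hρ3)]
        decide
      · rw [h.mem_rotLattice_iff_dvd 2 1 1 (by norm_num) (by push_cast; linear_combination -hρ4)]
        decide
      · rw [h.mem_rotLattice_iff_dvd 2 0 1 (by norm_num) (by push_cast; linear_combination -hρ5)]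
        decide
    · refine h.card_stabilizer (by norm_num) fun j hj => ?_
      change (1 - ρ ^ j) * κ ∈ _ ↔ _
      interval_cases j
      · simp
      · rw [h.mem_rotLattice_iff_dvd 3 2 (-1) (by norm_num)
          (by push_cast; linear_combination (1 - ρ) * hκ - hsq)]
        decide
      · rw [h.mem_rotLattice_iff_dvd 3 3 0 (by norm_num)
          (by push_cast; linear_combination 3 * hκρ - 3 * κ * hsq)]
        decide
      · rw [h.mem_rotLattice_iff_dvd 3 2 2 (by norm_num)
          (by push_cast; linear_combination 2 * hκ - 3 * κ * hρ3)]
        decide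
      · rw [h.mem_rotLattice_iff_dvd 3 0 3 (by norm_num)
          (by push_cast; linear_combination (1 + ρ) * hκ - 3 * κ * hρ4 + hsq)]
        decide
      · rw [h.mem_rotLattice_iff_dvd 3 (-1) 2 (by norm_num)
          (by push_cast; linear_combination ρ * hκ - 3 * κ * hρ5 + hsq)]
        decide
    · exact h.card_stabilizer_zero
  refine exists_isUniformization_of_halfTurn h hO (c := ![1 / 2, κ, 0]) hvc ?_
    (fun z => hadd z 1 (one_mem_rotLattice ρ)) (fun z => hadd z ρ (self_mem_rotLattice ρ)) hr
    ?_ ?_ ?_ hstab ?_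
  · intro z hz
    rw [Prod.mk_eq_zero] at hz
    have h1 := congrArg Complex.re hz.2
    have h2 := congrArg Complex.im hz.2
    simp only [Complex.add_re, Complex.ofReal_re, Complex.re_ofReal_mul, Complex.I_re, mul_zero,
      add_zero, Complex.zero_re] at h1
    simp only [Complex.add_im, Complex.ofReal_im, Complex.im_ofReal_mul, Complex.I_im, mul_one,
      zero_add, Complex.zero_im] at h2
    exact (isUnitTriple_char_six ρ z).altProd_im_ne_zero_of_sum_eq_zero
      (Complex.ext hz.1 h1) h2
  · intro z w k hk he
    rw [Prod.smul_mk, Prod.mk.injEq, smul_eq_mul, Complex.real_smul] at he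
    have h1 := congrArg Complex.re he.2
    have h2 := congrArg Complex.im he.2
    simp at h1 h2
    have h3 : σ z = k * σ w := Complex.ext (by rw [he.1]; simp) (by rw [h1]; simp)
    rcases (isUnitTriple_char_six ρ z).eq_rotate_of_smul (isUnitTriple_char_six ρ w) hk h3 h2
      with ⟨-, e1, e2⟩ | ⟨-, e1, e2⟩ | ⟨-, e1, e2⟩
    · exact horb z w e1 e2
    · refine h.sameOrbit_mul_iff.mp (h.sameOrbit_mul_iff.mp (horb z (ρ * (ρ * w)) ?_ ?_))
      · rw [e1, hB2]
      · rw [e2, hA2]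
    · refine h.sameOrbit_mul_iff.mp (h.sameOrbit_mul_iff.mp (h.sameOrbit_mul_iff.mp
        (h.sameOrbit_mul_iff.mp (horb z (ρ * (ρ * (ρ * (ρ * w)))) ?_ ?_))))
      · rw [e1, hB2, hA2]
      · rw [e2, hA2, hAB2]
  · rintro ⟨a, w⟩ hu
    obtain ⟨k, hk, a', b, c, hT, h1, h2⟩ := exists_isUnitTriple_smul (σ := ⟨a, w.re⟩)
      (s := w.im) (by
      by_contra! h0
      have h3 := congrArg Complex.re h0.1
      have h4 := congrArg Complex.im h0.1
      exact hu (Prod.ext h3 (Complex.ext h4 h0.2)))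
    obtain ⟨z, hz1, hz2⟩ := h.exists_char_eq (a := conj c) (b := conj b)
      (by rw [RCLike.norm_conj]; exact hT.norm_trd) (by rw [RCLike.norm_conj]; exact hT.norm_snd)
    refine ⟨z, k, hk, ?_⟩
    have ha : charFst ρ z * charSnd ρ z = a' := by
      rw [hz1, hz2, ← map_mul, mul_comm, ← hT.conj_fst, Complex.conj_conj]
    have h3 : σ z = k * ⟨a, w.re⟩ := by
      rw [← h1]
      simp only [σ]
      rw [ha, hz1, hz2, Complex.conj_conj, Complex.conj_conj]
    have h4 : s z = k * w.im := by
      rw [← h2]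
      simp only [s]
      rw [ha, hz1, hz2, Complex.conj_conj, Complex.conj_conj]
    simp only [v]
    rw [h3, h4]
    refine Prod.ext (by simp) ?_
    apply Complex.ext <;> simp
  · intro i j hij
    have h1 := h.card_stabilizer_congr hij
    rw [hstab, hstab] at h1
    revert h1
    fin_cases i <;> fin_cases j <;> simp
  · intro z ζ hζ hne hl
    have key : z ∈ rotLattice ρ ∨ (2 - ρ) * z ∈ rotLattice ρ ∨ 2 * z ∈ rotLattice ρ := by
      obtain ⟨j, hj, rfl⟩ := h.exists_pow hζ
      interval_cases j
      · simp at hne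
      · left
        have := h.mul_mem (self_mem_rotLattice ρ) hl
        rwa [show ρ * ((1 - ρ ^ 1) * z) = z by linear_combination -z * hsq] at this
      · right; left
        rwa [hsq, show 1 - (ρ - 1) = 2 - ρ by ring] at hl
      · right; right
        rwa [hρ3, show 1 - (-1 : ℂ) = 2 by ring] at hl
      · right; left
        have := h.mul_mem (sub_mem (one_mem_rotLattice ρ) (self_mem_rotLattice ρ)) hl
        rwa [hρ4, show (1 - ρ) * ((1 - -ρ) * z) = (2 - ρ) * z by
          linear_combination -z * hsq] at this
      · left
        have := h.mul_mem (sub_mem (one_mem_rotLattice ρ) (self_mem_rotLattice ρ)) hl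
        rwa [hρ5, show (1 - ρ) * ((1 - (1 - ρ)) * z) = z by linear_combination -z * hsq] at this
    have hρ6 : ρ ^ 6 = 1 := h.prim.pow_eq_one
    rcases key with hz | ⟨m, n, hmn⟩ | ⟨m, n, hmn⟩
    · exact ⟨2, (sameOrbit_zero_iff 6).mpr hz⟩
    · have hz : z = (m - n) * κ + n * ρ := by
        linear_combination κ * hmn - z * hκρ + n * (1 + ρ) / 3 * hκ - n * κ * hκ + n / 3 * hsq
      obtain ⟨r, hr | hr | hr⟩ : ∃ r : ℤ,
          m - n = 3 * r ∨ m - n = 3 * r + 1 ∨ m - n = 3 * r - 1 := by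
        refine ⟨(m - n + 1) / 3, ?_⟩
        omega
      · refine ⟨2, (sameOrbit_zero_iff 6).mpr ⟨r, r + n, ?_⟩⟩
        have hr' : (m - n : ℂ) = 3 * r := by exact_mod_cast hr
        rw [hz, hr']
        push_cast
        linear_combination r * hκ
      · refine ⟨1, sameOrbit_of_sub_mem 6 ⟨r, r + n, ?_⟩⟩
        have hr' : (m - n : ℂ) = 3 * r + 1 := by exact_mod_cast hr
        change z - κ = _
        rw [hz, hr']
        push_cast
        linear_combination r * hκ
      · refine ⟨1, -1, by norm_num, r + r * ρ + n * ρ, ⟨r, r + n, by push_cast; ring⟩, ?_⟩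
        have hr' : (m - n : ℂ) = 3 * r - 1 := by exact_mod_cast hr
        change z = -1 * κ + _
        rw [hz, hr']
        linear_combination r * hκ
    · rcases Int.even_or_odd' m with ⟨a, rfl | rfl⟩ <;>
        rcases Int.even_or_odd' n with ⟨b, rfl | rfl⟩ <;> push_cast at hmn
      · exact ⟨2, (sameOrbit_zero_iff 6).mpr ⟨a, b, by linear_combination hmn / 2⟩⟩
      · refine ⟨0, ρ, hρ6, a + b * ρ, ⟨a, b, rfl⟩, ?_⟩
        change z = ρ * (1 / 2) + _
        linear_combination hmn / 2
      · refine ⟨0, 1, one_pow _, a + b * ρ, ⟨a, b, rfl⟩, ?_⟩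
        change z = 1 * (1 / 2) + _
        linear_combination hmn / 2
      · refine ⟨0, ρ ^ 2, by rw [← pow_mul, mul_comm, pow_mul, hρ6, one_pow], (a + 1) + b * ρ,
          ⟨a + 1, b, by push_cast; ring⟩, ?_⟩
        change z = ρ ^ 2 * (1 / 2) + _
        linear_combination hmn / 2 - hsq / 2

/-- The uniformization of `S²(2,4,4)`: the invariants of the half-turns are the cosines of the two
coordinates and the product of their sines, and `ρ` acts on them by a half-turn. -/
theorem exists_isUniformization_four (h : IsCrystRotation 4 ρ 0) {X : Type*}
    [TopologicalSpace X] {O : ConeOrbifold X} {x : Fin 3 → X} (hO : O.IsSphereWith ![2, 4, 4] x) :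
    ∃ π : ℂ → X, IsUniformization O 4 ρ π := by
  have hsq : ρ ^ 2 = -1 := by simpa using h.sq
  have hρ3 : ρ ^ 3 = -ρ := by linear_combination ρ * hsq
  have hρ4 : ρ ^ 4 = 1 := h.prim.pow_eq_one
  let v : ℂ → ℝ × ℂ := fun z => ((charFst ρ z).re + (charSnd ρ z).re,
    (((charFst ρ z).re - (charSnd ρ z).re : ℝ) : ℂ) +
      ((charFst ρ z).im * (charSnd ρ z).im : ℝ) * Complex.I)
  have hcA := continuous_charFst ρ
  have hcB := continuous_charSnd ρ
  have hvc : Continuous v := by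
    have h1 := Complex.continuous_re.comp hcA
    have h2 := Complex.continuous_re.comp hcB
    have h3 := Complex.continuous_im.comp hcA
    have h4 := Complex.continuous_im.comp hcB
    exact (h1.add h2).prodMk ((Complex.continuous_ofReal.comp (h1.sub h2)).add
      ((Complex.continuous_ofReal.comp (h3.mul h4)).mul continuous_const))
  have hA : ∀ z, charFst ρ (ρ * z) = conj (charSnd ρ z) := h.charFst_mul
  have hB : ∀ z, charSnd ρ (ρ * z) = charFst ρ z := by
    intro z
    rw [h.charSnd_mul, zpow_zero, mul_one]
  have hadd : ∀ z l, l ∈ rotLattice ρ → v (z + l) = v z := by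
    intro z l hl
    simp only [v, (h.char_add_mem z hl).1, (h.char_add_mem z hl).2]
  have hr : ∀ z, v (ρ * z) = ((v z).1, -(v z).2) := by
    intro z
    simp only [v, hA, hB, Complex.conj_re, Complex.conj_im]
    refine Prod.ext (add_comm _ _) ?_
    push_cast
    ring
  let κ : ℂ := (1 + ρ) / 2
  have hκ : 2 * κ = 1 + ρ := by simp only [κ]; ring
  have hstab : ∀ i, Nat.card {ζ : ℂ // ζ ^ 4 = 1 ∧
      (1 - ζ) * (![1 / 2, 0, κ] : Fin 3 → ℂ) i ∈ rotLattice ρ} = (![2, 4, 4] : Fin 3 → ℕ) i := by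
    intro i
    fin_cases i
    · refine h.card_stabilizer (by norm_num) fun j hj => ?_
      change (1 - ρ ^ j) * (1 / 2) ∈ _ ↔ _
      interval_cases j
      · simp
      · rw [h.mem_rotLattice_iff_dvd 2 1 (-1) (by norm_num) (by push_cast; ring)]
        decide
      · rw [h.mem_rotLattice_iff_dvd 2 2 0 (by norm_num) (by push_cast; linear_combination -hsq)]
        decide
      · rw [h.mem_rotLattice_iff_dvd 2 1 1 (by norm_num) (by push_cast; linear_combination -hρ3)]
        decide
    · exact h.card_stabilizer_zero
    · refine h.card_stabilizer dvd_rfl fun j hj => iff_of_true ?_ (dvd_mul_left _ _)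
      change (1 - ρ ^ j) * κ ∈ _
      interval_cases j
      · simp
      · exact ⟨1, 0, by push_cast; linear_combination (1 - ρ) / 2 * hκ - hsq / 2⟩
      · exact ⟨1, 1, by push_cast; linear_combination hκ - κ * hsq⟩
      · exact ⟨0, 1, by push_cast; linear_combination (1 + ρ) / 2 * hκ - κ * hρ3 + hsq / 2⟩
  refine exists_isUniformization_of_halfTurn h hO (c := ![1 / 2, 0, κ]) hvc ?_
    (fun z => hadd z 1 (one_mem_rotLattice ρ)) (fun z => hadd z ρ (self_mem_rotLattice ρ)) hr
    ?_ ?_ ?_ hstab ?_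
  · intro z hz
    rw [Prod.mk_eq_zero] at hz
    have h1 := congrArg Complex.re hz.2
    have h2 := congrArg Complex.im hz.2
    simp at h1 h2
    have ea := re_sq_add_im_sq_of_norm_eq_one (norm_charFst ρ z)
    have eb := re_sq_add_im_sq_of_norm_eq_one (norm_charSnd ρ z)
    have h3 : (charFst ρ z).re = 0 := by linarith [hz.1]
    have h4 : (charSnd ρ z).re = 0 := by linarith [hz.1]
    rcases h2 with h2 | h2
    · rw [h2, h3] at ea; norm_num at ea
    · rw [h2, h4] at eb; norm_num at eb
  · intro z w k hk he
    rw [Prod.smul_mk, Prod.mk.injEq, smul_eq_mul, Complex.real_smul] at he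
    have h1 := congrArg Complex.re he.2
    have h2 := congrArg Complex.im he.2
    simp at h1 h2
    rcases eq_or_eq_conj_of_smul (norm_charFst ρ z) (norm_charSnd ρ z) (norm_charFst ρ w)
      (norm_charSnd ρ w) hk (by linarith [he.1]) (by linarith [he.1]) h2 with ⟨e1, e2⟩ | ⟨e1, e2⟩
    · exact h.sameOrbit_of_char_eq e1 e2
    · rw [← (h.char_neg w).1] at e1
      rw [← (h.char_neg w).2] at e2
      have := h.sameOrbit_of_char_eq e1 e2
      rw [show -w = ρ * (ρ * w) by linear_combination -w * hsq] at this
      exact h.sameOrbit_mul_iff.mp (h.sameOrbit_mul_iff.mp this)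
  · rintro ⟨a, w⟩ hu
    obtain ⟨k, hk, α, β, hα, hβ, h1, h2, h3⟩ := exists_norm_eq_one_smul
      (x := (a + w.re) / 2) (y := (a - w.re) / 2) (s := w.im) (by
      by_contra! h0
      exact hu (Prod.ext (by simp only [Prod.fst_zero]; linarith [h0.1, h0.2.1])
        (Complex.ext (by simp only [Prod.snd_zero, Complex.zero_re]; linarith [h0.1, h0.2.1])
          h0.2.2)))
    obtain ⟨z, hz1, hz2⟩ := h.exists_char_eq hα hβ
    refine ⟨z, k, hk, ?_⟩
    simp only [v]
    rw [hz1, hz2, h1, h2, h3]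
    refine Prod.ext (by simp only [Prod.smul_fst, smul_eq_mul]; ring) ?_
    apply Complex.ext
    · simp; ring
    · simp
  · have h12 : ¬SameOrbit 4 ρ 0 κ := by
      rw [sameOrbit_zero_iff, h.mem_rotLattice_iff_dvd 2 1 1 (by norm_num)
        (by push_cast; linear_combination hκ)]
      decide
    intro i j hij
    have h1 := h.card_stabilizer_congr hij
    have hji := h.sameOrbit_symm hij
    rw [hstab, hstab] at h1
    fin_cases i <;> fin_cases j <;> first | rfl | contradiction
  · intro z ζ hζ hne hl
    obtain ⟨m, n, hmn⟩ : 2 * z ∈ rotLattice ρ := by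
      obtain ⟨j, hj, rfl⟩ := h.exists_pow hζ
      interval_cases j
      · simp at hne
      · have := h.mul_mem (add_mem (one_mem_rotLattice ρ) (self_mem_rotLattice ρ)) hl
        rwa [show (1 + ρ) * ((1 - ρ ^ 1) * z) = 2 * z by linear_combination -z * hsq] at this
      · rwa [hsq, show 1 - (-1 : ℂ) = 2 by ring] at hl
      · have := h.mul_mem (sub_mem (one_mem_rotLattice ρ) (self_mem_rotLattice ρ)) hl
        rwa [hρ3, show (1 - ρ) * ((1 - -ρ) * z) = 2 * z by linear_combination -z * hsq] at this
    rcases Int.even_or_odd' m with ⟨a, rfl | rfl⟩ <;> rcases Int.even_or_odd' n with ⟨b, rfl | rfl⟩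
      <;> push_cast at hmn
    · exact ⟨1, (sameOrbit_zero_iff 4).mpr ⟨a, b, by linear_combination hmn / 2⟩⟩
    · refine ⟨0, ρ, hρ4, a + b * ρ, ⟨a, b, rfl⟩, ?_⟩
      change z = ρ * (1 / 2) + _
      linear_combination hmn / 2
    · refine ⟨0, 1, one_pow _, a + b * ρ, ⟨a, b, rfl⟩, ?_⟩
      change z = 1 * (1 / 2) + _
      linear_combination hmn / 2
    · refine ⟨2, sameOrbit_of_sub_mem 4 ⟨a, b, ?_⟩⟩
      change z - κ = _
      linear_combination hmn / 2 - hκ / 2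

end IsCrystRotation

/-! ### Degrees and covering data -/

theorem isCrystRotation_three :
    IsCrystRotation 3 (Complex.exp (2 * Real.pi * Complex.I / (3 : ℕ))) (-1) := by
  have hp := Complex.isPrimitiveRoot_exp 3 (by norm_num)
  refine ⟨hp, le_rfl, ?_⟩
  generalize Complex.exp (2 * Real.pi * Complex.I / (3 : ℕ)) = ρ at *
  have h1 : ρ - 1 ≠ 0 := sub_ne_zero.mpr (hp.ne_one (by norm_num))
  refine mul_left_cancel₀ h1 ?_
  push_cast
  linear_combination hp.pow_eq_one

theorem isCrystRotation_four :
    IsCrystRotation 4 (Complex.exp (2 * Real.pi * Complex.I / (4 : ℕ))) 0 := by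
  have hp := Complex.isPrimitiveRoot_exp 4 (by norm_num)
  refine ⟨hp, by norm_num, ?_⟩
  generalize Complex.exp (2 * Real.pi * Complex.I / (4 : ℕ)) = ρ at *
  have h1 : ρ ^ 2 - 1 ≠ 0 :=
    sub_ne_zero.mpr (hp.pow_ne_one_of_pos_of_lt (by norm_num) (by norm_num))
  refine mul_left_cancel₀ h1 ?_
  push_cast
  linear_combination hp.pow_eq_one

theorem isCrystRotation_six :
    IsCrystRotation 6 (Complex.exp (2 * Real.pi * Complex.I / (6 : ℕ))) 1 := by
  have hp := Complex.isPrimitiveRoot_exp 6 (by norm_num)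
  refine ⟨hp, by norm_num, ?_⟩
  generalize Complex.exp (2 * Real.pi * Complex.I / (6 : ℕ)) = ρ at *
  have h1 : (ρ ^ 3 - 1) * (ρ + 1) ≠ 0 := by
    refine mul_ne_zero
      (sub_ne_zero.mpr (hp.pow_ne_one_of_pos_of_lt (by norm_num) (by norm_num))) fun h0 => ?_
    refine hp.pow_ne_one_of_pos_of_lt (l := 2) (by norm_num) (by norm_num) ?_
    linear_combination (ρ - 1) * h0
  refine mul_left_cancel₀ h1 ?_
  push_cast
  linear_combination hp.pow_eq_one

theorem modEq_one_of_eq_loeschian {d : ℕ} (hd : d.Coprime 3) {m n : ℤ}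
    (h : (d : ℤ) = m ^ 2 + m * n + n ^ 2) : d ≡ 1 [MOD 3] := by
  have h3 : ¬3 ∣ d := fun h3 => by
    have := Nat.dvd_gcd h3 dvd_rfl
    rw [hd] at this
    omega
  have key : ((d : ZMod 3)) = (m : ZMod 3) ^ 2 + m * n + (n : ZMod 3) ^ 2 := by
    have := congrArg (Int.cast : ℤ → ZMod 3) h
    push_cast at this
    exact this
  rw [← ZMod.natCast_eq_zero_iff] at h3
  rw [← ZMod.natCast_eq_natCast_iff]
  rw [key] at h3 ⊢
  clear h key hd
  generalize (m : ZMod 3) = a at *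
  generalize (n : ZMod 3) = b at *
  revert a b
  rw [Nat.cast_one]
  decide

theorem modEq_one_of_eq_sq_add_sq {d : ℕ} (hd : d.Coprime 4) {m n : ℤ}
    (h : (d : ℤ) = m ^ 2 + n ^ 2) : d ≡ 1 [MOD 4] := by
  have h2 : d % 2 = 1 := by
    rw [← Nat.odd_iff, ← Nat.coprime_two_right]
    exact Nat.Coprime.coprime_dvd_right (by norm_num) hd
  rcases Int.even_or_odd' m with ⟨a, rfl | rfl⟩ <;>
    rcases Int.even_or_odd' n with ⟨b, rfl | rfl⟩ <;> ring_nf at h <;>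
    simp only [Nat.ModEq] <;> omega

theorem ConeOrbifold.IsSphereWith.hasCoveringData {X : Type*} [TopologicalSpace X]
    {O : ConeOrbifold X} {x : Fin 3 → X} {a b c Q n d : ℕ} (hO : O.IsSphereWith ![a, b, c] x)
    {f : X → X} (hf : O.IsCovering O f) (hd : O.HasDegree f d) (i : Fin 3)
    (hi : (![a, b, c] : Fin 3 → ℕ) i = Q) (hQ : 0 < Q) (hdn : d = Q * n + 1)
    (harith : ∀ u v w N : ℕ, (u = 0 ∨ u * a = Q) → (v = 0 ∨ v * b = Q) → (w = 0 ∨ w * c = Q) →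
      Q * N + (u + v + w) = Q * n + 1 →
      (u = 1 ∧ v = 0 ∧ w = 0) ∨ (u = 0 ∧ v = 1 ∧ w = 0) ∨ (u = 0 ∧ v = 0 ∧ w = 1)) :
    HasCoveringData f (x i) (Multiset.replicate n Q + {1}) := by
  refine hasCoveringData_of_arith hO hf hd hdn ((hO.index_eq i).trans hi) hQ fun ε N hε hN => ?_
  rcases harith (ε 0) (ε 1) (ε 2) N (hε 0) (hε 1) (hε 2) hN with h | h | h
  · exact ⟨0, h.1, by simp [Fin.forall_fin_succ, h]⟩
  · exact ⟨1, h.2.1, by simp [Fin.forall_fin_succ, h]⟩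
  · exact ⟨2, h.2.2, by simp [Fin.forall_fin_succ, h]⟩

theorem mainTheorem5 {X : Type*} [TopologicalSpace X] (O : ConeOrbifold X) (x : Fin 3 → X) :
    -- (1)  the orbifold S²(2,3,6)
    (O.IsSphereWith ![2, 3, 6] x →
      (∀ f : X → X, O.IsCovering O f → ∃ d : ℕ, O.HasDegree f d) ∧
      O.selfCoveringDegrees =
        {d : ℕ | ∃ m n : ℤ, (m, n) ≠ (0, 0) ∧ (d : ℤ) = m ^ 2 + m * n + n ^ 2} ∧
      (∀ d ∈ O.selfCoveringDegrees, d.Coprime 6 → d ≡ 1 [MOD 6]) ∧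
      (∀ (f : X → X) (k : ℕ), O.IsCovering O f → O.HasDegree f (6 * k + 1) →
        ConeOrbifold.HasCoveringData f (x 0) (Multiset.replicate (3 * k) 2 + {1}) ∧
        ConeOrbifold.HasCoveringData f (x 1) (Multiset.replicate (2 * k) 3 + {1}) ∧
        ConeOrbifold.HasCoveringData f (x 2) (Multiset.replicate k 6 + {1}))) ∧
    -- (2)  the orbifold S²(3,3,3)
    (O.IsSphereWith ![3, 3, 3] x →
      (∀ f : X → X, O.IsCovering O f → ∃ d : ℕ, O.HasDegree f d) ∧
      O.selfCoveringDegrees =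
        {d : ℕ | ∃ m n : ℤ, (m, n) ≠ (0, 0) ∧ (d : ℤ) = m ^ 2 + m * n + n ^ 2} ∧
      (∀ d ∈ O.selfCoveringDegrees, d.Coprime 3 → d ≡ 1 [MOD 3]) ∧
      (∀ (f : X → X) (k : ℕ), O.IsCovering O f → O.HasDegree f (3 * k + 1) →
        ConeOrbifold.HasCoveringData f (x 0) (Multiset.replicate k 3 + {1}) ∧
        ConeOrbifold.HasCoveringData f (x 1) (Multiset.replicate k 3 + {1}) ∧
        ConeOrbifold.HasCoveringData f (x 2) (Multiset.replicate k 3 + {1}))) ∧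
    -- (3)  the orbifold S²(2,4,4)
    (O.IsSphereWith ![2, 4, 4] x →
      (∀ f : X → X, O.IsCovering O f → ∃ d : ℕ, O.HasDegree f d) ∧
      O.selfCoveringDegrees =
        {d : ℕ | ∃ m n : ℤ, (m, n) ≠ (0, 0) ∧ (d : ℤ) = m ^ 2 + n ^ 2} ∧
      (∀ d ∈ O.selfCoveringDegrees, d.Coprime 4 → d ≡ 1 [MOD 4]) ∧
      (∀ (f : X → X) (k : ℕ), O.IsCovering O f → O.HasDegree f (4 * k + 1) →
        ConeOrbifold.HasCoveringData f (x 0) (Multiset.replicate (2 * k) 2 + {1}) ∧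
        ConeOrbifold.HasCoveringData f (x 1) (Multiset.replicate k 4 + {1}) ∧
        ConeOrbifold.HasCoveringData f (x 2) (Multiset.replicate k 4 + {1}))) := by
  refine ⟨fun hO => ?_, fun hO => ?_, fun hO => ?_⟩
  · have h := isCrystRotation_six
    obtain ⟨π, hπ⟩ := h.exists_isUniformization_six hO
    have hdeg : O.selfCoveringDegrees =
        {d : ℕ | ∃ m n : ℤ, (m, n) ≠ (0, 0) ∧ (d : ℤ) = m ^ 2 + m * n + n ^ 2} := by
      rw [hπ.selfCoveringDegrees_eq h]
      simp only [one_mul]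
    refine ⟨fun f hf => ?_, hdeg, fun d hd hc => ?_, fun f k hf hd => ?_⟩
    · obtain ⟨m, n, -, hd⟩ := hπ.exists_hasDegree h hf
      exact ⟨_, hd⟩
    · rw [hdeg] at hd
      obtain ⟨m, n, -, hmn⟩ := hd
      have h3 := modEq_one_of_eq_loeschian (hc.coprime_dvd_right (by norm_num)) hmn
      have h2 : d % 2 = 1 := by
        rw [← Nat.odd_iff, ← Nat.coprime_two_right]
        exact hc.coprime_dvd_right (by norm_num)
      simp only [Nat.ModEq] at h3 ⊢
      omega
    · exact ⟨hO.hasCoveringData hf hd 0 rfl (by norm_num) (by ring) (by omega),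
        hO.hasCoveringData hf hd 1 rfl (by norm_num) (by ring) (by omega),
        hO.hasCoveringData hf hd 2 rfl (by norm_num) (by ring) (by omega)⟩
  · have h := isCrystRotation_three
    obtain ⟨π, hπ⟩ := h.exists_isUniformization_three hO
    have hdeg : O.selfCoveringDegrees =
        {d : ℕ | ∃ m n : ℤ, (m, n) ≠ (0, 0) ∧ (d : ℤ) = m ^ 2 + m * n + n ^ 2} := by
      rw [hπ.selfCoveringDegrees_eq h]
      ext d
      constructor
      · rintro ⟨m, n, hmn, hd⟩
        exact ⟨m, -n, by simpa using hmn, by rw [hd]; ring⟩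
      · rintro ⟨m, n, hmn, hd⟩
        exact ⟨m, -n, by simpa using hmn, by rw [hd]; ring⟩
    refine ⟨fun f hf => ?_, hdeg, fun d hd hc => ?_, fun f k hf hd => ?_⟩
    · obtain ⟨m, n, -, hd⟩ := hπ.exists_hasDegree h hf
      exact ⟨_, hd⟩
    · rw [hdeg] at hd
      obtain ⟨m, n, -, hmn⟩ := hd
      exact modEq_one_of_eq_loeschian hc hmn
    · exact ⟨hO.hasCoveringData hf hd 0 rfl (by norm_num) (by ring) (by omega),
        hO.hasCoveringData hf hd 1 rfl (by norm_num) (by ring) (by omega),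
        hO.hasCoveringData hf hd 2 rfl (by norm_num) (by ring) (by omega)⟩
  · have h := isCrystRotation_four
    obtain ⟨π, hπ⟩ := h.exists_isUniformization_four hO
    have hdeg : O.selfCoveringDegrees =
        {d : ℕ | ∃ m n : ℤ, (m, n) ≠ (0, 0) ∧ (d : ℤ) = m ^ 2 + n ^ 2} := by
      rw [hπ.selfCoveringDegrees_eq h]
      simp only [zero_mul, add_zero]
    refine ⟨fun f hf => ?_, hdeg, fun d hd hc => ?_, fun f k hf hd => ?_⟩
    · obtain ⟨m, n, -, hd⟩ := hπ.exists_hasDegree h hf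
      exact ⟨_, hd⟩
    · rw [hdeg] at hd
      obtain ⟨m, n, -, hmn⟩ := hd
      exact modEq_one_of_eq_sq_add_sq hc hmn
    · exact ⟨hO.hasCoveringData hf hd 0 rfl (by norm_num) (by ring) (by omega),
        hO.hasCoveringData hf hd 1 rfl (by norm_num) (by ring) (by omega),
        hO.hasCoveringData hf hd 2 rfl (by norm_num) (by ring) (by omega)⟩
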